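/- Let $\gamma>0$, $v_0,V^0>0$, and let $g:[0,\infty)\to\mathbb R$ be a monotonically decreasing differentiable function with bounded derivative and $-V^0\le g\le -v_0$. Consider the free-interface problem for $u(x,t)$ and $s(t)=\int_0^t v(\tau)\,d\tau$: $$u_t=u_{xx}-\gamma u\ (x\ne s(t)),\quad u(x,0)=u_0(x)\ge 0,\quad g(u(s(t),t))=v(t),\quad u_x(s(t)^+,t)-u_x(s(t)^-,t)=v(t),$$ understood through its potential representation: with $G(x,t,\xi,\tau)=\exp\{-\frac{(x-\xi)^2}{4(t-\tau)}\}\,[4\pi(t-\tau)]^{-1/2}$, $$u(x,t)=e^{-\gamma t}\int_{-\infty}^{\infty}G(x,t,\xi,0)u_0(\xi)\,d\xi-\int_0^tG(x,t,s(\tau),\tau)e^{-\gamma(t-\tau)}v(\tau)\,d\tau\qquad(t>0),$$ where $v$ is continuous on $[0,\infty)$ and, for all $t>0$, $u(s(t),t)\ge0$ and $v(t)=g(u(s(t),t))$. For $\alpha\ge 0$ put $|f|_\alpha=\sup_x e^{\alpha|x|}|f(x)|$ and $C_\alpha=\{f\in C(\mathbb R):|f|_\alpha<\infty\}$. Let $C^1_\alpha$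 be the set of $f\in C_\alpha$ whose restrictions to $(-\infty,0]$ and to $[0,\infty)$ are continuously differentiable (one-sidedly at $0$; $f_x$ may jump at the interface $x=0$) with $|f_x|_\alpha<\infty$; here and below $|f_x|_\alpha$ is the supremum of $e^{\alpha|x|}|f_x(x)|$ over $x\neq0$. The phase space is $\{u\in C_\alpha: u\ge0\}$ with the metric of $C_\alpha$. The semigroup in the frame attached to the interface is $T(0)u_0=u_0$ and $(T(t)u_0)(x)=u(x+s(t),t)$ for $t>0$. For a fixed $\delta>0$ let $\mathcal A_\alpha$ be the attractor, i.e. the $\omega$-limit set $\bigcap_{\tau}\overline{\bigcup_{t\ge\tau}T(t)B}$ of the absorbing ball $B=\{u\in C_\alpha:u\ge0,\ |u|_\alpha\le V^0/\sqrt\gamma+\delta\}$. Put $$\alpha'_{\min}=\min\Big(\frac{v_0}{8},\frac{\gamma}{2V^0}\Big),\qquad \mathcal M(v_0,V^0,\alpha,\gamma)=V^0\max\Big[\frac{8}{e\,v_0},\ \frac12\Big(1+\frac{V^0}{v_0}\Big)e^{\alpha},\ \frac{2}{\sqrt\gamma}+6\Big].$$ **Theorem.** Let $0\le\alpha<\alpha'_{\min}$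 and $\delta>0$. For every $u_0$ in the phase space there is exactly one velocity $v$ on $[0,\infty)$ as above, so that $T(t)$ is well defined, and: 1. $T(t)\mathcal A_\alpha=\mathcal A_\alpha$ for every $t\ge0$: the semigroup maps the attractor onto itself. 2. Every $\phi\in\mathcal A_\alpha$ is differentiable at each $x\ne0$ and has one-sided derivatives at $x=0$, and $$|\phi|_\alpha\le\frac{V^0}{\sqrt\gamma},\qquad |\phi_x|_\alpha\le\mathcal M(v_0,V^0,\alpha,\gamma)\le\mathcal M(v_0,V^0,\alpha'_{\min},\gamma).$$ 3. For every $\varepsilon>0$ with $\alpha\le\beta:=\alpha'_{\min}-\varepsilon$, one has $\mathcal A_\alpha\subset C^1_\beta$. -/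

import Mathlib

open Set MeasureTheory
open scoped ENNReal

namespace FreeInterface

noncomputable section

/-- The kinetic function: `g` on `[0, ∞)` is differentiable (one-sidedly at `0`), has a bounded
derivative, is monotonically decreasing and takes its values in `[-V, -v₀]`.  The values of `g` at
negative arguments are irrelevant. -/
structure IsKinetics (v₀ V : ℝ) (g : ℝ → ℝ) : Prop where
  differentiableOn : DifferentiableOn ℝ g (Ici 0)
  bounded_deriv : ∃ C : ℝ, ∀ u ∈ Ici (0 : ℝ), |derivWithin g (Ici 0) u| ≤ C
  antitoneOn : AntitoneOn g (Ici 0)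
  bounds : ∀ u ∈ Ici (0 : ℝ), -V ≤ g u ∧ g u ≤ -v₀

/-- The heat kernel `G(x,t,ξ,τ)`, for `τ < t`. -/
def heatKernel (x t ξ τ : ℝ) : ℝ :=
  Real.exp (-(x - ξ) ^ 2 / (4 * (t - τ))) / √(4 * Real.pi * (t - τ))

/-- Position `s(t)` of the interface that moves with velocity `v` and starts at `0`. -/
def front (v : ℝ → ℝ) (t : ℝ) : ℝ := ∫ τ in (0 : ℝ)..t, v τ

/-- The temperature `u(x,t)`, `t > 0`, in the laboratory frame, that is produced by the initial
temperature `u₀` and by an interface of velocity `v` (heat potential of `u₀` plus single layer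
potential of the interface, with heat losses `γ`). -/
def temperature (γ : ℝ) (v u₀ : ℝ → ℝ) (x t : ℝ) : ℝ :=
  Real.exp (-γ * t) * (∫ ξ, heatKernel x t ξ 0 * u₀ ξ)
    - ∫ τ in (0 : ℝ)..t, heatKernel x t (front v τ) τ * Real.exp (-γ * (t - τ)) * v τ

/-- `v` is the interface velocity of the solution with initial temperature `u₀`: it is continuous
on `[0, ∞)` and solves the integral equation `v(t) = g(u(s(t),t))`, the interface temperature
staying in the domain `[0, ∞)` of `g`. -/
structure IsVelocity (γ : ℝ) (g u₀ v : ℝ → ℝ) : Prop where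
  continuousOn : ContinuousOn v (Ici 0)
  nonneg : ∀ t : ℝ, 0 < t → 0 ≤ temperature γ v u₀ (front v t) t
  kinetics : ∀ t : ℝ, 0 < t → v t = g (temperature γ v u₀ (front v t) t)

/-- The interface velocity of the solution with initial temperature `u₀`. -/
def velocity (γ : ℝ) (g u₀ : ℝ → ℝ) : ℝ → ℝ :=
  Classical.epsilon (IsVelocity γ g u₀)

/-- The semigroup `T(t)`: initial temperature to temperature at time `t`, in the coordinate
`x - s(t)` attached to the interface. -/
def semigroup (γ : ℝ) (g : ℝ → ℝ) (t : ℝ) (u₀ : ℝ → ℝ) : ℝ → ℝ := fun x =>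
  if t ≤ 0 then u₀ x
  else temperature γ (velocity γ g u₀) u₀ (x + front (velocity γ g u₀) t) t

/-- The weighted uniform norm `|f|_α = sup_x exp(α|x|) |f x|`, with the value `∞` allowed. -/
def wnorm (α : ℝ) (f : ℝ → ℝ) : ℝ≥0∞ :=
  ⨆ x : ℝ, ENNReal.ofReal (Real.exp (α * |x|) * |f x|)

/-- The weighted uniform norm of a function that is defined off the interface `x = 0`. -/
def wnormOff (α : ℝ) (f : ℝ → ℝ) : ℝ≥0∞ :=
  ⨆ (x : ℝ) (_ : x ≠ 0), ENNReal.ofReal (Real.exp (α * |x|) * |f x|)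

/-- The space `C_α`. -/
def spaceC (α : ℝ) : Set (ℝ → ℝ) := {f | Continuous f ∧ wnorm α f < ∞}

/-- The space `C¹_α`: functions in `C_α` that are continuously differentiable on either side of the
interface, up to the interface, with derivative of finite weighted norm.  The derivative may jump
at the interface `x = 0`. -/
def spaceC1 (α : ℝ) : Set (ℝ → ℝ) :=
  {f | f ∈ spaceC α ∧ ContDiffOn ℝ 1 f (Iic 0) ∧ ContDiffOn ℝ 1 f (Ici 0) ∧
    wnormOff α (deriv f) < ∞}

/-- The phase space: the nonnegative elements of `C_α`. -/
def phaseSpace (α : ℝ) : Set (ℝ → ℝ) := {f | f ∈ spaceC α ∧ ∀ x, 0 ≤ f x}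

/-- The absorbing ball of radius `V / √γ + δ` in the phase space. -/
def absorbingBall (γ V α δ : ℝ) : Set (ℝ → ℝ) :=
  {f | f ∈ phaseSpace α ∧ wnorm α f ≤ ENNReal.ofReal (V / √γ + δ)}

/-- The `ω`-limit set of `B` in the phase space with the metric of `C_α`: the intersection over
`τ` of the closures of `⋃ t ≥ τ, T(t) B`. -/
def omegaLimitSet (γ : ℝ) (g : ℝ → ℝ) (α : ℝ) (B : Set (ℝ → ℝ)) : Set (ℝ → ℝ) :=
  {φ | φ ∈ phaseSpace α ∧ ∀ τ : ℝ, ∀ η : ℝ, 0 < η → ∃ t : ℝ, τ ≤ t ∧ ∃ u ∈ B,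
    wnorm α (fun x => semigroup γ g t u x - φ x) < ENNReal.ofReal η}

/-- The attractor `𝒜_α`: the `ω`-limit set of the absorbing ball. -/
def attractor (γ V : ℝ) (g : ℝ → ℝ) (α δ : ℝ) : Set (ℝ → ℝ) :=
  omegaLimitSet γ g α (absorbingBall γ V α δ)

/-- The exponent `α'_min`. -/
def alphaMin (v₀ V γ : ℝ) : ℝ := min (v₀ / 8) (γ / (2 * V))

/-- The constant `ℳ(v₀, V, α, γ)`. -/
def derivBound (v₀ V α γ : ℝ) : ℝ :=
  V * max (8 / (Real.exp 1 * v₀)) (max (1 / 2 * (1 + V / v₀) * Real.exp α) (2 / √γ + 6))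

end

end FreeInterface

open Filter Topology

namespace FreeInterface

noncomputable section

/-! In the frame of the interface the temperature is `profile`: the heat potential of the initial
state, damped by `exp (-γ t)`, plus the single layer potential `layer` of the interface. Everything
rests on the fact that the interface moves to the left with speed between `v₀` and `V`, so that at
elapsed time `σ` in the past its displacement `depth` lies between `v₀ σ` and `V σ`. A weight `exp
(β |x|)` with `β ≤ alphaMin` is then paid for by part of the heat loss and less than half of the
Gaussian exponent (`exponent_le`). This gives bounds for the layer and for its slope that depend
neither on the time nor on the history: `weighted_layer_le` and `weighted_layerDeriv_le`.

The velocity is a fixed point of `v ↦ g (profile v)` at the interface. This map contracts by the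
factor `1/2` in a norm weighted by `exp (l t)` with `l` large (`abs_kineticStep_sub_le`), whence
existence, uniqueness and Lipschitz dependence on the initial state. The semigroup law
(`semigroup_add`) is Chapman–Kolmogorov for the heat kernel.

For invariance of the attractor, the heat part dies out, while layers are uniformly Hölder
continuous and decay at the rate `alphaMin`, strictly faster than `α`; hence sequences of states at
times tending to infinity have limit points (`exists_limit_state`). The semigroup is continuous at
states with this faster decay (`exists_semigroup_close`), and attractor elements have it
(`attractor_weighted_le`). The usual argument for `ω`-limit sets then yields both inclusions.

By invariance every attractor element is, for each `t > 0`, the profile at time `t` of a state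
bounded by `V / √γ`. One value of `t` gives one-sided smoothness, the limits of the slope at the
interface coming from the parabolic rescaling `σ = x² s`. Letting `t → ∞` removes the heat part from
the slope estimate and leaves `V (2 + V / (3 v₀))`, which is at most `ℳ` (`slope_const_le`). -/

/-- The heat kernel as a function of the elapsed time and of the displacement. -/
def gauss (s y : ℝ) : ℝ := Real.exp (-y ^ 2 / (4 * s)) / √(4 * Real.pi * s)

/-! ### Pointwise estimates of the heat kernel. -/

lemma heatKernel_eq_gauss (x t ξ τ : ℝ) : heatKernel x t ξ τ = gauss (t - τ) (x - ξ) := rfl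

lemma gauss_nonneg (s y : ℝ) : 0 ≤ gauss s y := by unfold gauss; positivity

lemma gauss_eq (s y : ℝ) :
    gauss s y = Real.exp (-y ^ 2 / (4 * s)) * (1 / √(4 * Real.pi)) * (1 / √s) := by
  unfold gauss
  rw [Real.sqrt_mul (by positivity)]
  field_simp

lemma one_div_sqrt_four_pi_le : 1 / √(4 * Real.pi) ≤ 1 := by
  rw [div_le_one (by positivity)]
  exact Real.one_le_sqrt.mpr (by nlinarith [Real.pi_gt_three])

lemma gauss_le {s : ℝ} (hs : 0 < s) (y : ℝ) : gauss s y ≤ 1 / √(4 * Real.pi) * (1 / √s) := by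
  rw [gauss_eq, mul_assoc]
  apply mul_le_of_le_one_left (by positivity)
  rw [Real.exp_le_one_iff, neg_div]
  have : 0 ≤ y ^ 2 / (4 * s) := by positivity
  linarith

lemma gauss_le_inv_sqrt {s : ℝ} (hs : 0 < s) (y : ℝ) : gauss s y ≤ 1 / √s :=
  (gauss_le hs y).trans (mul_le_of_le_one_left (by positivity) one_div_sqrt_four_pi_le)

/-- With `q = |y| / (2 √s)` the prefactor is `q / √s` and the Gaussian is `exp (-q²)`. Half of the
exponent absorbs `q`, because `q ≤ exp (q² / 2)`; the other half survives. -/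
lemma abs_mul_gauss_le_exp {s : ℝ} (hs : 0 < s) (y : ℝ) :
    |y| / (2 * s) * gauss s y ≤ 1 / s * Real.exp (-y ^ 2 / (8 * s)) := by
  set q := |y| / (2 * √s) with hq
  have hs' : √s ^ 2 = s := Real.sq_sqrt hs.le
  have hsp : 0 < √s := Real.sqrt_pos.mpr hs
  have hq0 : 0 ≤ q := by positivity
  have hq2 : q ^ 2 = y ^ 2 / (4 * s) := by
    rw [hq, div_pow, sq_abs, mul_pow, hs']; norm_num
  have h1 : q * Real.exp (-q ^ 2 / 2) ≤ 1 := by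
    have : q ≤ Real.exp (q ^ 2 / 2) := by
      have := Real.add_one_le_exp (q ^ 2 / 2); nlinarith [sq_nonneg (q - 1)]
    rw [neg_div, Real.exp_neg]
    exact mul_inv_le_one_of_le₀ this (by positivity)
  have h2 : Real.exp (-y ^ 2 / (4 * s)) = Real.exp (-q ^ 2 / 2) * Real.exp (-y ^ 2 / (8 * s)) := by
    rw [← Real.exp_add]; congr 1; rw [neg_div (4 * s), ← hq2]
    have : -y ^ 2 / (8 * s) = -(y ^ 2 / (4 * s)) / 2 := by field_simp; ring
    rw [this, ← hq2]; ring
  have h3 : |y| / (2 * s) = q / √s := by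
    rw [hq]; nth_rewrite 1 [← hs']; field_simp
  rw [gauss_eq, h2, h3]
  calc q / √s * (Real.exp (-q ^ 2 / 2) * Real.exp (-y ^ 2 / (8 * s)) * (1 / √(4 * Real.pi)) *
        (1 / √s))
      = (q * Real.exp (-q ^ 2 / 2)) * (1 / √(4 * Real.pi)) *
          (1 / √s ^ 2 * Real.exp (-y ^ 2 / (8 * s))) := by field_simp
    _ ≤ 1 * (1 / √s ^ 2 * Real.exp (-y ^ 2 / (8 * s))) := by
        gcongr
        exact mul_le_one₀ h1 (by positivity) one_div_sqrt_four_pi_le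
    _ = _ := by rw [one_mul, hs']

lemma abs_mul_gauss_le {s : ℝ} (hs : 0 < s) (y : ℝ) : |y| / (2 * s) * gauss s y ≤ 1 / s := by
  refine (abs_mul_gauss_le_exp hs y).trans (mul_le_of_le_one_right (by positivity) ?_)
  rw [Real.exp_le_one_iff, neg_div]
  have : 0 ≤ y ^ 2 / (8 * s) := by positivity
  linarith

lemma hasDerivAt_gauss (s y : ℝ) :
    HasDerivAt (gauss s) (-(y / (2 * s) * gauss s y)) y := by
  have h : HasDerivAt (fun y : ℝ => -y ^ 2 / (4 * s)) (-(2 * y) / (4 * s)) y := by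
    simpa using ((hasDerivAt_pow 2 y).neg.div_const (4 * s))
  have := (h.exp).div_const (√(4 * Real.pi * s))
  refine this.congr_deriv ?_
  unfold gauss
  have h2 : -(2 * y) / (4 * s) = -(y / (2 * s)) := by
    rw [show (4 : ℝ) * s = 2 * (2 * s) by ring, neg_div, mul_div_mul_left _ _ two_ne_zero]
  rw [h2]; ring

lemma abs_gauss_sub_le {s : ℝ} (hs : 0 < s) (a b : ℝ) :
    |gauss s a - gauss s b| ≤ 1 / s * |a - b| := by
  have := Convex.norm_image_sub_le_of_norm_hasDerivWithin_le (f := gauss s)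
    (f' := fun y => -(y / (2 * s) * gauss s y)) (s := univ) (C := 1 / s) (x := b) (y := a)
    (fun y _ => (hasDerivAt_gauss s y).hasDerivWithinAt)
    (fun y _ => by
      rw [norm_neg, norm_mul, Real.norm_eq_abs, Real.norm_eq_abs, abs_div,
        abs_of_nonneg (gauss_nonneg s y), abs_of_pos (by positivity : 0 < 2 * s)]
      exact abs_mul_gauss_le hs y)
    convex_univ trivial trivial
  simpa using this

@[fun_prop]
lemma measurable_gauss : Measurable (Function.uncurry gauss) := by
  unfold gauss Function.uncurry; fun_prop

lemma measurable_gauss_comp {X : Type*} [MeasurableSpace X] {f h : X → ℝ} (hf : Measurable f)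
    (hh : Measurable h) : Measurable fun x => gauss (f x) (h x) :=
  measurable_gauss.comp (hf.prodMk hh)

lemma integrable_exp_neg_sq_div {b : ℝ} (hb : 0 < b) (a : ℝ) :
    Integrable fun x : ℝ => Real.exp (-(a - x) ^ 2 / b) := by
  have h := (integrable_exp_neg_mul_sq (b := b⁻¹) (by positivity)).comp_sub_left a
  refine h.congr (ae_of_all _ fun x => ?_)
  simp only
  congr 1
  field_simp

/-! ### The heat potential -/

/-- The density of the normal law on which the heat potential is averaged. -/
def bell (z : ℝ) : ℝ := Real.exp (-z ^ 2) / √Real.pi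

lemma bell_nonneg (z : ℝ) : 0 ≤ bell z := by unfold bell; positivity

@[fun_prop]
lemma continuous_bell : Continuous bell := by unfold bell; fun_prop

lemma integrable_bell : Integrable bell := by
  have := (integrable_exp_neg_mul_sq (b := 1) one_pos).div_const (√Real.pi)
  refine this.congr (ae_of_all _ fun z => ?_)
  simp [bell]

lemma integral_bell : ∫ z, bell z = 1 := by
  have := integral_gaussian 1
  unfold bell
  rw [integral_div]
  simp only [neg_mul, one_mul, div_one] at this
  rw [this, div_self (by positivity)]

/-- The heat potential of `u` at time `t`. -/
def heat (t : ℝ) (u : ℝ → ℝ) (x : ℝ) : ℝ := ∫ z, bell z * u (x + 2 * √t * z)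

lemma integral_comp_affine (F : ℝ → ℝ) (x : ℝ) {c : ℝ} (hc : 0 < c) :
    ∫ ξ, F ξ = ∫ z, c * F (x + c * z) := by
  have h := Measure.integral_comp_mul_left (fun z => F (x + z)) c
  rw [integral_add_left_eq_self, abs_of_pos (inv_pos.mpr hc), smul_eq_mul] at h
  rw [integral_const_mul, h, mul_inv_cancel_left₀ hc.ne']

lemma scaled_gauss {t : ℝ} (ht : 0 < t) (x z : ℝ) :
    2 * √t * gauss t (x - (x + 2 * √t * z)) = bell z := by
  have hs' : √t ^ 2 = t := Real.sq_sqrt ht.le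
  have hsp : 0 < √t := Real.sqrt_pos.mpr ht
  have h4 : √(4 : ℝ) = 2 := by
    rw [show (4 : ℝ) = 2 ^ 2 by norm_num]; exact Real.sqrt_sq (by norm_num)
  unfold gauss bell
  rw [Real.sqrt_mul (by positivity), Real.sqrt_mul (by positivity), h4]
  have : -(x - (x + 2 * √t * z)) ^ 2 / (4 * t) = -z ^ 2 := by
    rw [show (x - (x + 2 * √t * z)) ^ 2 = 4 * √t ^ 2 * z ^ 2 by ring, hs']; field_simp
  rw [this]; field_simp

lemma integral_gauss_mul {t : ℝ} (ht : 0 < t) (u : ℝ → ℝ) (x : ℝ) :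
    ∫ ξ, gauss t (x - ξ) * u ξ = heat t u x := by
  rw [integral_comp_affine _ x (show 0 < 2 * √t by positivity)]
  unfold heat
  congr 1; ext z
  rw [← mul_assoc, scaled_gauss ht]

lemma integrable_bell_mul {u : ℝ → ℝ} (hu : Continuous u) {M : ℝ} (hM : ∀ x, |u x| ≤ M)
    (t x : ℝ) : Integrable fun z => bell z * u (x + 2 * √t * z) := by
  refine (integrable_bell.mul_const M).mono' (by fun_prop) (ae_of_all _ fun z => ?_)
  rw [norm_mul, Real.norm_of_nonneg (bell_nonneg z)]
  exact mul_le_mul_of_nonneg_left (hM _) (bell_nonneg z)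

/-- Averaging over the fixed normal law removes the singularity of the kernel at time zero: the
integrand is continuous in `(t, x)` everywhere, `√t` being `0` for `t ≤ 0`. -/
lemma continuous_heat_uncurry {u : ℝ → ℝ} (hu : Continuous u) {M : ℝ} (hM : ∀ x, |u x| ≤ M) :
    Continuous fun p : ℝ × ℝ => heat p.1 u p.2 := by
  unfold heat
  refine continuous_of_dominated (bound := fun z => bell z * M) (fun p => by fun_prop)
    (fun p => ae_of_all _ fun z => ?_) (integrable_bell.mul_const M)
    (ae_of_all _ fun z => by fun_prop)
  rw [norm_mul, Real.norm_of_nonneg (bell_nonneg z)]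
  exact mul_le_mul_of_nonneg_left (hM _) (bell_nonneg z)

lemma abs_heat_le {u : ℝ → ℝ} {M : ℝ} (hM : ∀ x, |u x| ≤ M) (t x : ℝ) : |heat t u x| ≤ M := by
  have h := norm_integral_le_of_norm_le (f := fun z => bell z * u (x + 2 * √t * z))
    (integrable_bell.mul_const M) (ae_of_all _ fun z => by
      rw [norm_mul, Real.norm_of_nonneg (bell_nonneg z)]
      exact mul_le_mul_of_nonneg_left (hM _) (bell_nonneg z))
  rwa [integral_mul_const, integral_bell, one_mul] at h

lemma heat_nonneg {u : ℝ → ℝ} (hu : ∀ x, 0 ≤ u x) (t x : ℝ) : 0 ≤ heat t u x :=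
  integral_nonneg fun z => mul_nonneg (bell_nonneg z) (hu _)

lemma heat_sub {u w : ℝ → ℝ} (hu : Continuous u) {M : ℝ} (hM : ∀ x, |u x| ≤ M)
    (hw : Continuous w) {N : ℝ} (hN : ∀ x, |w x| ≤ N) (t x : ℝ) :
    heat t u x - heat t w x = heat t (fun y => u y - w y) x := by
  unfold heat
  rw [← integral_sub (integrable_bell_mul hu hM t x) (integrable_bell_mul hw hN t x)]
  congr 1; ext z; ring

/-! ### The space derivative of the heat potential, and its weighted decay. -/

lemma integrable_mul_bell : Integrable fun z => z * bell z := by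
  have := (integrable_mul_exp_neg_mul_sq (b := 1) one_pos).div_const (√Real.pi)
  refine this.congr (ae_of_all _ fun z => ?_)
  simp [bell, mul_div_assoc]

lemma integrable_exp_neg_sq_half : Integrable fun z : ℝ => Real.exp (-z ^ 2 / 2) := by
  simpa using integrable_exp_neg_sq_div (b := 2) (by norm_num) 0

lemma integral_exp_neg_sq_half : ∫ z : ℝ, Real.exp (-z ^ 2 / 2) = √2 * √Real.pi := by
  have := integral_gaussian (2⁻¹)
  rw [← Real.sqrt_mul (by norm_num)]
  convert this using 2
  · ext z; congr 1; ring
  · field_simp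

/-- Half of the exponent absorbs `√2 |z|`, and the remaining majorant is a Gaussian of mass exactly
one. -/
lemma integral_abs_mul_bell_le : ∫ z, |z * bell z| ≤ 1 := by
  have h2 : √2 ^ 2 = (2 : ℝ) := Real.sq_sqrt (by norm_num)
  have h : ∀ z, |z * bell z| ≤ 1 / (√2 * √Real.pi) * Real.exp (-z ^ 2 / 2) := fun z => by
    rw [abs_mul, abs_of_nonneg (bell_nonneg z), bell]
    have h1 : √2 * |z| ≤ Real.exp (z ^ 2 / 2) := by
      have := Real.add_one_le_exp (z ^ 2 / 2)
      rw [← sq_abs z] at this ⊢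
      nlinarith [sq_nonneg (|z| - √2)]
    have h3 : Real.exp (-z ^ 2) = Real.exp (-z ^ 2 / 2) * (Real.exp (z ^ 2 / 2))⁻¹ := by
      rw [← Real.exp_neg, ← Real.exp_add]; congr 1; ring
    have h4 : √2 * |z| * (Real.exp (z ^ 2 / 2))⁻¹ ≤ 1 := mul_inv_le_one_of_le₀ h1 (by positivity)
    calc |z| * (Real.exp (-z ^ 2) / √Real.pi)
        = (√2 * |z| * (Real.exp (z ^ 2 / 2))⁻¹) *
            (1 / (√2 * √Real.pi) * Real.exp (-z ^ 2 / 2)) := by rw [h3]; field_simp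
      _ ≤ _ := mul_le_of_le_one_left (by positivity) h4
  calc ∫ z, |z * bell z| ≤ ∫ z, 1 / (√2 * √Real.pi) * Real.exp (-z ^ 2 / 2) :=
        integral_mono integrable_mul_bell.abs (integrable_exp_neg_sq_half.const_mul _) h
    _ = 1 := by
        rw [integral_const_mul, integral_exp_neg_sq_half]; field_simp

/-- The space derivative of the heat potential. -/
def heatDeriv (t : ℝ) (u : ℝ → ℝ) (x : ℝ) : ℝ :=
  1 / √t * ∫ z, z * bell z * u (x + 2 * √t * z)

lemma hasDerivAt_heat {u : ℝ → ℝ} (hu : Continuous u) {M : ℝ} (hM : ∀ x, |u x| ≤ M)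
    {t : ℝ} (ht : 0 < t) (x : ℝ) : HasDerivAt (heat t u) (heatDeriv t u x) x := by
  have hfun : heat t u = fun x => ∫ ξ, gauss t (x - ξ) * u ξ :=
    funext fun x => (integral_gauss_mul ht u x).symm
  have hg : Continuous (gauss t) := by unfold gauss; fun_prop
  have key := hasDerivAt_integral_of_dominated_loc_of_deriv_le
    (F := fun x ξ => gauss t (x - ξ) * u ξ)
    (F' := fun x ξ => -((x - ξ) / (2 * t) * gauss t (x - ξ)) * u ξ) (μ := volume)
    -- A majorant valid for all `y` within distance one of `x`: from `(x - ξ)² ≤ 2 (y - ξ)² + 2` the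
    -- exponent at `y` is compared with half the exponent at `x`, at the price of the factor `exp (1
    -- / (8 t))`.
    (bound := fun ξ => 1 / t * Real.exp (1 / (8 * t)) * Real.exp (-(x - ξ) ^ 2 / (16 * t)) * M)
    (x₀ := x) (s := Metric.ball x 1) (Metric.ball_mem_nhds x one_pos)
    (Eventually.of_forall fun y => by fun_prop)
    ?_ (by fun_prop) (ae_of_all _ fun ξ y hy => ?_)
    (((integrable_exp_neg_sq_div (by positivity) x).const_mul _).mul_const M)
    (ae_of_all _ fun ξ y _ => ?_)
  · rw [hfun]
    refine key.2.congr_deriv ?_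
    rw [integral_comp_affine _ x (show 0 < 2 * √t by positivity), heatDeriv,
      ← integral_const_mul]
    congr 1; ext z
    have hs' : √t ^ 2 = t := Real.sq_sqrt ht.le
    have hsp : 0 < √t := Real.sqrt_pos.mpr ht
    rw [← scaled_gauss ht x z]
    have h2 : x - (x + 2 * √t * z) = -(2 * √t * z) := by ring
    rw [h2]
    generalize gauss t (-(2 * √t * z)) = G
    generalize √t = q at *
    subst hs'
    field_simp
  · have hc : Continuous fun ξ => gauss t (x - ξ) * u ξ := by fun_prop
    refine (((integrable_exp_neg_sq_div (b := 4 * t) (by positivity) x).div_const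
      (√(4 * Real.pi * t))).mul_const M).mono' hc.aestronglyMeasurable (ae_of_all _ fun ξ => ?_)
    rw [norm_mul, Real.norm_of_nonneg (gauss_nonneg _ _)]
    exact mul_le_mul_of_nonneg_left (hM ξ) (gauss_nonneg _ _)
  · have hM0 : 0 ≤ M := (abs_nonneg _).trans (hM 0)
    rw [norm_mul, norm_neg, norm_mul, Real.norm_eq_abs, Real.norm_eq_abs, Real.norm_eq_abs,
      abs_div, abs_of_nonneg (gauss_nonneg _ _), abs_of_pos (show 0 < 2 * t by positivity)]
    refine mul_le_mul ((abs_mul_gauss_le_exp ht _).trans ?_) (hM ξ) (abs_nonneg _)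
      (by positivity)
    rw [mul_assoc, ← Real.exp_add]
    gcongr
    rw [Metric.mem_ball, Real.dist_eq] at hy
    have h1 : (y - x) ^ 2 ≤ 1 := by rw [← sq_abs]; nlinarith [abs_nonneg (y - x)]
    have h2 : (x - ξ) ^ 2 ≤ 2 * (y - ξ) ^ 2 + 2 := by nlinarith [sq_nonneg (y - ξ + (y - x))]
    rw [show 1 / (8 * t) + -(x - ξ) ^ 2 / (16 * t) = (2 - (x - ξ) ^ 2) / (16 * t) by
      field_simp; ring, show -(y - ξ) ^ 2 / (8 * t) = (-2 * (y - ξ) ^ 2) / (16 * t) by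
      field_simp; ring]
    gcongr; linarith
  · have h := ((hasDerivAt_gauss t (y - ξ)).comp y ((hasDerivAt_id y).sub_const ξ)).mul_const (u ξ)
    simpa [Function.comp_def] using h

lemma abs_heatDeriv_le {u : ℝ → ℝ} {M : ℝ} (hM : ∀ x, |u x| ≤ M) {t : ℝ} (ht : 0 < t)
    (x : ℝ) : |heatDeriv t u x| ≤ M / √t := by
  have hM0 : 0 ≤ M := (abs_nonneg _).trans (hM 0)
  have h := norm_integral_le_of_norm_le (f := fun z => z * bell z * u (x + 2 * √t * z))
    (integrable_mul_bell.abs.mul_const M) (ae_of_all _ fun z => by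
      rw [norm_mul]
      exact mul_le_mul_of_nonneg_left (hM _) (abs_nonneg _))
  rw [integral_mul_const] at h
  rw [heatDeriv, abs_mul, abs_of_nonneg (by positivity), div_eq_inv_mul M, one_div]
  gcongr
  exact h.trans (mul_le_of_le_one_left hM0 integral_abs_mul_bell_le)

lemma continuous_heatDeriv {u : ℝ → ℝ} (hu : Continuous u) {M : ℝ} (hM : ∀ x, |u x| ≤ M)
    (t : ℝ) : Continuous (heatDeriv t u) := by
  unfold heatDeriv
  refine continuous_const.mul (continuous_of_dominated (bound := fun z => |z * bell z| * M)
    (fun p => by fun_prop) (fun p => ae_of_all _ fun z => ?_)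
    (integrable_mul_bell.abs.mul_const M) (ae_of_all _ fun z => by fun_prop))
  rw [norm_mul]
  exact mul_le_mul_of_nonneg_left (hM _) (abs_nonneg _)

lemma abs_heat_sub_le {u : ℝ → ℝ} (hu : Continuous u) {M : ℝ} (hM : ∀ x, |u x| ≤ M)
    {t : ℝ} (ht : 0 < t) (x y : ℝ) : |heat t u x - heat t u y| ≤ M / √t * |x - y| := by
  have := Convex.norm_image_sub_le_of_norm_hasDerivWithin_le (f := heat t u)
    (s := univ) (C := M / √t) (x := y) (y := x)
    (fun y _ => (hasDerivAt_heat hu hM ht y).hasDerivWithinAt)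
    (fun y _ => abs_heatDeriv_le hM ht y) convex_univ trivial trivial
  simpa using this

/-- Weighted bound for the heat potential. -/
lemma weighted_heat_le {u : ℝ → ℝ} {α R : ℝ} (hα : 0 ≤ α)
    (hR : ∀ x, Real.exp (α * |x|) * |u x| ≤ R) {t : ℝ} (ht : 0 ≤ t) (x s : ℝ) :
    Real.exp (α * |x|) * |heat t u (x + s)| ≤ 2 * R * Real.exp (α * |s| + 2 * α ^ 2 * t) := by
  have hR0 : 0 ≤ R := le_trans (by positivity) (hR 0)
  have hu : ∀ y, |u y| ≤ R * Real.exp (-(α * |y|)) := fun y => by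
    rw [Real.exp_neg, ← div_eq_mul_inv, le_div_iff₀ (Real.exp_pos _), mul_comm]; exact hR y
  have h := norm_integral_le_of_norm_le (f := fun z => bell z * u (x + s + 2 * √t * z))
    (g := fun z => R * Real.exp (-(α * |x|)) * Real.exp (α * |s| + 2 * α ^ 2 * t) / √Real.pi
      * Real.exp (-z ^ 2 / 2))
    (integrable_exp_neg_sq_half.const_mul _) (ae_of_all _ fun z => by
      rw [norm_mul, Real.norm_of_nonneg (bell_nonneg z), Real.norm_eq_abs]
      refine (mul_le_mul_of_nonneg_left (hu _) (bell_nonneg z)).trans ?_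
      have hx : |x| ≤ |x + s + 2 * √t * z| + |s| + 2 * √t * |z| := by
        have e : x = (x + s + 2 * √t * z) + (-s) + (-(2 * √t * z)) := by ring
        calc |x| = |(x + s + 2 * √t * z) + (-s) + (-(2 * √t * z))| := by rw [← e]
          _ ≤ _ := abs_add_three _ _ _
          _ = _ := by rw [abs_neg, abs_neg, abs_mul, abs_of_nonneg (by positivity : 0 ≤ 2 * √t)]
      have hs' : √t ^ 2 = t := Real.sq_sqrt ht
      -- Young's inequality: half of `z²` pays for the weight along the random displacement. The
      -- surviving `exp (-z² / 2)` has mass `√2 √π`, which produces the factor `√2 ≤ 2` in the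
      -- bound.
      have hz : 2 * α * √t * |z| ≤ z ^ 2 / 2 + 2 * α ^ 2 * t := by
        rw [← sq_abs z]; nth_rewrite 2 [← hs']; nlinarith [sq_nonneg (|z| - 2 * α * √t)]
      have hle : -z ^ 2 + -(α * |x + s + 2 * √t * z|) ≤
          -(α * |x|) + (α * |s| + 2 * α ^ 2 * t) + -z ^ 2 / 2 := by
        nlinarith [mul_le_mul_of_nonneg_left hx hα]
      calc bell z * (R * Real.exp (-(α * |x + s + 2 * √t * z|)))
          = R / √Real.pi * Real.exp (-z ^ 2 + -(α * |x + s + 2 * √t * z|)) := by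
            rw [Real.exp_add, bell]; ring
        _ ≤ R / √Real.pi *
            Real.exp (-(α * |x|) + (α * |s| + 2 * α ^ 2 * t) + -z ^ 2 / 2) := by gcongr
        _ = _ := by rw [Real.exp_add, Real.exp_add]; ring)
  rw [integral_const_mul, integral_exp_neg_sq_half] at h
  have h2 : √2 ≤ 2 := Real.sqrt_le_iff.mpr (by norm_num)
  have hpi : 0 < √Real.pi := by positivity
  calc Real.exp (α * |x|) * |heat t u (x + s)|
      ≤ Real.exp (α * |x|) * _ := mul_le_mul_of_nonneg_left h (Real.exp_pos _).le
    _ = √2 * R * Real.exp (α * |s| + 2 * α ^ 2 * t) := by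
        rw [Real.exp_neg]; field_simp
    _ ≤ _ := by gcongr

end

noncomputable section

/-! ### Interface paths -/

/-- A continuous velocity with values in `[-V, -v₀]`. -/
structure IsSpeed (v₀ V : ℝ) (v : ℝ → ℝ) : Prop where
  continuous : Continuous v
  bounds : ∀ τ, -V ≤ v τ ∧ v τ ≤ -v₀

/-- Displacement of the interface during the last `σ` units of time before `t`. -/
def depth (v : ℝ → ℝ) (t σ : ℝ) : ℝ := front v (t - σ) - front v t

lemma hasDerivAt_front {v : ℝ → ℝ} (hv : Continuous v) (t : ℝ) : HasDerivAt (front v) (v t) t :=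
  intervalIntegral.integral_hasDerivAt_right (hv.intervalIntegrable _ _)
    (hv.stronglyMeasurableAtFilter _ _) hv.continuousAt

lemma continuous_front {v : ℝ → ℝ} (hv : Continuous v) : Continuous (front v) :=
  continuous_iff_continuousAt.mpr fun t => (hasDerivAt_front hv t).continuousAt

lemma front_zero (v : ℝ → ℝ) : front v 0 = 0 := intervalIntegral.integral_same

lemma depth_zero (v : ℝ → ℝ) (t : ℝ) : depth v t 0 = 0 := by simp [depth]

lemma depth_self (v : ℝ → ℝ) (t : ℝ) : depth v t t = -front v t := by simp [depth, front_zero]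

lemma hasDerivAt_depth {v : ℝ → ℝ} (hv : Continuous v) (t σ : ℝ) :
    HasDerivAt (depth v t) (-v (t - σ)) σ := by
  have := ((hasDerivAt_front hv (t - σ)).comp σ ((hasDerivAt_id σ).const_sub t)).sub_const
    (front v t)
  refine this.congr_deriv ?_
  simp

lemma continuous_depth_uncurry {v : ℝ → ℝ} (hv : Continuous v) :
    Continuous fun p : ℝ × ℝ => depth v p.1 p.2 := by
  have := continuous_front hv
  unfold depth; fun_prop

lemma continuous_depth {v : ℝ → ℝ} (hv : Continuous v) (t : ℝ) : Continuous (depth v t) := by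
  have := continuous_front hv
  unfold depth; fun_prop

variable {γ v₀ V : ℝ} {v : ℝ → ℝ}

lemma IsSpeed.le (hv : IsSpeed v₀ V v) : v₀ ≤ V := by
  have := hv.bounds 0; linarith

lemma IsSpeed.abs_le (hv₀ : 0 < v₀) (hv : IsSpeed v₀ V v) (τ : ℝ) : |v τ| ≤ V := by
  have := hv.bounds τ; exact _root_.abs_le.mpr ⟨by linarith, by linarith⟩

lemma IsSpeed.depth_sub (hv : IsSpeed v₀ V v) (t : ℝ) {σ₁ σ₂ : ℝ} (h : σ₁ ≤ σ₂) :
    v₀ * (σ₂ - σ₁) ≤ depth v t σ₂ - depth v t σ₁ ∧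
      depth v t σ₂ - depth v t σ₁ ≤ V * (σ₂ - σ₁) := by
  have hd : Differentiable ℝ (depth v t) := fun σ =>
    (hasDerivAt_depth hv.continuous t σ).differentiableAt
  have hderiv : ∀ σ, deriv (depth v t) σ = -v (t - σ) := fun σ =>
    (hasDerivAt_depth hv.continuous t σ).deriv
  constructor
  · refine mul_sub_le_image_sub_of_le_deriv hd (fun σ => ?_) h
    rw [hderiv]; have := hv.bounds (t - σ); linarith
  · refine image_sub_le_mul_sub_of_deriv_le hd (fun σ => ?_) h
    rw [hderiv]; have := hv.bounds (t - σ); linarith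

lemma IsSpeed.depth_bounds (hv : IsSpeed v₀ V v) (t : ℝ) {σ : ℝ} (h : 0 ≤ σ) :
    v₀ * σ ≤ depth v t σ ∧ depth v t σ ≤ V * σ := by
  simpa [depth_zero] using hv.depth_sub t h

lemma IsSpeed.depth_nonneg (hv₀ : 0 < v₀) (hv : IsSpeed v₀ V v) (t : ℝ) {σ : ℝ} (h : 0 ≤ σ) :
    0 ≤ depth v t σ :=
  (by positivity : 0 ≤ v₀ * σ).trans (hv.depth_bounds t h).1

lemma IsSpeed.abs_front_le (hv₀ : 0 < v₀) (hv : IsSpeed v₀ V v) {t : ℝ} (ht : 0 ≤ t) :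
    |front v t| ≤ V * t := by
  rw [← abs_neg, ← depth_self, abs_of_nonneg (hv.depth_nonneg hv₀ t ht)]
  exact (hv.depth_bounds t ht).2

/-- Heat production of the interface, discounted by the heat losses. -/
def source (γ : ℝ) (v : ℝ → ℝ) (t σ : ℝ) : ℝ := Real.exp (-γ * σ) * -v (t - σ)

/-- The single layer potential in the frame of the interface. -/
def layer (γ : ℝ) (v : ℝ → ℝ) (t x : ℝ) : ℝ :=
  ∫ σ in Ioc 0 t, gauss σ (x - depth v t σ) * source γ v t σ

/-- The temperature in the frame of the interface. -/
def profile (γ : ℝ) (v u₀ : ℝ → ℝ) (t x : ℝ) : ℝ :=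
  Real.exp (-γ * t) * heat t u₀ (x + front v t) + layer γ v t x

/-- The layer is rewritten in the elapsed time `σ = t - τ`. The minus sign of the potential goes
into `source`, which is nonnegative because the velocity is negative. -/
lemma temperature_eq_profile (γ : ℝ) (v u₀ : ℝ → ℝ) {t : ℝ} (ht : 0 < t) (x : ℝ) :
    temperature γ v u₀ (x + front v t) t = profile γ v u₀ t x := by
  unfold temperature profile
  have h1 : ∫ ξ, heatKernel (x + front v t) t ξ 0 * u₀ ξ = heat t u₀ (x + front v t) := by
    rw [← integral_gauss_mul ht]
    simp only [heatKernel_eq_gauss, sub_zero]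
  have h2 := intervalIntegral.integral_comp_sub_left (a := 0) (b := t) (fun σ =>
    gauss σ (x - depth v t σ) * Real.exp (-γ * σ) * v (t - σ)) t
  rw [sub_self, sub_zero] at h2
  have h3 : layer γ v t x =
      -∫ σ in (0 : ℝ)..t, gauss σ (x - depth v t σ) * Real.exp (-γ * σ) * v (t - σ) := by
    rw [layer, intervalIntegral.integral_of_le ht.le, ← integral_neg]
    congr 1; ext σ; unfold source; ring
  rw [h1, h3, ← h2, sub_eq_add_neg]
  congr 3; ext τ
  rw [heatKernel_eq_gauss, sub_sub_cancel, depth, sub_sub_cancel,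
    show x - (front v τ - front v t) = x + front v t - front v τ by ring]

lemma abs_source_le (hv₀ : 0 < v₀) (hv : IsSpeed v₀ V v) (t σ : ℝ) :
    |source γ v t σ| ≤ V * Real.exp (-γ * σ) := by
  rw [source, abs_mul, abs_neg, Real.abs_exp, mul_comm]
  exact mul_le_mul_of_nonneg_right (hv.abs_le hv₀ _) (Real.exp_pos _).le

lemma source_nonneg (hv₀ : 0 < v₀) (hv : IsSpeed v₀ V v) (t σ : ℝ) : 0 ≤ source γ v t σ := by
  have := (hv.bounds (t - σ)).2
  exact mul_nonneg (Real.exp_pos _).le (by linarith)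

lemma continuous_source (hv : Continuous v) (t : ℝ) : Continuous (source γ v t) := by
  unfold source; fun_prop

lemma measurable_layer_integrand (hv : Continuous v) (t x : ℝ) :
    Measurable fun σ => gauss σ (x - depth v t σ) * source γ v t σ :=
  (measurable_gauss_comp measurable_id
    (measurable_const.sub (continuous_depth hv t).measurable)).mul
    (continuous_source hv t).measurable

/-! ### Elementary integrals -/

lemma integrableOn_rpow_mul_exp {s a : ℝ} (hs : -1 < s) (ha : 0 < a) :
    IntegrableOn (fun σ : ℝ => σ ^ s * Real.exp (-a * σ)) (Ioi 0) := by
  simpa using integrableOn_rpow_mul_exp_neg_mul_rpow hs one_pos ha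

lemma one_div_sqrt_eq (σ : ℝ) (h : 0 < σ) : 1 / √σ = σ ^ (-(1 / 2) : ℝ) := by
  rw [Real.sqrt_eq_rpow, Real.rpow_neg h.le, one_div]

lemma integrableOn_inv_sqrt_mul_exp {a : ℝ} (ha : 0 < a) :
    IntegrableOn (fun σ : ℝ => 1 / √σ * Real.exp (-a * σ)) (Ioi 0) :=
  (integrableOn_rpow_mul_exp (s := -(1 / 2)) (by norm_num) ha).congr_fun
    (fun σ hσ => by simp only [one_div_sqrt_eq σ hσ]) measurableSet_Ioi

lemma integral_inv_sqrt_mul_exp {a : ℝ} (ha : 0 < a) :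
    ∫ σ in Ioi (0 : ℝ), 1 / √σ * Real.exp (-a * σ) = √(Real.pi / a) := by
  have h := Real.integral_rpow_mul_exp_neg_mul_Ioi (a := 1 / 2) (by norm_num) ha
  rw [Real.Gamma_one_half_eq, ← Real.sqrt_eq_rpow, ← Real.sqrt_mul (by positivity),
    one_div_mul_eq_div] at h
  rw [← h]
  refine setIntegral_congr_fun measurableSet_Ioi fun σ hσ => ?_
  rw [one_div_sqrt_eq σ hσ, neg_mul]; norm_num

/-- Bound for an integral over the past by an integral over the half line. -/
lemma abs_setIntegral_Ioc_le {f b : ℝ → ℝ} {t : ℝ} (hb : IntegrableOn b (Ioi 0))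
    (h : ∀ σ, 0 < σ → σ ≤ t → |f σ| ≤ b σ) (h0 : ∀ σ, 0 < σ → 0 ≤ b σ) :
    |∫ σ in Ioc 0 t, f σ| ≤ ∫ σ in Ioi 0, b σ := by
  have h1 : ∀ᵐ σ ∂volume.restrict (Ioc 0 t), ‖f σ‖ ≤ b σ :=
    (ae_restrict_iff' measurableSet_Ioc).mpr (ae_of_all _ fun σ hσ => h σ hσ.1 hσ.2)
  calc |∫ σ in Ioc 0 t, f σ| ≤ ∫ σ in Ioc 0 t, b σ :=
        norm_integral_le_of_norm_le (hb.mono_set Ioc_subset_Ioi_self) h1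
    _ ≤ _ := setIntegral_mono_set hb
        ((ae_restrict_iff' measurableSet_Ioi).mpr (ae_of_all _ fun σ hσ => h0 σ hσ))
        (Ioc_subset_Ioi_self).eventuallyLE

lemma abs_layer_integrand_le (hv₀ : 0 < v₀) (hv : IsSpeed v₀ V v) (t y : ℝ) {σ : ℝ}
    (hσ : 0 < σ) :
    |gauss σ y * source γ v t σ| ≤ V * (1 / √σ * Real.exp (-γ * σ)) := by
  rw [abs_mul, abs_of_nonneg (gauss_nonneg _ _)]
  calc _ ≤ 1 / √σ * (V * Real.exp (-γ * σ)) :=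
        mul_le_mul (gauss_le_inv_sqrt hσ y) (abs_source_le hv₀ hv t σ) (abs_nonneg _)
          (by positivity)
    _ = _ := by ring

lemma integrableOn_layer (hγ : 0 < γ) (hv₀ : 0 < v₀) (hv : IsSpeed v₀ V v) (t x : ℝ) :
    IntegrableOn (fun σ => gauss σ (x - depth v t σ) * source γ v t σ) (Ioc 0 t) := by
  have hi : IntegrableOn (fun σ : ℝ => V * (1 / √σ * Real.exp (-γ * σ))) (Ioi 0) :=
    (integrableOn_inv_sqrt_mul_exp hγ).const_mul V
  refine (hi.mono_set Ioc_subset_Ioi_self).mono' (measurable_layer_integrand hv.continuous t x).aestronglyMeasurable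
    ((ae_restrict_iff' measurableSet_Ioc).mpr (ae_of_all _ fun σ hσ => ?_))
  exact abs_layer_integrand_le hv₀ hv t _ hσ.1

lemma layer_nonneg (hv₀ : 0 < v₀) (hv : IsSpeed v₀ V v) (t x : ℝ) : 0 ≤ layer γ v t x :=
  integral_nonneg fun _ => mul_nonneg (gauss_nonneg _ _) (source_nonneg hv₀ hv _ _)

lemma profile_nonneg (hv₀ : 0 < v₀) (hv : IsSpeed v₀ V v) {u : ℝ → ℝ} (hu : ∀ x, 0 ≤ u x)
    (t x : ℝ) : 0 ≤ profile γ v u t x :=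
  add_nonneg (mul_nonneg (Real.exp_pos _).le (heat_nonneg hu _ _)) (layer_nonneg hv₀ hv _ _)

/-! ### Weighted bounds -/

/-- Since `|x| ≤ |x - d| + V σ`, the weight costs `β V σ ≤ γ σ / 2` and, by Young, `7/16` of the
Gaussian exponent plus `(16/7) β² σ`. The two bounds on `β` together with `v₀ ≤ V` give `β² ≤ γ /
16`, so this last cost is at most `γ σ / 7`, and at least `γ / 4` of the loss rate remains. The
share `9/16` kept for the Gaussian has the rational root `3/4`, which enters the slope constants
below. -/
lemma exponent_le (hγ : 0 < γ) (hv₀ : 0 < v₀) (hV : v₀ ≤ V) {β : ℝ} (hβ : 0 ≤ β)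
    (hβ' : β ≤ alphaMin v₀ V γ) {σ d : ℝ} (hσ : 0 < σ) (hd0 : 0 ≤ d) (hd : d ≤ V * σ) (x : ℝ) :
    β * |x| + -γ * σ + -(x - d) ^ 2 / (4 * σ) ≤
      -(γ / 4) * σ + -(9 / 16 * (x - d) ^ 2) / (4 * σ) := by
  have hVp : 0 < V := hv₀.trans_le hV
  have h1 : β ≤ v₀ / 8 := hβ'.trans (min_le_left _ _)
  have h2 : β ≤ γ / (2 * V) := hβ'.trans (min_le_right _ _)
  rw [le_div_iff₀ (by positivity)] at h2
  have h3 : β ^ 2 ≤ γ / 16 := by nlinarith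
  have hx : |x| ≤ |x - d| + d := by
    have := abs_add_le (x - d) d; rwa [sub_add_cancel, abs_of_nonneg hd0] at this
  have h4 : β * |x - d| ≤ 7 / 16 * (x - d) ^ 2 / (4 * σ) + 16 / 7 * β ^ 2 * σ := by
    rw [← sq_abs (x - d), div_add' _ _ _ (by positivity), le_div_iff₀ (by positivity)]
    nlinarith [sq_nonneg (7 / 16 * |x - d| - 2 * β * σ)]
  have h5 : β * |x| ≤ β * |x - d| + β * (V * σ) := by
    rw [← mul_add]; exact mul_le_mul_of_nonneg_left (hx.trans (by linarith)) hβ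
  have h6 : -(x - d) ^ 2 / (4 * σ) = -(9 / 16 * (x - d) ^ 2) / (4 * σ) -
    7 / 16 * (x - d) ^ 2 / (4 * σ) := by field_simp; ring
  rw [h6]
  nlinarith [mul_le_mul_of_nonneg_right h2 hσ.le, mul_le_mul_of_nonneg_right h3 hσ.le,
    mul_pos hγ hσ]

lemma weighted_gauss_le (hγ : 0 < γ) (hv₀ : 0 < v₀) (hV : v₀ ≤ V) {β : ℝ} (hβ : 0 ≤ β)
    (hβ' : β ≤ alphaMin v₀ V γ) {σ d : ℝ} (hσ : 0 < σ) (hd0 : 0 ≤ d) (hd : d ≤ V * σ) (x : ℝ) :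
    Real.exp (β * |x|) * (gauss σ (x - d) * Real.exp (-γ * σ)) ≤
      1 / √(4 * Real.pi) * (1 / √σ) *
        (Real.exp (-(γ / 4) * σ) * Real.exp (-(9 / 16 * (x - d) ^ 2) / (4 * σ))) := by
  have h := Real.exp_le_exp.mpr (exponent_le hγ hv₀ hV hβ hβ' hσ hd0 hd x)
  rw [Real.exp_add, Real.exp_add, Real.exp_add] at h
  rw [gauss_eq]
  calc _ = 1 / √(4 * Real.pi) * (1 / √σ) * (Real.exp (β * |x|) * Real.exp (-γ * σ) *
        Real.exp (-(x - d) ^ 2 / (4 * σ))) := by ring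
    _ ≤ _ := mul_le_mul_of_nonneg_left h (by positivity)

/-- Once the rest of the Gaussian is dropped, `1 / √(4 π)` times the integral of `σ^(-1/2) exp (-γ σ
/ 4)` over the half line is exactly `1 / √γ`. This is the source of the radius `V / √γ`. -/
lemma weighted_layer_le (hγ : 0 < γ) (hv₀ : 0 < v₀) (hv : IsSpeed v₀ V v) {β : ℝ} (hβ : 0 ≤ β)
    (hβ' : β ≤ alphaMin v₀ V γ) (t x : ℝ) :
    Real.exp (β * |x|) * |layer γ v t x| ≤ V / √γ := by
  have hVp : 0 < V := hv₀.trans_le hv.le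
  have hγ4 : 0 < γ / 4 := by positivity
  have hE : 0 < Real.exp (β * |x|) := Real.exp_pos _
  rw [← abs_of_pos hE, ← abs_mul, layer, ← integral_const_mul]
  refine (abs_setIntegral_Ioc_le (b := fun σ => V / √(4 * Real.pi) *
    (1 / √σ * Real.exp (-(γ / 4) * σ))) ((integrableOn_inv_sqrt_mul_exp hγ4).const_mul _)
    (fun σ hσ _ => ?_) (fun σ _ => by positivity)).trans ?_
  · rw [abs_mul, abs_mul, abs_of_pos hE, abs_of_nonneg (gauss_nonneg _ _)]
    have hd := hv.depth_bounds t hσ.le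
    have h := weighted_gauss_le hγ hv₀ hv.le hβ hβ' hσ (hv.depth_nonneg hv₀ t hσ.le) hd.2 x
    have he : Real.exp (-(9 / 16 * (x - depth v t σ) ^ 2) / (4 * σ)) ≤ 1 := by
      rw [Real.exp_le_one_iff, neg_div]
      have : 0 ≤ 9 / 16 * (x - depth v t σ) ^ 2 / (4 * σ) := by positivity
      linarith
    calc _ ≤ Real.exp (β * |x|) * (gauss σ (x - depth v t σ) * (V * Real.exp (-γ * σ))) := by
          gcongr
          · exact gauss_nonneg _ _
          · exact abs_source_le hv₀ hv t σ
      _ = V * (Real.exp (β * |x|) * (gauss σ (x - depth v t σ) * Real.exp (-γ * σ))) := by ring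
      _ ≤ V * (1 / √(4 * Real.pi) * (1 / √σ) * (Real.exp (-(γ / 4) * σ) * 1)) := by
          refine mul_le_mul_of_nonneg_left (h.trans ?_) hVp.le
          gcongr
      _ = _ := by ring
  · rw [integral_const_mul, integral_inv_sqrt_mul_exp hγ4,
      show Real.pi / (γ / 4) = 4 * Real.pi / γ by field_simp, Real.sqrt_div (by positivity)]
    apply le_of_eq; field_simp

/-! ### Regularity in space and time -/

/-- Hölder constant of the single layer potential. -/
def holderConst (γ V : ℝ) : ℝ :=
  ∫ σ in Ioi (0 : ℝ), V * (σ ^ (-(3 / 4) : ℝ) * Real.exp (-γ * σ))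

/-- Geometric mean of the Lipschitz bound `|a - b| / s` and the uniform bound `1 / √s`. The
Lipschitz constant is not integrable at `s = 0`, whereas the power `-3/4` is; this makes layers
Hölder continuous of exponent `1/2`, uniformly in time and in the velocity. -/
lemma abs_gauss_sub_le_sqrt {s : ℝ} (hs : 0 < s) (a b : ℝ) :
    |gauss s a - gauss s b| ≤ √|a - b| * s ^ (-(3 / 4) : ℝ) := by
  have h1 := abs_gauss_sub_le hs a b
  have h2 : |gauss s a - gauss s b| ≤ 1 / √s := by
    have := gauss_nonneg s a; have := gauss_nonneg s b
    have := gauss_le_inv_sqrt hs a; have := gauss_le_inv_sqrt hs b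
    rw [abs_le]; constructor <;> linarith
  have h3 : (s ^ (-(3 / 4) : ℝ)) ^ 2 = 1 / s * (1 / √s) := by
    rw [one_div_sqrt_eq s hs, one_div, ← Real.rpow_neg_one, ← Real.rpow_add hs,
      ← Real.rpow_natCast, ← Real.rpow_mul hs.le]
    norm_num
  refine abs_le_of_sq_le_sq' ?_ (by positivity) |>.2
  rw [mul_pow, Real.sq_sqrt (abs_nonneg _), h3, pow_two]
  calc _ ≤ (1 / s * |a - b|) * (1 / √s) := mul_le_mul h1 h2 (abs_nonneg _) (by positivity)
    _ = _ := by ring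

lemma abs_layer_sub_le (hγ : 0 < γ) (hv₀ : 0 < v₀) (hv : IsSpeed v₀ V v) (t x y : ℝ) :
    |layer γ v t x - layer γ v t y| ≤ holderConst γ V * √|x - y| := by
  have hVp : 0 < V := hv₀.trans_le hv.le
  have hi : IntegrableOn (fun σ : ℝ => V * (σ ^ (-(3 / 4) : ℝ) * Real.exp (-γ * σ))) (Ioi 0) :=
    (integrableOn_rpow_mul_exp (by norm_num) hγ).const_mul V
  rw [layer, layer, ← integral_sub (integrableOn_layer hγ hv₀ hv t x)
    (integrableOn_layer hγ hv₀ hv t y), holderConst, ← integral_mul_const]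
  refine abs_setIntegral_Ioc_le (hi.mul_const _) (fun σ hσ _ => ?_)
    (fun σ hσ => by positivity)
  rw [← sub_mul, abs_mul]
  have h := abs_gauss_sub_le_sqrt hσ (x - depth v t σ) (y - depth v t σ)
  rw [sub_sub_sub_cancel_right] at h
  calc _ ≤ √|x - y| * σ ^ (-(3 / 4) : ℝ) * (V * Real.exp (-γ * σ)) :=
        mul_le_mul h (abs_source_le hv₀ hv t σ) (abs_nonneg _) (by positivity)
    _ = _ := by ring

lemma continuous_layer (hγ : 0 < γ) (hv₀ : 0 < v₀) (hv : IsSpeed v₀ V v) (t : ℝ) :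
    Continuous (layer γ v t) := by
  refine continuous_iff_continuousAt.mpr fun x => ?_
  rw [ContinuousAt, tendsto_iff_dist_tendsto_zero]
  have h : Tendsto (fun y => holderConst γ V * √|y - x|) (𝓝 x) (𝓝 0) := by
    have : Continuous fun y => holderConst γ V * √|y - x| := by fun_prop
    simpa using this.tendsto x
  exact squeeze_zero (fun _ => dist_nonneg) (fun y => abs_layer_sub_le hγ hv₀ hv t y x) h

lemma continuous_layer_time (hγ : 0 < γ) (hv₀ : 0 < v₀) (hv : IsSpeed v₀ V v) (x : ℝ) :
    Continuous fun t => layer γ v t x := by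
  -- The moving upper limit is turned into an indicator, so that dominated convergence applies on a
  -- fixed domain; continuity in `t` fails only at the single point `σ = t`.
  have hrw : ∀ t, layer γ v t x = ∫ σ in Ioi 0,
      (Iic t).indicator (fun σ => gauss σ (x - depth v t σ) * source γ v t σ) σ := fun t => by
    rw [integral_indicator measurableSet_Iic, Measure.restrict_restrict measurableSet_Iic,
      inter_comm, Ioi_inter_Iic, layer]
  simp only [hrw]
  refine continuous_iff_continuousAt.mpr fun t₀ => ?_
  refine continuousAt_of_dominated (bound := fun σ => V * (1 / √σ * Real.exp (-γ * σ)))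
    (Eventually.of_forall fun t => ((measurable_layer_integrand hv.continuous t x).indicator
      measurableSet_Iic).aestronglyMeasurable)
    (Eventually.of_forall fun t => (ae_restrict_iff' measurableSet_Ioi).mpr
      (ae_of_all _ fun σ hσ => ?_)) ((integrableOn_inv_sqrt_mul_exp hγ).const_mul V) ?_
  · refine (norm_indicator_le_norm_self _ _).trans ?_
    exact abs_layer_integrand_le hv₀ hv t _ hσ
  · have hne : ∀ᵐ σ : ℝ ∂volume.restrict (Ioi 0), σ ≠ t₀ :=
      ae_restrict_of_ae (Measure.ae_ne volume t₀)
    filter_upwards [hne] with σ hσ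
    rcases lt_or_gt_of_ne hσ with h | h
    · have hc : Continuous fun t => gauss σ (x - depth v t σ) * source γ v t σ := by
        have h1 : Continuous fun t => depth v t σ :=
          (continuous_depth_uncurry hv.continuous).comp (by fun_prop : Continuous fun t => (t, σ))
        have h2 : Continuous (gauss σ) := by unfold gauss; fun_prop
        have h3 := hv.continuous
        unfold source; fun_prop
      refine hc.continuousAt.congr ?_
      filter_upwards [lt_mem_nhds h] with t ht
      rw [indicator_of_mem (mem_Iic.mpr (le_of_lt ht))]
    · refine (continuousAt_const (y := (0 : ℝ))).congr ?_
      filter_upwards [gt_mem_nhds h] with t ht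
      rw [indicator_of_notMem (by simpa using ht)]

lemma continuous_profile (hγ : 0 < γ) (hv₀ : 0 < v₀) (hv : IsSpeed v₀ V v) {u : ℝ → ℝ}
    (hu : Continuous u) {M : ℝ} (hM : ∀ x, |u x| ≤ M) (t : ℝ) :
    Continuous (profile γ v u t) := by
  have h1 := continuous_layer (γ := γ) hγ hv₀ hv t
  have h2 : Continuous fun x => heat t u (x + front v t) :=
    (continuous_heat_uncurry hu hM).comp (by fun_prop : Continuous fun x => (t, x + front v t))
  unfold profile
  fun_prop

lemma continuous_profile_time (hγ : 0 < γ) (hv₀ : 0 < v₀) (hv : IsSpeed v₀ V v) {u : ℝ → ℝ}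
    (hu : Continuous u) {M : ℝ} (hM : ∀ x, |u x| ≤ M) (x : ℝ) :
    Continuous fun t => profile γ v u t x := by
  have h1 := continuous_layer_time (γ := γ) hγ hv₀ hv x
  have h3 := continuous_front hv.continuous
  have h2 : Continuous fun t => heat t u (x + front v t) :=
    (continuous_heat_uncurry hu hM).comp (by fun_prop : Continuous fun t => (t, x + front v t))
  unfold profile
  fun_prop

/-! ### Dependence on the velocity -/

lemma one_sub_exp_neg_le_sqrt {y : ℝ} (hy : 0 ≤ y) : 1 - Real.exp (-y) ≤ √y := by
  rcases le_total y 1 with h | h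
  · have h1 := Real.add_one_le_exp (-y)
    have h2 : y ≤ √y := Real.le_sqrt_of_sq_le (by nlinarith)
    linarith
  · have h2 : 1 ≤ √y := Real.one_le_sqrt.mpr h
    linarith [Real.exp_pos (-y)]

variable {v₁ v₂ : ℝ → ℝ}

/-- Integrating `exp (l τ)` over the last `σ` units of time gives `(1 - exp (-l σ)) / l`, and `1 -
exp (-y) ≤ √y` turns this into `√(σ / l)`. The root is a compromise: it supplies decay in `l` and
still tames half of the `1 / σ` singularity of the kernel's Lipschitz constant. -/
lemma abs_depth_sub_le (h₁ : Continuous v₁) (h₂ : Continuous v₂) {D l t : ℝ} (hD : 0 ≤ D)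
    (hl : 0 < l) (h : ∀ τ, 0 ≤ τ → τ ≤ t → |v₁ τ - v₂ τ| ≤ D * Real.exp (l * τ)) {σ : ℝ}
    (hσ : 0 ≤ σ) (hσt : σ ≤ t) :
    |depth v₁ t σ - depth v₂ t σ| ≤ D * Real.exp (l * t) * √(σ / l) := by
  have hd : depth v₁ t σ - depth v₂ t σ = -∫ τ in (t - σ)..t, (v₁ τ - v₂ τ) := by
    have e : ∀ {w : ℝ → ℝ}, Continuous w → depth w t σ = -∫ τ in (t - σ)..t, w τ := fun {w} hw => by
      rw [depth, front, front, intervalIntegral.integral_interval_sub_left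
        (hw.intervalIntegrable _ _) (hw.intervalIntegrable _ _), intervalIntegral.integral_symm]
    rw [intervalIntegral.integral_sub (h₁.intervalIntegrable _ _) (h₂.intervalIntegrable _ _),
      e h₁, e h₂]; ring
  have hint : ∫ τ in (t - σ)..t, D * Real.exp (l * τ) =
      D * Real.exp (l * t) * ((1 - Real.exp (-(l * σ))) / l) := by
    rw [intervalIntegral.integral_const_mul, intervalIntegral.integral_comp_mul_left _ hl.ne',
      integral_exp, smul_eq_mul, mul_sub l t σ, sub_eq_add_neg (l * t), Real.exp_add]
    field_simp
  rw [hd, abs_neg]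
  have hb := intervalIntegral.norm_integral_le_of_norm_le (f := fun τ => v₁ τ - v₂ τ)
    (g := fun τ => D * Real.exp (l * τ)) (a := t - σ) (b := t) (μ := volume) (by linarith)
    (ae_of_all _ fun τ hτ => h τ (by linarith [hτ.1]) hτ.2)
    ((by fun_prop : Continuous fun τ => D * Real.exp (l * τ)).intervalIntegrable _ _)
  refine hb.trans ?_
  rw [hint]
  refine mul_le_mul_of_nonneg_left ?_ (by positivity)
  rw [div_le_iff₀ hl]
  refine (one_sub_exp_neg_le_sqrt (by positivity)).trans (le_of_eq ?_)
  rw [show l * σ = σ / l * l ^ 2 by field_simp, Real.sqrt_mul (by positivity),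
    Real.sqrt_sq hl.le]

/-- Two effects of a change of velocity are separated. A different source strength is discounted by
`exp (-l σ)` and contributes `√(π / l)`; a different path contributes `(1 / σ) √(σ / l)`. Both carry
the factor `1 / √l`, which later makes the kinetic map a contraction. -/
lemma abs_layer_sub_layer_le (hγ : 0 < γ) (hv₀ : 0 < v₀) (h₁ : IsSpeed v₀ V v₁)
    (h₂ : IsSpeed v₀ V v₂) {D l t : ℝ} (hD : 0 ≤ D) (hl : 0 < l)
    (h : ∀ τ, 0 ≤ τ → τ ≤ t → |v₁ τ - v₂ τ| ≤ D * Real.exp (l * τ)) (x : ℝ) :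
    |layer γ v₁ t x - layer γ v₂ t x| ≤
      (√Real.pi + V * √(Real.pi / γ)) / √l * (D * Real.exp (l * t)) := by
  have hVp : 0 < V := hv₀.trans_le h₁.le
  have hi1 := (integrableOn_inv_sqrt_mul_exp hl).const_mul (D * Real.exp (l * t))
  have hi2 := (integrableOn_inv_sqrt_mul_exp hγ).const_mul (V * (D * Real.exp (l * t)) / √l)
  rw [layer, layer, ← integral_sub (integrableOn_layer hγ hv₀ h₁ t x)
    (integrableOn_layer hγ hv₀ h₂ t x)]
  refine (abs_setIntegral_Ioc_le (hi1.add hi2) (fun σ hσ hσt => ?_)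
    (fun σ hσ => ?_)).trans (le_of_eq ?_)
  · have e : gauss σ (x - depth v₁ t σ) * source γ v₁ t σ -
        gauss σ (x - depth v₂ t σ) * source γ v₂ t σ =
        gauss σ (x - depth v₁ t σ) * Real.exp (-γ * σ) * (v₂ (t - σ) - v₁ (t - σ)) +
        (gauss σ (x - depth v₁ t σ) - gauss σ (x - depth v₂ t σ)) * source γ v₂ t σ := by
      unfold source; ring
    rw [e]
    refine (abs_add_le _ _).trans (add_le_add ?_ ?_)
    · rw [abs_mul, abs_mul, abs_of_nonneg (gauss_nonneg _ _), Real.abs_exp, abs_sub_comm]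
      have hE : Real.exp (-γ * σ) ≤ 1 := by
        rw [Real.exp_le_one_iff]; nlinarith
      calc _ ≤ 1 / √σ * 1 * (D * Real.exp (l * (t - σ))) := by
            gcongr
            · exact gauss_le_inv_sqrt hσ _
            · exact h _ (by linarith) (by linarith)
        _ = _ := by
            rw [mul_sub, sub_eq_add_neg, Real.exp_add]; ring_nf
    · have hg := abs_gauss_sub_le hσ (x - depth v₁ t σ) (x - depth v₂ t σ)
      have hd := abs_depth_sub_le h₁.continuous h₂.continuous hD hl h hσ.le hσt
      rw [sub_sub_sub_cancel_left, abs_sub_comm (depth v₂ t σ)] at hg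
      rw [abs_mul]
      calc _ ≤ (1 / σ * (D * Real.exp (l * t) * √(σ / l))) * (V * Real.exp (-γ * σ)) := by
            refine mul_le_mul (hg.trans ?_) (abs_source_le hv₀ h₂ t σ) (abs_nonneg _)
              (by positivity)
            gcongr
        _ = _ := by
            rw [Real.sqrt_div hσ.le]
            have hs' : √σ ^ 2 = σ := Real.sq_sqrt hσ.le
            have hsp : 0 < √σ := Real.sqrt_pos.mpr hσ
            have : 1 / σ * √σ = 1 / √σ := by
              rw [div_mul_eq_mul_div, one_mul, div_eq_div_iff hσ.ne' hsp.ne']; nlinarith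
            calc _ = (1 / σ * √σ) * V * (D * Real.exp (l * t)) / √l * Real.exp (-γ * σ) := by ring
              _ = _ := by rw [this]; ring
  · simp only [Pi.add_apply]
    positivity
  · simp only [Pi.add_apply]
    rw [integral_add hi1 hi2, integral_const_mul, integral_const_mul,
      integral_inv_sqrt_mul_exp hl, integral_inv_sqrt_mul_exp hγ, Real.sqrt_div Real.pi_pos.le l]
    ring

/-- The profile depends continuously on the velocity and on the initial temperature. -/
lemma abs_profile_sub_le (hγ : 0 < γ) (hv₀ : 0 < v₀) (h₁ : IsSpeed v₀ V v₁)
    (h₂ : IsSpeed v₀ V v₂) {u₁ u₂ : ℝ → ℝ} (hu₁ : Continuous u₁) {N : ℝ} (hN : ∀ x, |u₁ x| ≤ N)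
    (hu₂ : Continuous u₂) {M : ℝ} (hM : ∀ x, |u₂ x| ≤ M)
    {η : ℝ} (hη : ∀ x, |u₁ x - u₂ x| ≤ η) {D l t : ℝ} (hD : 0 ≤ D) (hl : 0 < l) (ht : 0 < t)
    (h : ∀ τ, 0 ≤ τ → τ ≤ t → |v₁ τ - v₂ τ| ≤ D * Real.exp (l * τ)) (x : ℝ) :
    |profile γ v₁ u₁ t x - profile γ v₂ u₂ t x| ≤
      η + (M + √Real.pi + V * √(Real.pi / γ)) / √l * (D * Real.exp (l * t)) := by
  have hM0 : 0 ≤ M := (abs_nonneg _).trans (hM 0)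
  have h3 := abs_layer_sub_layer_le (γ := γ) hγ hv₀ h₁ h₂ hD hl h x
  have h4 : |heat t u₁ (x + front v₁ t) - heat t u₂ (x + front v₁ t)| ≤ η := by
    rw [heat_sub hu₁ hN hu₂ hM]; exact abs_heat_le hη _ _
  have h5 : |heat t u₂ (x + front v₁ t) - heat t u₂ (x + front v₂ t)| ≤
      M / √l * (D * Real.exp (l * t)) := by
    refine (abs_heat_sub_le hu₂ hM ht _ _).trans ?_
    have hd := abs_depth_sub_le h₁.continuous h₂.continuous hD hl h ht.le le_rfl
    rw [depth_self, depth_self, neg_sub_neg, abs_sub_comm] at hd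
    rw [add_sub_add_left_eq_sub]
    -- The blow-up `1 / √t` of the slope of the heat potential cancels against the `√t` of the path
    -- estimate.
    calc _ ≤ M / √t * (D * Real.exp (l * t) * √(t / l)) := by gcongr
      _ = _ := by rw [Real.sqrt_div ht.le]; field_simp
  have hE : Real.exp (-γ * t) ≤ 1 := by rw [Real.exp_le_one_iff]; nlinarith
  have e : profile γ v₁ u₁ t x - profile γ v₂ u₂ t x =
      Real.exp (-γ * t) * ((heat t u₁ (x + front v₁ t) - heat t u₂ (x + front v₁ t)) +
        (heat t u₂ (x + front v₁ t) - heat t u₂ (x + front v₂ t))) +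
      (layer γ v₁ t x - layer γ v₂ t x) := by unfold profile; ring
  rw [e]
  calc _ ≤ |Real.exp (-γ * t) * ((heat t u₁ (x + front v₁ t) - heat t u₂ (x + front v₁ t)) +
        (heat t u₂ (x + front v₁ t) - heat t u₂ (x + front v₂ t)))| +
        |layer γ v₁ t x - layer γ v₂ t x| := abs_add_le _ _
    _ ≤ (η + M / √l * (D * Real.exp (l * t))) +
        (√Real.pi + V * √(Real.pi / γ)) / √l * (D * Real.exp (l * t)) := by
        refine add_le_add ?_ h3
        rw [abs_mul, Real.abs_exp]
        exact (mul_le_of_le_one_left (abs_nonneg _) hE).trans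
          ((abs_add_le _ _).trans (add_le_add h4 h5))
    _ = _ := by ring

end

noncomputable section

/-! ### Integral bounds for the derivative of the heat kernel along a path -/

/-- Majorant of the space derivative of the heat kernel, with a weakened exponent. -/
def gaussSlope (b σ y : ℝ) : ℝ :=
  |y| / (2 * σ) * (1 / √(4 * Real.pi) * (1 / √σ)) * Real.exp (-(b * y ^ 2) / (4 * σ))

lemma sqrt_four_mul_pi : √(4 * Real.pi) = 2 * √Real.pi := by
  rw [Real.sqrt_mul (by norm_num), show (4 : ℝ) = 2 ^ 2 by norm_num, Real.sqrt_sq (by norm_num)]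

lemma lintegral_gaussian_Ioi {b c : ℝ} (hb : 0 < b) (hc : 0 ≤ c) :
    ∫⁻ z in Ioi (0 : ℝ), ENNReal.ofReal (c * Real.exp (-b * z ^ 2)) =
      ENNReal.ofReal (c * (√(Real.pi / b) / 2)) := by
  rw [← integral_gaussian_Ioi, ← integral_const_mul, ofReal_integral_eq_lintegral_ofReal]
  · exact ((integrable_exp_neg_mul_sq hb).const_mul c).integrableOn
  · exact ae_of_all _ fun z => by positivity

/-- The part of the past in which the interface was behind the point `x`. -/
lemma lintegral_gaussSlope_behind {d w : ℝ → ℝ} (hd : ∀ σ, HasDerivAt d (w σ) σ)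
    (hw : ∀ σ, 0 ≤ w σ) (x : ℝ) {b : ℝ} (hb : 0 < b) :
    ∫⁻ σ in {σ | 0 < σ ∧ d σ < x}, ENNReal.ofReal (gaussSlope b σ (x - d σ)) ≤
      ENNReal.ofReal (1 / (2 * √b)) := by
  have hdc : Continuous d := continuous_iff_continuousAt.mpr fun σ => (hd σ).continuousAt
  have hdm : Monotone d := monotone_of_deriv_nonneg (fun σ => (hd σ).differentiableAt)
    fun σ => by rw [(hd σ).deriv]; exact hw σ
  set s := {σ | 0 < σ ∧ d σ < x} with hs
  have hsm : MeasurableSet s :=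
    (measurableSet_lt measurable_const measurable_id).inter
      (measurableSet_lt hdc.measurable measurable_const)
  -- `F` is the similarity variable. While the interface is behind `x`, both terms of `-F'` are
  -- nonnegative and the second is the prefactor of the kernel. The substitution `z = F σ` therefore
  -- bounds the integral by half a Gaussian, whatever the path.
  let F : ℝ → ℝ := fun σ => (x - d σ) / (2 * √σ)
  let F' : ℝ → ℝ := fun σ => -(w σ / (2 * √σ) + (x - d σ) / (4 * σ * √σ))
  have hF : ∀ σ ∈ s, HasDerivWithinAt F (F' σ) s σ := fun σ hσ => by
    have hσ0 : 0 < σ := hσ.1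
    have hsp : 0 < √σ := Real.sqrt_pos.mpr hσ0
    have h1 := ((hd σ).const_sub x).div ((Real.hasDerivAt_sqrt hσ0.ne').const_mul 2)
      (by positivity)
    refine (h1.congr_deriv ?_).hasDerivWithinAt
    have hs2 : √σ ^ 2 = σ := Real.sq_sqrt hσ0.le
    simp only [F']
    generalize √σ = q at *
    subst hs2
    field_simp
    ring
  have hinj : InjOn F s := by
    refine StrictAntiOn.injOn fun a ha c hc hac => ?_
    have h1 : √a < √c := Real.sqrt_lt_sqrt ha.1.le hac
    have h0 : 0 < √a := Real.sqrt_pos.mpr ha.1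
    have h2 := hdm hac.le
    have h3 : 0 < x - d c := sub_pos.mpr hc.2
    simp only [F]
    calc (x - d c) / (2 * √c) < (x - d c) / (2 * √a) := by gcongr
      _ ≤ _ := by gcongr
  have hcv := lintegral_image_eq_lintegral_abs_deriv_mul hsm hF hinj
    (fun z => ENNReal.ofReal (1 / √Real.pi * Real.exp (-b * z ^ 2)))
  calc _ ≤ ∫⁻ σ in s, ENNReal.ofReal |F' σ| *
        ENNReal.ofReal (1 / √Real.pi * Real.exp (-b * F σ ^ 2)) := by
        refine setLIntegral_mono' hsm fun σ hσ => ?_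
        rw [← ENNReal.ofReal_mul (abs_nonneg _)]
        apply ENNReal.ofReal_le_ofReal
        have hσ0 : 0 < σ := hσ.1
        have hy : 0 < x - d σ := sub_pos.mpr hσ.2
        have hsp : 0 < √σ := Real.sqrt_pos.mpr hσ0
        have hs2 : √σ ^ 2 = σ := Real.sq_sqrt hσ0.le
        have e1 : -b * F σ ^ 2 = -(b * (x - d σ) ^ 2) / (4 * σ) := by
          simp only [F]; rw [div_pow, mul_pow, hs2]; ring
        have e2 : (x - d σ) / (4 * σ * √σ) ≤ |F' σ| := by
          simp only [F']
          rw [abs_neg, abs_of_nonneg (add_nonneg (div_nonneg (hw σ) (by positivity))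
            (by positivity))]
          have := div_nonneg (hw σ) (by positivity : 0 ≤ 2 * √σ)
          linarith
        rw [e1, gaussSlope, abs_of_pos hy, sqrt_four_mul_pi]
        calc _ = (x - d σ) / (4 * σ * √σ) *
              (1 / √Real.pi * Real.exp (-(b * (x - d σ) ^ 2) / (4 * σ))) := by
              field_simp; ring
          _ ≤ _ := mul_le_mul_of_nonneg_right e2 (by positivity)
    _ = ∫⁻ z in F '' s, ENNReal.ofReal (1 / √Real.pi * Real.exp (-b * z ^ 2)) := hcv.symm
    _ ≤ ∫⁻ z in Ioi (0 : ℝ), ENNReal.ofReal (1 / √Real.pi * Real.exp (-b * z ^ 2)) := by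
        refine lintegral_mono_set ?_
        rintro _ ⟨σ, hσ, rfl⟩
        have := Real.sqrt_pos.mpr hσ.1
        have := sub_pos.mpr hσ.2
        simp only [F, mem_Ioi]; positivity
    _ = _ := by
        rw [lintegral_gaussian_Ioi hb (by positivity), Real.sqrt_div Real.pi_pos.le]
        congr 1; field_simp

/-- Substitute `z = (σ - σ₁) / √σ`. This is increasing with derivative `(σ + σ₁) / (2 σ √σ)`, which
dominates the factor `(σ - σ₁) / (2 σ √σ)` of the integrand, and half a Gaussian integral remains.
-/
lemma lintegral_lag_gaussian {σ₁ c : ℝ} (hσ₁ : 0 ≤ σ₁) (hc : 0 < c) :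
    ∫⁻ σ in Ioi σ₁, ENNReal.ofReal ((σ - σ₁) / (2 * σ) * (1 / √(4 * Real.pi) * (1 / √σ)) *
      Real.exp (-(c * (σ - σ₁) ^ 2) / (4 * σ))) ≤ ENNReal.ofReal (1 / (2 * √c)) := by
  let F : ℝ → ℝ := fun σ => (σ - σ₁) / √σ
  let F' : ℝ → ℝ := fun σ => 1 / √σ - (σ - σ₁) / (2 * σ * √σ)
  have hF : ∀ σ ∈ Ioi σ₁, HasDerivWithinAt F (F' σ) (Ioi σ₁) σ := fun σ hσ => by
    have hσ0 : 0 < σ := hσ₁.trans_lt hσ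
    have hsp : 0 < √σ := Real.sqrt_pos.mpr hσ0
    have h1 := ((hasDerivAt_id σ).sub_const σ₁).div (Real.hasDerivAt_sqrt hσ0.ne') hsp.ne'
    refine (h1.congr_deriv ?_).hasDerivWithinAt
    have hs2 : √σ ^ 2 = σ := Real.sq_sqrt hσ0.le
    simp only [F', id]
    generalize √σ = q at *
    subst hs2
    field_simp
  have hinj : InjOn F (Ioi σ₁) := by
    refine StrictMonoOn.injOn fun a ha c hc hac => ?_
    have ha0 : 0 < a := hσ₁.trans_lt ha
    have h0 : 0 < √a := Real.sqrt_pos.mpr ha0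
    have h1 : √a < √c := Real.sqrt_lt_sqrt ha0.le hac
    have h2 : √a ^ 2 = a := Real.sq_sqrt ha0.le
    have h3 : √c ^ 2 = c := Real.sq_sqrt (ha0.trans hac).le
    simp only [F]
    rw [div_lt_div_iff₀ h0 (h0.trans h1)]
    generalize √a = p at *
    generalize √c = q at *
    subst h2 h3
    nlinarith [mul_pos (mul_pos h0 (h0.trans h1)) (sub_pos.mpr h1),
      mul_nonneg hσ₁ (sub_pos.mpr h1).le]
  have hcv := lintegral_image_eq_lintegral_abs_deriv_mul measurableSet_Ioi hF hinj
    (fun z => ENNReal.ofReal (1 / √(4 * Real.pi) * Real.exp (-(c / 4) * z ^ 2)))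
  calc _ ≤ ∫⁻ σ in Ioi σ₁, ENNReal.ofReal |F' σ| *
        ENNReal.ofReal (1 / √(4 * Real.pi) * Real.exp (-(c / 4) * F σ ^ 2)) := by
        refine setLIntegral_mono' measurableSet_Ioi fun σ hσ => ?_
        rw [← ENNReal.ofReal_mul (abs_nonneg _)]
        apply ENNReal.ofReal_le_ofReal
        have hσ0 : 0 < σ := hσ₁.trans_lt hσ
        have hsp : 0 < √σ := Real.sqrt_pos.mpr hσ0
        have hs2 : √σ ^ 2 = σ := Real.sq_sqrt hσ0.le
        have e1 : -(c / 4) * F σ ^ 2 = -(c * (σ - σ₁) ^ 2) / (4 * σ) := by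
          simp only [F]; rw [div_pow, hs2]; field_simp
        have e2 : (σ - σ₁) / (2 * σ * √σ) ≤ |F' σ| := by
          refine le_trans ?_ (le_abs_self _)
          simp only [F']
          rw [le_sub_iff_add_le, ← add_div, div_le_div_iff₀ (by positivity) hsp]
          nlinarith [mul_nonneg hσ₁ hsp.le]
        rw [e1]
        calc _ = (σ - σ₁) / (2 * σ * √σ) * (1 / √(4 * Real.pi) *
              Real.exp (-(c * (σ - σ₁) ^ 2) / (4 * σ))) := by field_simp
          _ ≤ _ := mul_le_mul_of_nonneg_right e2 (by positivity)
    _ = ∫⁻ z in F '' Ioi σ₁,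
          ENNReal.ofReal (1 / √(4 * Real.pi) * Real.exp (-(c / 4) * z ^ 2)) := hcv.symm
    _ ≤ ∫⁻ z in Ioi (0 : ℝ),
          ENNReal.ofReal (1 / √(4 * Real.pi) * Real.exp (-(c / 4) * z ^ 2)) := by
        refine lintegral_mono_set ?_
        rintro _ ⟨σ, hσ, rfl⟩
        have := Real.sqrt_pos.mpr (hσ₁.trans_lt hσ)
        have := sub_pos.mpr (mem_Ioi.mp hσ)
        simp only [F, mem_Ioi]; positivity
    _ = _ := by
        rw [lintegral_gaussian_Ioi (by positivity) (by positivity),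
          show Real.pi / (c / 4) = 4 * Real.pi / c by field_simp, Real.sqrt_div (by positivity)]
        congr 1; field_simp

/-- The part of the past in which the interface was ahead of the point under consideration. -/
lemma lintegral_gaussSlope_ahead {v₀ V σ₁ : ℝ} (hv₀ : 0 < v₀) (hV : 0 < V) (hσ₁ : 0 ≤ σ₁)
    {z : ℝ → ℝ} (hz : ∀ σ, σ₁ < σ → v₀ * (σ - σ₁) ≤ z σ ∧ z σ ≤ V * (σ - σ₁)) :
    ∫⁻ σ in Ioi σ₁, ENNReal.ofReal (gaussSlope (9 / 16) σ (z σ)) ≤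
      ENNReal.ofReal (4 / 3 + V / (3 * v₀)) := by
  let f : ℝ → ℝ → ℝ := fun c σ => (σ - σ₁) / (2 * σ) * (1 / √(4 * Real.pi) * (1 / √σ)) *
      Real.exp (-(c * (σ - σ₁) ^ 2) / (4 * σ))
  have hfm : ∀ c, Measurable (f c) := fun c => by simp only [f]; fun_prop
  have hc1 : √(9 / 16 * v₀ ^ 2) = 3 / 4 * v₀ := by
    rw [show 9 / 16 * v₀ ^ 2 = (3 / 4 * v₀) ^ 2 by ring]; exact Real.sqrt_sq (by positivity)
  have hc2 : √(9 / 4 * v₀ ^ 2) = 3 / 2 * v₀ := by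
    rw [show 9 / 4 * v₀ ^ 2 = (3 / 2 * v₀) ^ 2 by ring]; exact Real.sqrt_sq (by positivity)
  calc _ ≤ ∫⁻ σ in Ioi σ₁, (ENNReal.ofReal (2 * v₀) * ENNReal.ofReal (f (9 / 16 * v₀ ^ 2) σ) +
        ENNReal.ofReal V * ENNReal.ofReal (f (9 / 4 * v₀ ^ 2) σ)) := by
        refine setLIntegral_mono' measurableSet_Ioi fun σ hσ => ?_
        have hρ : 0 < σ - σ₁ := sub_pos.mpr hσ
        have hσ0 : 0 < σ := hσ₁.trans_lt hσ
        have hf0 : ∀ c, 0 ≤ f c σ := fun c => by simp only [f]; positivity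
        rw [← ENNReal.ofReal_mul (by positivity), ← ENNReal.ofReal_mul hV.le,
          ← ENNReal.ofReal_add (mul_nonneg (by positivity) (hf0 _)) (mul_nonneg hV.le (hf0 _))]
        apply ENNReal.ofReal_le_ofReal
        obtain ⟨hz1, hz2⟩ := hz σ hσ
        have hz0 : 0 < z σ := lt_of_lt_of_le (by positivity) hz1
        -- The range of `z` is cut at twice its lower bound. Below the cut the prefactor is at most
        -- `2 v₀ (σ - σ₁)`; above it the prefactor is at most `V (σ - σ₁)` but the exponent is four
        -- times larger. The pieces integrate to `4/3` and `V / (3 v₀)`. Without the cut the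
        -- coefficient of `V / v₀` would be `2/3`, too large for the coefficient `1/2` that
        -- `derivBound` offers when `α = 0`.
        have key : z σ * Real.exp (-(9 / 16 * z σ ^ 2) / (4 * σ)) ≤
            2 * v₀ * (σ - σ₁) * Real.exp (-(9 / 16 * v₀ ^ 2 * (σ - σ₁) ^ 2) / (4 * σ)) +
            V * (σ - σ₁) * Real.exp (-(9 / 4 * v₀ ^ 2 * (σ - σ₁) ^ 2) / (4 * σ)) := by
          rcases le_total (z σ) (2 * v₀ * (σ - σ₁)) with h | h
          · refine le_add_of_le_of_nonneg ?_ (by positivity)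
            have : (v₀ * (σ - σ₁)) ^ 2 ≤ z σ ^ 2 := pow_le_pow_left₀ (by positivity) hz1 2
            gcongr ?_ * Real.exp (?_ / _)
            nlinarith
          · refine le_add_of_nonneg_of_le (by positivity) ?_
            have : (2 * v₀ * (σ - σ₁)) ^ 2 ≤ z σ ^ 2 := pow_le_pow_left₀ (by positivity) h 2
            gcongr ?_ * Real.exp (?_ / _)
            nlinarith
        simp only [f]
        rw [gaussSlope, abs_of_pos hz0]
        calc _ = (1 / (2 * σ) * (1 / √(4 * Real.pi) * (1 / √σ))) *
              (z σ * Real.exp (-(9 / 16 * z σ ^ 2) / (4 * σ))) := by ring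
          _ ≤ _ := mul_le_mul_of_nonneg_left key (by positivity)
          _ = _ := by ring
    _ = ENNReal.ofReal (2 * v₀) * (∫⁻ σ in Ioi σ₁, ENNReal.ofReal (f (9 / 16 * v₀ ^ 2) σ)) +
        ENNReal.ofReal V * ∫⁻ σ in Ioi σ₁, ENNReal.ofReal (f (9 / 4 * v₀ ^ 2) σ) := by
        rw [lintegral_add_left ((hfm _).ennreal_ofReal.const_mul _),
          lintegral_const_mul _ (hfm _).ennreal_ofReal,
          lintegral_const_mul _ (hfm _).ennreal_ofReal]
    _ ≤ ENNReal.ofReal (2 * v₀) * ENNReal.ofReal (1 / (2 * (3 / 4 * v₀))) +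
        ENNReal.ofReal V * ENNReal.ofReal (1 / (2 * (3 / 2 * v₀))) := by
        rw [← hc1, ← hc2]
        gcongr
        · exact lintegral_lag_gaussian hσ₁ (by positivity)
        · exact lintegral_lag_gaussian hσ₁ (by positivity)
    _ = _ := by
        rw [← ENNReal.ofReal_mul (by positivity), ← ENNReal.ofReal_mul hV.le,
          ← ENNReal.ofReal_add (by positivity) (by positivity)]
        congr 1; field_simp

variable {γ v₀ V : ℝ} {v : ℝ → ℝ}

/-- If `x > 0`, the interface passed `x` at one elapsed time `σ₁`, which separates the parts
`behind` and `ahead`. If `x < 0`, it was always ahead, and `|x - d| = |x| + d` splits the slope into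
that of a source at rest and that of a path starting at the point itself. Either way the total is
`2/3 + 4/3 + V / (3 v₀)`. -/
lemma lintegral_gaussSlope_le (hv₀ : 0 < v₀) (hv : IsSpeed v₀ V v) (t : ℝ) {x : ℝ}
    (hx : x ≠ 0) :
    ∫⁻ σ in Ioi (0 : ℝ), ENNReal.ofReal (gaussSlope (9 / 16) σ (x - depth v t σ)) ≤
      ENNReal.ofReal (2 + V / (3 * v₀)) := by
  have hV : 0 < V := hv₀.trans_le hv.le
  have hsq : √(9 / 16 : ℝ) = 3 / 4 := by
    rw [show (9 / 16 : ℝ) = (3 / 4) ^ 2 by norm_num]; exact Real.sqrt_sq (by norm_num)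
  have hsum : ENNReal.ofReal (1 / (2 * √(9 / 16 : ℝ))) + ENNReal.ofReal (4 / 3 + V / (3 * v₀)) =
      ENNReal.ofReal (2 + V / (3 * v₀)) := by
    rw [← ENNReal.ofReal_add (by positivity) (by positivity), hsq]
    congr 1; ring
  rw [← hsum]
  rcases lt_or_gt_of_ne hx with hneg | hpos
  · have hm : Measurable fun σ => ENNReal.ofReal (gaussSlope (9 / 16) σ (-x - (0 : ℝ))) := by
      unfold gaussSlope; fun_prop
    calc _ ≤ ∫⁻ σ in Ioi (0 : ℝ), (ENNReal.ofReal (gaussSlope (9 / 16) σ (-x - (0 : ℝ))) +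
          ENNReal.ofReal (gaussSlope (9 / 16) σ (depth v t σ))) := by
          refine setLIntegral_mono' measurableSet_Ioi fun σ hσ => ?_
          have hσ0 : (0 : ℝ) < σ := hσ
          have hk : 0 < -x := by linarith
          have hd : 0 ≤ depth v t σ := hv.depth_nonneg hv₀ t hσ0.le
          rw [← ENNReal.ofReal_add (by unfold gaussSlope; positivity)
            (by unfold gaussSlope; positivity)]
          apply ENNReal.ofReal_le_ofReal
          unfold gaussSlope
          rw [sub_zero, abs_of_neg (by linarith : x - depth v t σ < 0), abs_of_pos hk,
            abs_of_nonneg hd]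
          generalize depth v t σ = d at *
          have h1 : Real.exp (-(9 / 16 * (x - d) ^ 2) / (4 * σ)) ≤
              Real.exp (-(9 / 16 * (-x) ^ 2) / (4 * σ)) := by
            gcongr Real.exp (?_ / _); nlinarith [mul_nonneg hk.le hd]
          have h2 : Real.exp (-(9 / 16 * (x - d) ^ 2) / (4 * σ)) ≤
              Real.exp (-(9 / 16 * d ^ 2) / (4 * σ)) := by
            gcongr Real.exp (?_ / _); nlinarith [mul_nonneg hk.le hd, sq_nonneg x]
          calc _ = -x / (2 * σ) * (1 / √(4 * Real.pi) * (1 / √σ)) *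
                  Real.exp (-(9 / 16 * (x - d) ^ 2) / (4 * σ)) +
                d / (2 * σ) * (1 / √(4 * Real.pi) * (1 / √σ)) *
                  Real.exp (-(9 / 16 * (x - d) ^ 2) / (4 * σ)) := by ring
            _ ≤ _ := by gcongr
      _ = (∫⁻ σ in Ioi (0 : ℝ), ENNReal.ofReal (gaussSlope (9 / 16) σ (-x - (0 : ℝ)))) +
          ∫⁻ σ in Ioi (0 : ℝ), ENNReal.ofReal (gaussSlope (9 / 16) σ (depth v t σ)) :=
          lintegral_add_left hm _
      _ ≤ _ := by
          refine add_le_add ?_ (lintegral_gaussSlope_ahead hv₀ hV le_rfl fun σ hσ => by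
            simpa using hv.depth_bounds t (le_of_lt hσ))
          refine le_trans (lintegral_mono_set fun σ hσ => ?_)
            (lintegral_gaussSlope_behind (d := fun _ => 0) (w := fun _ => 0)
              (fun σ => hasDerivAt_const _ _) (fun _ => le_rfl) (-x) (by norm_num))
          exact ⟨hσ, by linarith⟩
  · have hc := continuous_depth hv.continuous t
    obtain ⟨σ₁, hσ₁, hdσ₁⟩ : ∃ σ₁ ∈ Icc 0 (x / v₀), depth v t σ₁ = x := by
      refine intermediate_value_Icc (by positivity) hc.continuousOn ⟨?_, ?_⟩
      · rw [depth_zero]; exact hpos.le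
      · have := (hv.depth_bounds t (by positivity : 0 ≤ x / v₀)).1
        rwa [mul_div_cancel₀ _ hv₀.ne'] at this
    have hsub : Ioi (0 : ℝ) ⊆ {σ | 0 < σ ∧ depth v t σ < x} ∪ Ici σ₁ := fun σ hσ => by
      rcases lt_or_ge σ σ₁ with h | h
      · refine Or.inl ⟨hσ, ?_⟩
        have := (hv.depth_sub t h.le).1
        have := mul_pos hv₀ (sub_pos.mpr h)
        linarith
      · exact Or.inr h
    refine (lintegral_mono_set hsub).trans ((lintegral_union_le _ _ _).trans ?_)
    refine add_le_add (lintegral_gaussSlope_behind (fun σ => hasDerivAt_depth hv.continuous t σ)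
      (fun σ => by have := (hv.bounds (t - σ)).2; linarith) x (by norm_num)) ?_
    rw [← setLIntegral_congr Ioi_ae_eq_Ici]
    have hsymm : ∀ σ, gaussSlope (9 / 16) σ (x - depth v t σ) =
        gaussSlope (9 / 16) σ (depth v t σ - x) := fun σ => by
      unfold gaussSlope; rw [abs_sub_comm, ← neg_sub x, neg_sq]
    simp only [hsymm]
    refine lintegral_gaussSlope_ahead hv₀ hV hσ₁.1 fun σ hσ => ?_
    rw [← hdσ₁]
    exact hv.depth_sub t (le_of_lt hσ)

/-! ### The space derivative of the single layer potential -/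

/-- The space derivative of the single layer potential. -/
def layerDeriv (γ : ℝ) (v : ℝ → ℝ) (t x : ℝ) : ℝ :=
  ∫ σ in Ioc 0 t, -((x - depth v t σ) / (2 * σ) * gauss σ (x - depth v t σ)) * source γ v t σ

lemma weighted_layerDeriv_le (hγ : 0 < γ) (hv₀ : 0 < v₀) (hv : IsSpeed v₀ V v) {β : ℝ}
    (hβ : 0 ≤ β) (hβ' : β ≤ alphaMin v₀ V γ) (t : ℝ) {x : ℝ} (hx : x ≠ 0) :
    Real.exp (β * |x|) * |layerDeriv γ v t x| ≤ V * (2 + V / (3 * v₀)) := by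
  have hV : 0 < V := hv₀.trans_le hv.le
  have hE : 0 < Real.exp (β * |x|) := Real.exp_pos _
  rw [← abs_of_pos hE, ← abs_mul, layerDeriv, ← integral_const_mul,
    ← ENNReal.ofReal_le_ofReal_iff (by positivity), ← Real.norm_eq_abs, ofReal_norm]
  calc _ ≤ ∫⁻ σ in Ioc 0 t, ‖Real.exp (β * |x|) * (-((x - depth v t σ) / (2 * σ) *
        gauss σ (x - depth v t σ)) * source γ v t σ)‖ₑ := enorm_integral_le_lintegral_enorm _
    _ ≤ ∫⁻ σ in Ioc 0 t, ENNReal.ofReal V *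
        ENNReal.ofReal (gaussSlope (9 / 16) σ (x - depth v t σ)) := by
        refine setLIntegral_mono' measurableSet_Ioc fun σ hσ => ?_
        rw [← ofReal_norm, ← ENNReal.ofReal_mul hV.le]
        apply ENNReal.ofReal_le_ofReal
        have hσ0 : 0 < σ := hσ.1
        rw [Real.norm_eq_abs, abs_mul, abs_mul, abs_neg, abs_mul, abs_div, abs_of_pos hE,
          abs_of_nonneg (gauss_nonneg _ _), abs_of_pos (by positivity : 0 < 2 * σ)]
        have hd := hv.depth_bounds t hσ0.le
        have h := weighted_gauss_le hγ hv₀ hv.le hβ hβ' hσ0 (hv.depth_nonneg hv₀ t hσ0.le) hd.2 x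
        have he : Real.exp (-(γ / 4) * σ) ≤ 1 := by rw [Real.exp_le_one_iff]; nlinarith
        calc _ ≤ Real.exp (β * |x|) * (|x - depth v t σ| / (2 * σ) * gauss σ (x - depth v t σ) *
              (V * Real.exp (-γ * σ))) := by
              gcongr
              · exact mul_nonneg (by positivity) (gauss_nonneg _ _)
              · exact abs_source_le hv₀ hv t σ
          _ = V * (|x - depth v t σ| / (2 * σ) *
              (Real.exp (β * |x|) * (gauss σ (x - depth v t σ) * Real.exp (-γ * σ)))) := by ring
          _ ≤ V * (|x - depth v t σ| / (2 * σ) * (1 / √(4 * Real.pi) * (1 / √σ) *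
              (1 * Real.exp (-(9 / 16 * (x - depth v t σ) ^ 2) / (4 * σ))))) := by
              refine mul_le_mul_of_nonneg_left (mul_le_mul_of_nonneg_left (h.trans ?_)
                (by positivity)) hV.le
              gcongr
          _ = _ := by unfold gaussSlope; ring
    _ ≤ ∫⁻ σ in Ioi (0 : ℝ), ENNReal.ofReal V *
        ENNReal.ofReal (gaussSlope (9 / 16) σ (x - depth v t σ)) :=
        lintegral_mono_set Ioc_subset_Ioi_self
    _ = ENNReal.ofReal V *
        ∫⁻ σ in Ioi (0 : ℝ), ENNReal.ofReal (gaussSlope (9 / 16) σ (x - depth v t σ)) :=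
        lintegral_const_mul' _ _ ENNReal.ofReal_ne_top
    _ ≤ ENNReal.ofReal (V * (2 + V / (3 * v₀))) := by
        rw [ENNReal.ofReal_mul hV.le]
        gcongr
        exact lintegral_gaussSlope_le hv₀ hv t hx

/-- Off the interface the slope of the kernel has no singularity: either `V σ ≥ c / 2`, so that `1 /
σ` is bounded, or `|y| ≥ c / 2` and the Gaussian beats `1 / σ`. This is the locally uniform majorant
for differentiating the layer under the integral sign. -/
lemma abs_mul_gauss_le_const (hV : 0 < V) {c σ y : ℝ} (hc : 0 < c) (hσ : 0 < σ)
    (h : c ≤ |y| + V * σ) : |y| / (2 * σ) * gauss σ y ≤ 2 * V / c + 32 / c ^ 2 := by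
  rcases le_total (c / 2) (V * σ) with h1 | h1
  · refine (abs_mul_gauss_le hσ y).trans ?_
    have : 1 / σ ≤ 2 * V / c := by
      rw [div_le_div_iff₀ hσ hc]; linarith
    have : 0 ≤ 32 / c ^ 2 := by positivity
    linarith
  · have hy : c / 2 ≤ |y| := by linarith
    have hy2 : c ^ 2 / 4 ≤ y ^ 2 := by rw [← sq_abs y]; nlinarith
    refine (abs_mul_gauss_le_exp hσ y).trans ?_
    have hu : y ^ 2 / (8 * σ) ≤ Real.exp (y ^ 2 / (8 * σ)) := by
      linarith [Real.add_one_le_exp (y ^ 2 / (8 * σ))]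
    have hy0 : 0 < y ^ 2 := by have : 0 < c ^ 2 := by positivity
                               linarith
    have h2 : 1 / σ * Real.exp (-y ^ 2 / (8 * σ)) ≤ 8 / y ^ 2 := by
      rw [neg_div, Real.exp_neg]
      calc _ ≤ 1 / σ * (y ^ 2 / (8 * σ))⁻¹ := by gcongr
        _ = _ := by field_simp
    have h3 : 8 / y ^ 2 ≤ 32 / c ^ 2 := by
      rw [div_le_div_iff₀ hy0 (by positivity)]; linarith
    have : 0 ≤ 2 * V / c := by positivity
    linarith

lemma abs_layerDeriv_integrand_le (hγ : 0 < γ) (hv₀ : 0 < v₀) (hv : IsSpeed v₀ V v) (t : ℝ)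
    {c x σ : ℝ} (hc : 0 < c) (hx : c ≤ |x|) (hσ : 0 < σ) :
    ‖-((x - depth v t σ) / (2 * σ) * gauss σ (x - depth v t σ)) * source γ v t σ‖ ≤
      (2 * V / c + 32 / c ^ 2) * V := by
  have hV : 0 < V := hv₀.trans_le hv.le
  have hd0 := hv.depth_nonneg hv₀ t hσ.le
  have hd := (hv.depth_bounds t hσ.le).2
  rw [norm_mul, norm_neg, norm_mul, Real.norm_eq_abs, Real.norm_eq_abs, Real.norm_eq_abs,
    abs_div, abs_of_nonneg (gauss_nonneg _ _), abs_of_pos (by positivity : 0 < 2 * σ)]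
  have h1 : c ≤ |x - depth v t σ| + V * σ := by
    have := abs_add_le (x - depth v t σ) (depth v t σ)
    rw [sub_add_cancel, abs_of_nonneg hd0] at this
    linarith
  have h2 : |source γ v t σ| ≤ V := by
    refine (abs_source_le hv₀ hv t σ).trans (mul_le_of_le_one_right hV.le ?_)
    rw [Real.exp_le_one_iff]; nlinarith
  exact mul_le_mul (abs_mul_gauss_le_const hV hc hσ h1) h2 (abs_nonneg _) (by positivity)

lemma measurable_layerDeriv_integrand (hv : Continuous v) (t x : ℝ) :
    Measurable fun σ =>
      -((x - depth v t σ) / (2 * σ) * gauss σ (x - depth v t σ)) * source γ v t σ := by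
  have h1 := (continuous_depth hv t).measurable
  have h2 := measurable_gauss_comp measurable_id (measurable_const.sub h1 : Measurable
    fun σ => x - depth v t σ)
  have h3 := (continuous_source (γ := γ) hv t).measurable
  exact ((((measurable_const.sub h1).div (measurable_const.mul measurable_id)).mul h2).neg).mul h3

lemma eventually_half_le_abs {x : ℝ} (hx : x ≠ 0) : ∀ᶠ y in 𝓝 x, |x| / 2 ≤ |y| := by
  have : |x| / 2 < |x| := half_lt_self (abs_pos.mpr hx)
  filter_upwards [continuous_abs.continuousAt.eventually (lt_mem_nhds this)] with y hy
  exact le_of_lt hy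

lemma integrableOn_layerDeriv (hγ : 0 < γ) (hv₀ : 0 < v₀) (hv : IsSpeed v₀ V v) (t : ℝ) {x : ℝ}
    (hx : x ≠ 0) :
    IntegrableOn (fun σ => -((x - depth v t σ) / (2 * σ) * gauss σ (x - depth v t σ)) *
      source γ v t σ) (Ioc 0 t) := by
  refine (integrableOn_const (C := (2 * V / |x| + 32 / |x| ^ 2) * V) (by simp)).mono'
    (measurable_layerDeriv_integrand hv.continuous t x).aestronglyMeasurable
    ((ae_restrict_iff' measurableSet_Ioc).mpr (ae_of_all _ fun σ hσ => ?_))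
  exact abs_layerDeriv_integrand_le hγ hv₀ hv t (abs_pos.mpr hx) le_rfl hσ.1

lemma hasDerivAt_layer (hγ : 0 < γ) (hv₀ : 0 < v₀) (hv : IsSpeed v₀ V v) (t : ℝ) {x : ℝ}
    (hx : x ≠ 0) : HasDerivAt (layer γ v t) (layerDeriv γ v t x) x := by
  refine (hasDerivAt_integral_of_dominated_loc_of_deriv_le
    (F := fun x σ => gauss σ (x - depth v t σ) * source γ v t σ)
    (F' := fun x σ => -((x - depth v t σ) / (2 * σ) * gauss σ (x - depth v t σ)) *
      source γ v t σ) (μ := volume.restrict (Ioc 0 t))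
    (bound := fun _ => (2 * V / (|x| / 2) + 32 / (|x| / 2) ^ 2) * V)
    (eventually_half_le_abs hx)
    (Eventually.of_forall fun y => (measurable_layer_integrand hv.continuous t y).aestronglyMeasurable)
    (integrableOn_layer hγ hv₀ hv t x)
    (measurable_layerDeriv_integrand hv.continuous t x).aestronglyMeasurable
    ((ae_restrict_iff' measurableSet_Ioc).mpr (ae_of_all _ fun σ hσ y hy => ?_))
    (integrableOn_const (by simp))
    (ae_of_all _ fun σ y _ => ?_)).2
  · exact abs_layerDeriv_integrand_le hγ hv₀ hv t (half_pos (abs_pos.mpr hx)) hy hσ.1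
  · have h := ((hasDerivAt_gauss σ (y - depth v t σ)).comp y
      ((hasDerivAt_id y).sub_const (depth v t σ))).mul_const (source γ v t σ)
    simpa [Function.comp_def] using h

lemma continuousAt_layerDeriv (hγ : 0 < γ) (hv₀ : 0 < v₀) (hv : IsSpeed v₀ V v) (t : ℝ) {x : ℝ}
    (hx : x ≠ 0) : ContinuousAt (layerDeriv γ v t) x := by
  refine continuousAt_of_dominated (bound := fun _ => (2 * V / (|x| / 2) + 32 / (|x| / 2) ^ 2) * V)
    (Eventually.of_forall fun y =>
      (measurable_layerDeriv_integrand hv.continuous t y).aestronglyMeasurable)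
    ((eventually_half_le_abs hx).mono fun y hy =>
      (ae_restrict_iff' measurableSet_Ioc).mpr (ae_of_all _ fun σ hσ => ?_))
    (integrableOn_const (by simp)) (ae_of_all _ fun σ => ?_)
  · exact abs_layerDeriv_integrand_le hγ hv₀ hv t (half_pos (abs_pos.mpr hx)) hy hσ.1
  · have hg : Continuous (gauss σ) := by unfold gauss; fun_prop
    exact Continuous.continuousAt (by fun_prop)

end

noncomputable section

variable {γ v₀ V : ℝ} {v : ℝ → ℝ}

/-! ### One-sided limits of the derivative at the interface -/

/-- The regular part of the derivative of the single layer potential. -/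
def layerDrift (γ : ℝ) (v : ℝ → ℝ) (t x : ℝ) : ℝ :=
  ∫ σ in Ioc 0 t, depth v t σ / (2 * σ) * gauss σ (x - depth v t σ) * source γ v t σ

/-- The integrand of the singular part of the derivative of the single layer potential. -/
def layerKink (γ : ℝ) (v : ℝ → ℝ) (t x σ : ℝ) : ℝ :=
  (Iic t).indicator (fun σ => 1 / (2 * σ) * gauss σ (x - depth v t σ) * source γ v t σ) σ

lemma measurable_layerDrift_integrand (hv : Continuous v) (t x : ℝ) :
    Measurable fun σ =>
      depth v t σ / (2 * σ) * gauss σ (x - depth v t σ) * source γ v t σ := by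
  have h1 := (continuous_depth hv t).measurable
  have h2 := measurable_gauss_comp measurable_id (measurable_const.sub h1 : Measurable
    fun σ => x - depth v t σ)
  have h3 := (continuous_source (γ := γ) hv t).measurable
  exact ((h1.div (measurable_const.mul measurable_id)).mul h2).mul h3

lemma measurable_layerKink (hv : Continuous v) (t x : ℝ) : Measurable (layerKink γ v t x) := by
  have h1 := (continuous_depth hv t).measurable
  have h2 := measurable_gauss_comp measurable_id (measurable_const.sub h1 : Measurable
    fun σ => x - depth v t σ)
  have h3 := (continuous_source (γ := γ) hv t).measurable
  exact (((measurable_const.div (measurable_const.mul measurable_id)).mul h2).mul h3).indicator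
    measurableSet_Iic

lemma norm_layerDrift_integrand_le (hv₀ : 0 < v₀) (hv : IsSpeed v₀ V v) (t x : ℝ) {σ : ℝ}
    (hσ : 0 < σ) : ‖depth v t σ / (2 * σ) * gauss σ (x - depth v t σ) * source γ v t σ‖ ≤
      V / 2 * (V * (1 / √σ * Real.exp (-γ * σ))) := by
  have hd := hv.depth_bounds t hσ.le
  have hd0 := hv.depth_nonneg hv₀ t hσ.le
  have hV : 0 < V := hv₀.trans_le hv.le
  rw [mul_assoc, norm_mul, Real.norm_of_nonneg (by positivity)]
  refine mul_le_mul ?_ (abs_layer_integrand_le hv₀ hv t _ hσ) (norm_nonneg _) (by positivity)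
  rw [div_le_div_iff₀ (by positivity) two_pos]
  linarith

lemma integrableOn_layerDrift_bound (hγ : 0 < γ) (V t : ℝ) :
    IntegrableOn (fun σ : ℝ => V / 2 * (V * (1 / √σ * Real.exp (-γ * σ)))) (Ioc 0 t) := by
  have h : IntegrableOn (fun σ : ℝ => V / 2 * (V * (1 / √σ * Real.exp (-γ * σ)))) (Ioi 0) :=
    ((integrableOn_inv_sqrt_mul_exp hγ).const_mul V).const_mul (V / 2)
  exact h.mono_set Ioc_subset_Ioi_self

lemma integrableOn_layerDrift (hγ : 0 < γ) (hv₀ : 0 < v₀) (hv : IsSpeed v₀ V v) (t x : ℝ) :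
    IntegrableOn (fun σ => depth v t σ / (2 * σ) * gauss σ (x - depth v t σ) *
      source γ v t σ) (Ioc 0 t) :=
  (integrableOn_layerDrift_bound hγ V t).mono'
    (measurable_layerDrift_integrand hv.continuous t x).aestronglyMeasurable
    ((ae_restrict_iff' measurableSet_Ioc).mpr (ae_of_all _ fun _ hσ =>
      norm_layerDrift_integrand_le hv₀ hv t x hσ.1))

lemma continuous_layerDrift (hγ : 0 < γ) (hv₀ : 0 < v₀) (hv : IsSpeed v₀ V v) (t : ℝ) :
    Continuous (layerDrift γ v t) := by
  refine continuous_of_dominated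
    (fun y => (measurable_layerDrift_integrand hv.continuous t y).aestronglyMeasurable)
    (fun y => (ae_restrict_iff' measurableSet_Ioc).mpr (ae_of_all _ fun σ hσ =>
      norm_layerDrift_integrand_le hv₀ hv t y hσ.1))
    (integrableOn_layerDrift_bound hγ V t) (ae_of_all _ fun σ => ?_)
  have hg : Continuous (gauss σ) := by unfold gauss; fun_prop
  fun_prop

/-- Write the factor `-(x - d)` as `-x + d`. In the second part `d = O(σ)` cancels `1 / σ`, so it is
continuous across the interface; the possible jump is confined to the first. -/
lemma layerDeriv_eq (hγ : 0 < γ) (hv₀ : 0 < v₀) (hv : IsSpeed v₀ V v) (t : ℝ) {x : ℝ}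
    (hx : x ≠ 0) :
    layerDeriv γ v t x = -(x * ∫ σ in Ioi 0, layerKink γ v t x σ) + layerDrift γ v t x := by
  have h1 := integrableOn_layerDeriv hγ hv₀ hv t hx
  have h2 := integrableOn_layerDrift hγ hv₀ hv t x
  have hk : ∫ σ in Ioi 0, layerKink γ v t x σ =
      ∫ σ in Ioc 0 t, 1 / (2 * σ) * gauss σ (x - depth v t σ) * source γ v t σ := by
    unfold layerKink
    rw [integral_indicator measurableSet_Iic, Measure.restrict_restrict measurableSet_Iic,
      inter_comm, Ioi_inter_Iic]
  rw [hk, ← sub_eq_iff_eq_add, layerDeriv, layerDrift, ← integral_sub h1 h2,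
    ← integral_const_mul, ← integral_neg]
  congr 1; ext σ; ring

/-- The profile of the jump of the derivative across the interface, in similarity variables. -/
def kinkDensity (s : ℝ) : ℝ :=
  1 / (2 * s) * (1 / √(4 * Real.pi) * (1 / √s)) * Real.exp (-1 / (4 * s))

/-- This density is the slope of the kernel at distance one from a source at rest, so the estimate
for the interface behind the point applies with `d = 0`. -/
lemma integrableOn_kinkDensity : IntegrableOn kinkDensity (Ioi 0) := by
  have hm : Measurable kinkDensity := by unfold kinkDensity; fun_prop
  refine ⟨hm.aestronglyMeasurable, ?_⟩
  have h := lintegral_gaussSlope_behind (d := fun _ => 0) (w := fun _ => 0)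
    (fun σ => hasDerivAt_const _ _) (fun _ => le_rfl) 1 one_pos
  have hs : {σ : ℝ | 0 < σ ∧ (0 : ℝ) < 1} = Ioi 0 := by ext; simp
  rw [hs] at h
  refine lt_of_le_of_lt (le_trans (le_of_eq ?_) h) ENNReal.ofReal_lt_top
  refine setLIntegral_congr_fun measurableSet_Ioi fun s hs => ?_
  have : (0 : ℝ) < s := hs
  rw [← ofReal_norm, Real.norm_of_nonneg (by unfold kinkDensity; positivity)]
  simp [gaussSlope, kinkDensity]

lemma scaled_gauss_kink {s x d : ℝ} (hs : 0 < s) (hx : x ≠ 0) :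
    |x| * x ^ 2 * (1 / (2 * (x ^ 2 * s)) * gauss (x ^ 2 * s) (x - d)) =
      1 / (2 * s) * (1 / √(4 * Real.pi) * (1 / √s)) * Real.exp (-(1 - d / x) ^ 2 / (4 * s)) := by
  rw [gauss_eq, Real.sqrt_mul (sq_nonneg x), Real.sqrt_sq_eq_abs]
  have h1 : -(x - d) ^ 2 / (4 * (x ^ 2 * s)) = -(1 - d / x) ^ 2 / (4 * s) := by
    field_simp
  have h2 : 0 < |x| := abs_pos.mpr hx
  rw [h1]; field_simp

/-- Under `σ = x² s` the displacement divided by `x` is `O(|x|)` for fixed `s`: near the interface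
its motion becomes invisible, and the source tends to its present value. With the factor `|x|` the
limit is the same from both sides; replacing `|x|` by `x` reverses its sign on the left. -/
lemma tendsto_integral_layerKink (hγ : 0 < γ) (hv₀ : 0 < v₀) (hv : IsSpeed v₀ V v) {t : ℝ}
    (ht : 0 < t) :
    Tendsto (fun x => |x| * ∫ σ in Ioi 0, layerKink γ v t x σ) (𝓝[≠] 0)
      (𝓝 (∫ s in Ioi 0, kinkDensity s * -v t)) := by
  have hV : 0 < V := hv₀.trans_le hv.le
  have hsub : ∀ x : ℝ, x ≠ 0 → |x| * ∫ σ in Ioi 0, layerKink γ v t x σ =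
      ∫ s in Ioi 0, |x| * x ^ 2 * layerKink γ v t x (x ^ 2 * s) := fun x hx => by
    have h := integral_comp_mul_left_Ioi (layerKink γ v t x) 0 (by positivity : 0 < x ^ 2)
    rw [mul_zero, smul_eq_mul] at h
    rw [integral_const_mul, h]
    field_simp
  have hval : ∀ x : ℝ, x ≠ 0 → ∀ s, 0 < s → x ^ 2 * s ≤ t →
      |x| * x ^ 2 * layerKink γ v t x (x ^ 2 * s) =
      1 / (2 * s) * (1 / √(4 * Real.pi) * (1 / √s)) *
        Real.exp (-(1 - depth v t (x ^ 2 * s) / x) ^ 2 / (4 * s)) *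
        source γ v t (x ^ 2 * s) := fun x hx s hs hst => by
    rw [layerKink, indicator_of_mem (mem_Iic.mpr hst), ← scaled_gauss_kink hs hx]
    ring
  have hratio : ∀ x : ℝ, x ≠ 0 → ∀ s, 0 < s → |depth v t (x ^ 2 * s) / x| ≤ V * s * |x| :=
    fun x hx s hs => by
      have h2 : 0 < |x| := abs_pos.mpr hx
      have hp : 0 ≤ x ^ 2 * s := by positivity
      rw [abs_div, abs_of_nonneg (hv.depth_nonneg hv₀ t hp), div_le_iff₀ h2]
      refine (hv.depth_bounds t hp).2.trans (le_of_eq ?_)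
      rw [← sq_abs]; ring
  refine Tendsto.congr' (f₁ := fun x => ∫ s in Ioi 0,
    |x| * x ^ 2 * layerKink γ v t x (x ^ 2 * s)) ?_ ?_
  · filter_upwards [self_mem_nhdsWithin] with x hx
    exact (hsub x hx).symm
  refine tendsto_integral_filter_of_dominated_convergence
    (fun s => Real.exp (V / 2) * V * kinkDensity s) ?_ ?_
    (integrableOn_kinkDensity.const_mul _) ?_
  · refine Eventually.of_forall fun x => ?_
    exact (((measurable_layerKink hv.continuous t x).comp
      (measurable_const.mul measurable_id)).const_mul _).aestronglyMeasurable
  · have h1 : ∀ᶠ x : ℝ in 𝓝[≠] 0, |x| < 1 := by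
      refine nhdsWithin_le_nhds ?_
      have := continuous_abs.continuousAt (x := (0 : ℝ))
      exact this.eventually (gt_mem_nhds (by simp))
    filter_upwards [self_mem_nhdsWithin, h1] with x hx hx1
    refine (ae_restrict_iff' measurableSet_Ioi).mpr (ae_of_all _ fun s hs => ?_)
    have hs0 : (0 : ℝ) < s := hs
    have hk : 0 ≤ kinkDensity s := by unfold kinkDensity; positivity
    by_cases hst : x ^ 2 * s ≤ t
    · rw [hval x hx s hs0 hst, norm_mul, norm_mul, Real.norm_of_nonneg (by positivity),
        Real.norm_of_nonneg (Real.exp_pos _).le, Real.norm_eq_abs]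
      have hsrc : |source γ v t (x ^ 2 * s)| ≤ V := by
        refine (abs_source_le hv₀ hv t _).trans (mul_le_of_le_one_right hV.le ?_)
        rw [Real.exp_le_one_iff]
        have : 0 ≤ γ * (x ^ 2 * s) := by positivity
        linarith
      -- With `q` the rescaled displacement, `-(1 - q)² ≤ -1 + 2 q` and `q ≤ V s` for `|x| < 1`, so
      -- the motion costs at most `2 V s / (4 s) = V / 2` in the exponent.
      have hexp : Real.exp (-(1 - depth v t (x ^ 2 * s) / x) ^ 2 / (4 * s)) ≤
          Real.exp (V / 2) * Real.exp (-1 / (4 * s)) := by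
        rw [← Real.exp_add]
        gcongr
        have hr := (le_abs_self _).trans (hratio x hx s hs0)
        have hr1 : V * s * |x| ≤ V * s * 1 := by gcongr
        rw [← sub_nonneg]
        have : V / 2 + -1 / (4 * s) - -(1 - depth v t (x ^ 2 * s) / x) ^ 2 / (4 * s) =
          (2 * (V * s - depth v t (x ^ 2 * s) / x) + (depth v t (x ^ 2 * s) / x) ^ 2) /
            (4 * s) := by
          generalize depth v t (x ^ 2 * s) / x = q
          field_simp; ring
        rw [this]
        apply div_nonneg _ (by positivity)
        nlinarith [sq_nonneg (depth v t (x ^ 2 * s) / x)]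
      calc _ ≤ 1 / (2 * s) * (1 / √(4 * Real.pi) * (1 / √s)) *
            (Real.exp (V / 2) * Real.exp (-1 / (4 * s))) * V := by gcongr
        _ = _ := by unfold kinkDensity; ring
    · rw [layerKink, indicator_of_notMem (by simpa using hst), mul_zero, norm_zero]
      positivity
  · refine (ae_restrict_iff' measurableSet_Ioi).mpr (ae_of_all _ fun s hs => ?_)
    have hs0 : (0 : ℝ) < s := hs
    have hsq : Tendsto (fun x : ℝ => x ^ 2 * s) (𝓝[≠] 0) (𝓝 0) := by
      have : Continuous fun x : ℝ => x ^ 2 * s := by fun_prop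
      have h := this.tendsto 0
      simp only [ne_eq, OfNat.ofNat_ne_zero, not_false_eq_true, zero_pow, zero_mul] at h
      exact h.mono_left nhdsWithin_le_nhds
    have hq : Tendsto (fun x : ℝ => depth v t (x ^ 2 * s) / x) (𝓝[≠] 0) (𝓝 0) := by
      have hb : Tendsto (fun x : ℝ => V * s * |x|) (𝓝[≠] 0) (𝓝 0) := by
        have : Continuous fun x : ℝ => V * s * |x| := by fun_prop
        have h := this.tendsto 0
        simp only [abs_zero, mul_zero] at h
        exact h.mono_left nhdsWithin_le_nhds
      refine squeeze_zero_norm' ?_ hb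
      filter_upwards [self_mem_nhdsWithin] with x hx
      exact hratio x hx s hs0
    have hsrc : Tendsto (fun x : ℝ => source γ v t (x ^ 2 * s)) (𝓝[≠] 0) (𝓝 (-v t)) := by
      have h := ((continuous_source (γ := γ) hv.continuous t).tendsto 0).comp hsq
      simpa [source, Function.comp_def] using h
    have hexp : Tendsto (fun x : ℝ => Real.exp (-(1 - depth v t (x ^ 2 * s) / x) ^ 2 / (4 * s)))
        (𝓝[≠] 0) (𝓝 (Real.exp (-1 / (4 * s)))) := by
      have hc : Continuous fun q : ℝ => Real.exp (-(1 - q) ^ 2 / (4 * s)) := by fun_prop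
      have h := (hc.tendsto 0).comp hq
      simpa [Function.comp_def] using h
    have hlim := ((tendsto_const_nhds (x := 1 / (2 * s) * (1 / √(4 * Real.pi) * (1 / √s)))).mul
      hexp).mul hsrc
    refine hlim.congr' ?_
    filter_upwards [self_mem_nhdsWithin, hsq.eventually (gt_mem_nhds ht)] with x hx hxt
    exact (hval x hx s hs0 (le_of_lt hxt)).symm

lemma exists_tendsto_layerDeriv (hγ : 0 < γ) (hv₀ : 0 < v₀) (hv : IsSpeed v₀ V v) {t : ℝ}
    (ht : 0 < t) :
    (∃ l, Tendsto (layerDeriv γ v t) (𝓝[>] 0) (𝓝 l)) ∧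
      ∃ l, Tendsto (layerDeriv γ v t) (𝓝[<] 0) (𝓝 l) := by
  have hk := tendsto_integral_layerKink hγ hv₀ hv ht
  have hd := (continuous_layerDrift hγ hv₀ hv t).tendsto 0
  constructor
  · refine ⟨_, Tendsto.congr' ?_ ((hk.mono_left (nhdsWithin_mono _ fun x hx => ne_of_gt hx)).neg.add
      (hd.mono_left nhdsWithin_le_nhds))⟩
    filter_upwards [self_mem_nhdsWithin] with x hx
    rw [layerDeriv_eq hγ hv₀ hv t (ne_of_gt hx), abs_of_pos hx]
  · refine ⟨_, Tendsto.congr' ?_ ((hk.mono_left (nhdsWithin_mono _ fun x hx => ne_of_lt hx)).add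
      (hd.mono_left nhdsWithin_le_nhds))⟩
    filter_upwards [self_mem_nhdsWithin] with x hx
    rw [layerDeriv_eq hγ hv₀ hv t (ne_of_lt hx), abs_of_neg hx]
    ring

/-! ### Piecewise continuous differentiability -/

lemma contDiffOn_Ici_of_hasDerivAt {f f' : ℝ → ℝ} {a l : ℝ} (hf : Continuous f)
    (hd : ∀ x, a < x → HasDerivAt f (f' x) x) (hc : ∀ x, a < x → ContinuousAt f' x)
    (hl : Tendsto f' (𝓝[>] a) (𝓝 l)) : ContDiffOn ℝ 1 f (Ici a) := by
  have ha : HasDerivWithinAt f l (Ici a) a := by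
    refine hasDerivWithinAt_Ici_of_tendsto_deriv (s := Ioi a)
      (fun x hx => (hd x hx).differentiableAt.differentiableWithinAt) hf.continuousWithinAt
      self_mem_nhdsWithin (hl.congr' ?_)
    filter_upwards [self_mem_nhdsWithin] with x hx
    exact ((hd x hx).deriv).symm
  have hu : UniqueDiffOn ℝ (Ici a) := uniqueDiffOn_Ici a
  have hda : derivWithin f (Ici a) a = l := ha.derivWithin (hu a self_mem_Ici)
  have hdx : ∀ x, a < x → derivWithin f (Ici a) x = f' x := fun x hx =>
    (hd x hx).hasDerivWithinAt.derivWithin (hu x (le_of_lt hx))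
  rw [contDiffOn_one_iff_derivWithin hu]
  refine ⟨fun x hx => ?_, fun x hx => ?_⟩
  · rcases eq_or_lt_of_le (mem_Ici.mp hx) with rfl | h
    · exact ha.differentiableWithinAt
    · exact (hd x h).differentiableAt.differentiableWithinAt
  · rcases eq_or_lt_of_le (mem_Ici.mp hx) with rfl | h
    · rw [← continuousWithinAt_sdiff_self, Ici_sdiff_left, ContinuousWithinAt, hda]
      refine hl.congr' ?_
      filter_upwards [self_mem_nhdsWithin] with y hy
      exact (hdx y hy).symm
    · refine ((hc x h).congr ?_).continuousWithinAt
      filter_upwards [lt_mem_nhds h] with y hy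
      exact (hdx y hy).symm

lemma contDiffOn_Iic_of_hasDerivAt {f f' : ℝ → ℝ} {a l : ℝ} (hf : Continuous f)
    (hd : ∀ x, x < a → HasDerivAt f (f' x) x) (hc : ∀ x, x < a → ContinuousAt f' x)
    (hl : Tendsto f' (𝓝[<] a) (𝓝 l)) : ContDiffOn ℝ 1 f (Iic a) := by
  have h := contDiffOn_Ici_of_hasDerivAt (f := fun x => f (-x)) (f' := fun x => -f' (-x))
    (a := -a) (l := -l) (by fun_prop)
    (fun x hx => by
      have := (hd (-x) (by linarith)).comp x (hasDerivAt_neg x)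
      simpa [Function.comp_def] using this)
    (fun x hx => by
      have h1 := hc (-x) (by linarith)
      exact (ContinuousAt.comp (f := fun x : ℝ => -x) h1 continuous_neg.continuousAt).neg)
    (by
      refine (hl.comp ?_).neg
      have h := tendsto_neg_nhdsGT (a := -a)
      rwa [neg_neg] at h)
  have h2 := h.comp (contDiff_neg (𝕜 := ℝ) (F := ℝ) (n := 1)).contDiffOn (s := Iic a)
    (fun x hx => by simpa using hx)
  refine h2.congr fun x _ => ?_
  simp

/-! ### Smoothness and weighted bounds of the profile, and comparison with `derivBound`. -/

/-- The space derivative of the profile. -/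
def profileDeriv (γ : ℝ) (v u : ℝ → ℝ) (t x : ℝ) : ℝ :=
  Real.exp (-γ * t) * heatDeriv t u (x + front v t) + layerDeriv γ v t x

variable {u : ℝ → ℝ} {M t : ℝ}

lemma hasDerivAt_profile (hγ : 0 < γ) (hv₀ : 0 < v₀) (hv : IsSpeed v₀ V v) (hu : Continuous u)
    (hM : ∀ x, |u x| ≤ M) (ht : 0 < t) {x : ℝ} (hx : x ≠ 0) :
    HasDerivAt (profile γ v u t) (profileDeriv γ v u t x) x := by
  have h1 := (hasDerivAt_heat hu hM ht (x + front v t)).comp_add_const x (front v t)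
  exact (h1.const_mul _).add (hasDerivAt_layer hγ hv₀ hv t hx)

lemma contDiffOn_profile (hγ : 0 < γ) (hv₀ : 0 < v₀) (hv : IsSpeed v₀ V v) (hu : Continuous u)
    (hM : ∀ x, |u x| ≤ M) (ht : 0 < t) :
    ContDiffOn ℝ 1 (profile γ v u t) (Iic 0) ∧ ContDiffOn ℝ 1 (profile γ v u t) (Ici 0) := by
  obtain ⟨⟨l₁, hl₁⟩, l₂, hl₂⟩ := exists_tendsto_layerDeriv hγ hv₀ hv ht
  have hc := continuous_profile hγ hv₀ hv hu hM t
  have hh : Continuous fun x => Real.exp (-γ * t) * heatDeriv t u (x + front v t) :=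
    continuous_const.mul ((continuous_heatDeriv hu hM t).comp (by fun_prop))
  have hcd : ∀ x, x ≠ 0 → ContinuousAt (profileDeriv γ v u t) x := fun x hx =>
    hh.continuousAt.add (continuousAt_layerDeriv hγ hv₀ hv t hx)
  exact ⟨contDiffOn_Iic_of_hasDerivAt hc
      (fun x hx => hasDerivAt_profile hγ hv₀ hv hu hM ht (ne_of_lt hx))
      (fun x hx => hcd x (ne_of_lt hx))
      (((hh.tendsto 0).mono_left nhdsWithin_le_nhds).add hl₂),
    contDiffOn_Ici_of_hasDerivAt hc
      (fun x hx => hasDerivAt_profile hγ hv₀ hv hu hM ht (ne_of_gt hx))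
      (fun x hx => hcd x (ne_of_gt hx))
      (((hh.tendsto 0).mono_left nhdsWithin_le_nhds).add hl₁)⟩

/-- Only boundedness of the initial state is used, so the weight stays on the heat term. For fixed
`x` that term vanishes as `t → ∞`, which is how attractor elements acquire decay at rates `β` above
`α`. -/
lemma weighted_profile_le (hγ : 0 < γ) (hv₀ : 0 < v₀) (hv : IsSpeed v₀ V v)
    (hM : ∀ x, |u x| ≤ M) {β : ℝ} (hβ : 0 ≤ β) (hβ' : β ≤ alphaMin v₀ V γ) (t x : ℝ) :
    Real.exp (β * |x|) * |profile γ v u t x| ≤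
      Real.exp (β * |x|) * (Real.exp (-γ * t) * M) + V / √γ := by
  have h1 : |profile γ v u t x| ≤ Real.exp (-γ * t) * M + |layer γ v t x| := by
    refine (abs_add_le _ _).trans (add_le_add_left ?_ _)
    rw [abs_mul, Real.abs_exp]
    exact mul_le_mul_of_nonneg_left (abs_heat_le hM _ _) (Real.exp_pos _).le
  refine (mul_le_mul_of_nonneg_left h1 (Real.exp_pos _).le).trans ?_
  rw [mul_add]
  exact add_le_add_right (weighted_layer_le hγ hv₀ hv hβ hβ' t x) _

lemma weighted_profileDeriv_le (hγ : 0 < γ) (hv₀ : 0 < v₀) (hv : IsSpeed v₀ V v)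
    (hM : ∀ x, |u x| ≤ M) (ht : 1 ≤ t) {β : ℝ} (hβ : 0 ≤ β) (hβ' : β ≤ alphaMin v₀ V γ) {x : ℝ}
    (hx : x ≠ 0) :
    Real.exp (β * |x|) * |profileDeriv γ v u t x| ≤
      Real.exp (β * |x|) * (Real.exp (-γ * t) * M) + V * (2 + V / (3 * v₀)) := by
  have hM0 : 0 ≤ M := (abs_nonneg _).trans (hM 0)
  have h1 : |profileDeriv γ v u t x| ≤ Real.exp (-γ * t) * M + |layerDeriv γ v t x| := by
    refine (abs_add_le _ _).trans (add_le_add_left ?_ _)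
    rw [abs_mul, Real.abs_exp]
    refine mul_le_mul_of_nonneg_left ((abs_heatDeriv_le hM (by linarith) _).trans ?_)
      (Real.exp_pos _).le
    exact div_le_self hM0 (Real.one_le_sqrt.mpr ht)
  refine (mul_le_mul_of_nonneg_left h1 (Real.exp_pos _).le).trans ?_
  rw [mul_add]
  exact add_le_add_right (weighted_layerDeriv_le hγ hv₀ hv hβ hβ' t hx) _

/-- With `r = V / v₀`, the number `2 + r / 3` is at most `6` for `r ≤ 12` and at most `(1 + r) / 2`
for `r ≥ 9`. Any threshold between `9` and `12` would serve. -/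
lemma slope_const_le {γ v₀ V α : ℝ} (hv₀ : 0 < v₀) (hV : v₀ ≤ V) (hα : 0 ≤ α) :
    V * (2 + V / (3 * v₀)) ≤ derivBound v₀ V α γ := by
  have hVp : 0 < V := hv₀.trans_le hV
  unfold derivBound
  refine mul_le_mul_of_nonneg_left ?_ hVp.le
  refine le_trans ?_ (le_max_right _ _)
  have e : V / (3 * v₀) = V / v₀ / 3 := by field_simp
  rw [e]
  rcases le_total (V / v₀) 12 with h | h
  · refine le_trans ?_ (le_max_right _ _)
    have : 0 ≤ 2 / √γ := by positivity
    linarith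
  · refine le_trans ?_ (le_max_left _ _)
    have h1 : 1 ≤ Real.exp α := Real.one_le_exp hα
    have h2 : 1 / 2 * (1 + V / v₀) * 1 ≤ 1 / 2 * (1 + V / v₀) * Real.exp α := by
      gcongr
    linarith

lemma derivBound_mono {γ v₀ V α β : ℝ} (hv₀ : 0 < v₀) (hV : 0 < V) (h : α ≤ β) :
    derivBound v₀ V α γ ≤ derivBound v₀ V β γ := by
  unfold derivBound
  gcongr

end

noncomputable section

/-! ### Chapman–Kolmogorov identities -/

/-- Completing the square in `ξ`: a kernel at the total time multiplies a kernel centred at the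
weighted mean, which integrates to one. -/
lemma gauss_mul_gauss {t r : ℝ} (ht : 0 < t) (hr : 0 < r) (x a ξ : ℝ) :
    gauss t (x - ξ) * gauss r (ξ - a) =
      gauss (t + r) (x - a) * gauss (t * r / (t + r)) ((r * x + t * a) / (t + r) - ξ) := by
  have hs : 0 < t + r := by positivity
  unfold gauss
  rw [div_mul_div_comm, div_mul_div_comm, ← Real.exp_add, ← Real.exp_add,
    ← Real.sqrt_mul (by positivity), ← Real.sqrt_mul (by positivity)]
  congr 1
  · congr 1; field_simp; ring
  · congr 1; field_simp

lemma integrable_gauss (q c : ℝ) (hq : 0 < q) : Integrable fun ξ => gauss q (c - ξ) :=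
  (integrable_exp_neg_sq_div (b := 4 * q) (by positivity) c).div_const (√(4 * Real.pi * q))

lemma integral_gauss (q c : ℝ) (hq : 0 < q) : ∫ ξ, gauss q (c - ξ) = 1 := by
  have h := integral_gauss_mul hq (fun _ => 1) c
  simpa [heat, integral_bell] using h

lemma integrable_gauss_mul {u : ℝ → ℝ} (hu : Continuous u) {M : ℝ} (hM : ∀ x, |u x| ≤ M)
    {t : ℝ} (ht : 0 < t) (x : ℝ) : Integrable fun ξ => gauss t (x - ξ) * u ξ := by
  have hg : Continuous (gauss t) := by unfold gauss; fun_prop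
  refine ((integrable_gauss t x ht).mul_const M).mono' (by fun_prop) (ae_of_all _ fun ξ => ?_)
  rw [norm_mul, Real.norm_of_nonneg (gauss_nonneg _ _)]
  exact mul_le_mul_of_nonneg_left (hM ξ) (gauss_nonneg _ _)

lemma lintegral_gauss_mul_gauss {t r : ℝ} (ht : 0 < t) (hr : 0 < r) (x a : ℝ) :
    ∫⁻ ξ, ENNReal.ofReal (gauss t (x - ξ) * gauss r (ξ - a)) =
      ENNReal.ofReal (gauss (t + r) (x - a)) := by
  have hq : 0 < t * r / (t + r) := by positivity
  simp_rw [gauss_mul_gauss ht hr]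
  rw [← ofReal_integral_eq_lintegral_ofReal ((integrable_gauss _ _ hq).const_mul _)
    (ae_of_all _ fun ξ => mul_nonneg (gauss_nonneg _ _) (gauss_nonneg _ _)),
    integral_const_mul, integral_gauss _ _ hq, mul_one]

/-- The heat flow of a superposition of heat kernels. -/
lemma integral_gauss_mul_integral {X : Type*} [MeasurableSpace X] {μ : Measure X} [SFinite μ]
    {ρ a h : X → ℝ} (hρm : Measurable ρ) (ham : Measurable a) (hhm : Measurable h)
    (hρ : ∀ᵐ i ∂μ, 0 < ρ i) (hh : ∀ i, 0 ≤ h i)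
    (hint : ∀ ξ, Integrable (fun i => gauss (ρ i) (ξ - a i) * h i) μ) {t : ℝ} (ht : 0 < t)
    (x : ℝ) :
    ∫ ξ, gauss t (x - ξ) * ∫ i, gauss (ρ i) (ξ - a i) * h i ∂μ =
      ∫ i, gauss (t + ρ i) (x - a i) * h i ∂μ := by
  have hnn : ∀ ξ i, 0 ≤ gauss (ρ i) (ξ - a i) * h i := fun ξ i =>
    mul_nonneg (gauss_nonneg _ _) (hh i)
  have hmeas : Measurable fun p : ℝ × X => gauss t (x - p.1) * (gauss (ρ p.2) (p.1 - a p.2) * h p.2) :=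
    (measurable_gauss_comp measurable_const (measurable_const.sub measurable_fst)).mul
      ((measurable_gauss_comp (hρm.comp measurable_snd)
        (measurable_fst.sub (ham.comp measurable_snd))).mul (hhm.comp measurable_snd))
  have hmi : StronglyMeasurable fun ξ => ∫ i, gauss (ρ i) (ξ - a i) * h i ∂μ := by
    refine StronglyMeasurable.integral_prod_right (f := fun ξ i => gauss (ρ i) (ξ - a i) * h i) ?_
    exact Measurable.stronglyMeasurable ((measurable_gauss_comp (hρm.comp measurable_snd)
        (measurable_fst.sub (ham.comp measurable_snd))).mul (hhm.comp measurable_snd))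
  have hm1 : Measurable fun ξ => gauss t (x - ξ) :=
    measurable_gauss_comp measurable_const (measurable_const.sub measurable_id)
  have hm2 : Measurable fun i => gauss (t + ρ i) (x - a i) * h i :=
    (measurable_gauss_comp (measurable_const.add hρm) (measurable_const.sub ham)).mul hhm
  -- All factors are nonnegative, so with lower integrals Tonelli exchanges the order without any
  -- joint integrability.
  rw [integral_eq_lintegral_of_nonneg_ae
      (ae_of_all _ fun ξ => mul_nonneg (gauss_nonneg _ _) (integral_nonneg (hnn ξ)))
      (hm1.aestronglyMeasurable.mul hmi.aestronglyMeasurable),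
    integral_eq_lintegral_of_nonneg_ae
      (ae_of_all _ fun i => mul_nonneg (gauss_nonneg _ _) (hh i))
      hm2.aestronglyMeasurable]
  congr 1
  calc ∫⁻ ξ, ENNReal.ofReal (gauss t (x - ξ) * ∫ i, gauss (ρ i) (ξ - a i) * h i ∂μ)
      = ∫⁻ ξ, ∫⁻ i, ENNReal.ofReal (gauss t (x - ξ) * (gauss (ρ i) (ξ - a i) * h i)) ∂μ := by
        congr 1; ext ξ
        rw [← integral_const_mul, ofReal_integral_eq_lintegral_ofReal ((hint ξ).const_mul _)
          (ae_of_all _ fun i => mul_nonneg (gauss_nonneg _ _) (hnn ξ i))]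
    _ = ∫⁻ i, (∫⁻ ξ, ENNReal.ofReal (gauss t (x - ξ) * (gauss (ρ i) (ξ - a i) * h i))) ∂μ :=
        lintegral_lintegral_swap hmeas.ennreal_ofReal.aemeasurable
    _ = _ := by
        refine lintegral_congr_ae (hρ.mono fun i hi => ?_)
        simp only
        rw [ENNReal.ofReal_mul (gauss_nonneg _ _), ← lintegral_gauss_mul_gauss ht hi,
          ← lintegral_mul_const' _ _ ENNReal.ofReal_ne_top]
        congr 1; ext ξ
        rw [← mul_assoc, ENNReal.ofReal_mul (mul_nonneg (gauss_nonneg _ _) (gauss_nonneg _ _))]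

variable {γ v₀ V : ℝ} {v : ℝ → ℝ}

lemma heat_heat {u : ℝ → ℝ} (hu : Continuous u) (h0 : ∀ x, 0 ≤ u x) {M : ℝ}
    (hM : ∀ x, |u x| ≤ M) {t r : ℝ} (ht : 0 < t) (hr : 0 < r) (x s : ℝ) :
    heat t (fun ξ => heat r u (ξ + s)) x = heat (t + r) u (x + s) := by
  rw [← integral_gauss_mul ht, ← integral_gauss_mul (by positivity : 0 < t + r)]
  simp_rw [← integral_gauss_mul hr]
  have h := integral_gauss_mul_integral (μ := volume) (ρ := fun _ : ℝ => r)
    (a := fun η => η - s) (h := u) measurable_const (by fun_prop) hu.measurable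
    (ae_of_all _ fun _ => hr) h0 (fun ξ => by
      simp_rw [← sub_add]
      simp_rw [sub_add_eq_add_sub]
      exact integrable_gauss_mul hu hM hr _) ht x
  simp_rw [← sub_add, sub_add_eq_add_sub] at h
  exact h

lemma heat_layer (hγ : 0 < γ) (hv₀ : 0 < v₀) (hv : IsSpeed v₀ V v) {t r : ℝ} (ht : 0 < t)
    (x : ℝ) :
    heat t (layer γ v r) x =
      ∫ σ in Ioc 0 r, gauss (t + σ) (x - depth v r σ) * source γ v r σ := by
  rw [← integral_gauss_mul ht]
  exact integral_gauss_mul_integral measurable_id (continuous_depth hv.continuous r).measurable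
    (continuous_source hv.continuous r).measurable
    ((ae_restrict_iff' measurableSet_Ioc).mpr (ae_of_all _ fun σ hσ => hσ.1))
    (source_nonneg hv₀ hv r) (fun ξ => integrableOn_layer hγ hv₀ hv r ξ) ht x

lemma front_shift (hv : Continuous v) (r t : ℝ) :
    front (fun τ => v (r + τ)) t = front v (r + t) - front v r := by
  have h := intervalIntegral.integral_comp_add_left (a := 0) (b := t) v r
  rw [front, h, add_zero, front, front, intervalIntegral.integral_interval_sub_left
    (hv.intervalIntegrable _ _) (hv.intervalIntegrable _ _)]

lemma depth_shift (hv : Continuous v) (r t σ : ℝ) :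
    depth (fun τ => v (r + τ)) t σ = depth v (r + t) σ := by
  rw [depth, front_shift hv, front_shift hv, depth, sub_sub_sub_cancel_right, add_sub_assoc]

lemma source_shift (γ : ℝ) (v : ℝ → ℝ) (r t σ : ℝ) :
    source γ (fun τ => v (r + τ)) t σ = source γ v (r + t) σ := by
  rw [source, source, add_sub_assoc]

/-- The past is cut at elapsed time `t`. Heat emitted after time `r` is the layer of the shifted
velocity; heat emitted earlier is the layer at time `r`, carried on by the heat flow and the losses
for a further time `t`. -/
lemma layer_add (hγ : 0 < γ) (hv₀ : 0 < v₀) (hv : IsSpeed v₀ V v) {t r : ℝ} (ht : 0 < t)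
    (hr : 0 < r) (x : ℝ) :
    layer γ v (r + t) x = layer γ (fun τ => v (r + τ)) t x +
      Real.exp (-γ * t) * heat t (layer γ v r) (x + (front v (r + t) - front v r)) := by
  have hI := integrableOn_layer hγ hv₀ hv (r + t) x
  have h1 : layer γ v (r + t) x =
      (∫ σ in (0 : ℝ)..t, gauss σ (x - depth v (r + t) σ) * source γ v (r + t) σ) +
      ∫ σ in t..(r + t), gauss σ (x - depth v (r + t) σ) * source γ v (r + t) σ := by
    rw [intervalIntegral.integral_add_adjacent_intervals,
      intervalIntegral.integral_of_le (by positivity), layer]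
    · rw [intervalIntegrable_iff_integrableOn_Ioc_of_le ht.le]
      exact hI.mono_set (Ioc_subset_Ioc_right (by linarith))
    · rw [intervalIntegrable_iff_integrableOn_Ioc_of_le (by linarith)]
      exact hI.mono_set (Ioc_subset_Ioc_left ht.le)
  have h2 := intervalIntegral.integral_comp_add_left (a := 0) (b := r)
    (fun σ => gauss σ (x - depth v (r + t) σ) * source γ v (r + t) σ) t
  rw [add_zero, add_comm t r] at h2
  rw [h1, ← h2, heat_layer hγ hv₀ hv ht, intervalIntegral.integral_of_le ht.le,
    intervalIntegral.integral_of_le hr.le, layer, ← integral_const_mul]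
  congr 1
  · simp_rw [depth_shift hv.continuous, source_shift]
  · congr 1; ext σ
    have e1 : r + t - (t + σ) = r - σ := by ring
    have e2 : x - depth v (r + t) (t + σ) =
        x + (front v (r + t) - front v r) - depth v r σ := by
      rw [depth, depth, e1]; ring
    rw [e2, source, source, e1, mul_add, Real.exp_add]
    ring

lemma IsSpeed.shift (hv : IsSpeed v₀ V v) (r : ℝ) : IsSpeed v₀ V fun τ => v (r + τ) :=
  ⟨hv.continuous.comp (by fun_prop), fun _ => hv.bounds _⟩

/-- The semigroup law for a given path of the interface. -/
lemma profile_profile (hγ : 0 < γ) (hv₀ : 0 < v₀) (hv : IsSpeed v₀ V v) {u : ℝ → ℝ}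
    (hu : Continuous u) (h0 : ∀ x, 0 ≤ u x) {M : ℝ} (hM : ∀ x, |u x| ≤ M) {t r : ℝ}
    (ht : 0 < t) (hr : 0 < r) (x : ℝ) :
    profile γ (fun τ => v (r + τ)) (profile γ v u r) t x = profile γ v u (r + t) x := by
  set X := x + (front v (r + t) - front v r) with hX
  have hc1 : Continuous fun ξ => heat r u (ξ + front v r) :=
    (continuous_heat_uncurry hu hM).comp (by fun_prop : Continuous fun ξ => (r, ξ + front v r))
  have hsplit : heat t (profile γ v u r) X =
      Real.exp (-γ * r) * heat t (fun ξ => heat r u (ξ + front v r)) X +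
        heat t (layer γ v r) X := by
    have hi1 := (integrable_bell_mul hc1 (fun ξ => abs_heat_le hM r _) t X).const_mul
      (Real.exp (-γ * r))
    have hi2 : Integrable fun z => bell z * layer γ v r (X + 2 * √t * z) := by
      refine integrable_bell_mul (continuous_layer hγ hv₀ hv r) (M := V / √γ) (fun ξ => ?_) t X
      have hV := hv₀.trans_le hv.le
      have := weighted_layer_le hγ hv₀ hv le_rfl (le_min (by positivity) (by positivity)) r ξ
      simpa using this
    rw [heat, heat, heat, ← integral_const_mul, ← integral_add hi1 hi2]
    congr 1; ext z
    rw [profile]; ring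
  have e1 : X + front v r = x + front v (r + t) := by rw [hX]; ring
  rw [profile, front_shift hv.continuous, hsplit, heat_heat hu h0 hM ht hr, e1, profile,
    layer_add hγ hv₀ hv ht hr, mul_add, ← mul_assoc, ← Real.exp_add, add_comm t r,
    show -γ * t + -γ * r = -γ * (r + t) by ring]
  ring

end

noncomputable section

variable {γ v₀ V L : ℝ} {g : ℝ → ℝ}

/-! ### The integral equation for the velocity -/

lemma IsKinetics.exists_lipschitz (hg : IsKinetics v₀ V g) :
    ∃ L, 0 ≤ L ∧ ∀ a b, 0 ≤ a → 0 ≤ b → |g a - g b| ≤ L * |a - b| := by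
  obtain ⟨C, hC⟩ := hg.bounded_deriv
  refine ⟨C, (abs_nonneg _).trans (hC 0 self_mem_Ici), fun a b ha hb => ?_⟩
  exact Convex.norm_image_sub_le_of_norm_derivWithin_le hg.differentiableOn hC (convex_Ici 0) hb ha

lemma IsKinetics.pos (hg : IsKinetics v₀ V g) : v₀ ≤ V := by
  have := hg.bounds 0 self_mem_Ici; linarith

/-- The velocity that the kinetics assigns to the interface temperature generated by `v`. -/
def kineticStep (γ : ℝ) (g u v : ℝ → ℝ) (t : ℝ) : ℝ := g (profile γ v u (max t 0) 0)

/-- A globally continuous solution of the integral equation. -/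
structure IsSolution (γ v₀ V : ℝ) (g u v : ℝ → ℝ) : Prop extends IsSpeed v₀ V v where
  equation : ∀ t, 0 < t → v t = g (profile γ v u t 0)

lemma isSpeed_kineticStep (hγ : 0 < γ) (hv₀ : 0 < v₀) (hg : IsKinetics v₀ V g) {u v : ℝ → ℝ}
    (hu : Continuous u) (h0 : ∀ x, 0 ≤ u x) {M : ℝ} (hM : ∀ x, |u x| ≤ M)
    (hv : IsSpeed v₀ V v) : IsSpeed v₀ V (kineticStep γ g u v) := by
  have hp : ∀ t, profile γ v u t 0 ∈ Ici (0 : ℝ) := fun t => profile_nonneg hv₀ hv h0 t 0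
  refine ⟨?_, fun t => hg.bounds _ (hp _)⟩
  exact hg.differentiableOn.continuousOn.comp_continuous
    ((continuous_profile_time hγ hv₀ hv hu hM 0).comp (by fun_prop)) fun t => hp _

/-- The constant in the stability estimate for profiles. -/
def stabilityConst (γ V M : ℝ) : ℝ := M + √Real.pi + V * √(Real.pi / γ)

lemma exists_rate {A : ℝ} (hA : 0 ≤ A) : ∃ l, 0 < l ∧ A / √l ≤ 1 / 2 := by
  refine ⟨(2 * A + 1) ^ 2, by positivity, ?_⟩
  rw [Real.sqrt_sq (by positivity), div_le_div_iff₀ (by positivity) two_pos]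
  linarith

lemma forall_nonneg_of_pos {f h : ℝ → ℝ} (hf : Continuous f) (hh : Continuous h)
    (H : ∀ τ, 0 < τ → f τ ≤ h τ) : ∀ τ, 0 ≤ τ → f τ ≤ h τ := by
  have hc : IsClosed {τ | f τ ≤ h τ} := isClosed_le hf hh
  have hs : closure (Ioi (0 : ℝ)) ⊆ {τ | f τ ≤ h τ} := hc.closure_subset_iff.mpr H
  rw [closure_Ioi] at hs
  exact fun τ hτ => hs hτ

/-- The kinetic step contracts differences of velocities in an exponentially weighted norm. -/
lemma abs_kineticStep_sub_le (hγ : 0 < γ) (hv₀ : 0 < v₀) (hg : IsKinetics v₀ V g)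
    (hL0 : 0 ≤ L) (hL : ∀ a b, 0 ≤ a → 0 ≤ b → |g a - g b| ≤ L * |a - b|)
    {u₁ u₂ v₁ v₂ : ℝ → ℝ} (hu₁ : Continuous u₁) (h0₁ : ∀ x, 0 ≤ u₁ x) {N : ℝ}
    (hN : ∀ x, |u₁ x| ≤ N) (hu₂ : Continuous u₂) (h0₂ : ∀ x, 0 ≤ u₂ x) {M : ℝ}
    (hM : ∀ x, |u₂ x| ≤ M) {η : ℝ} (hη : ∀ x, |u₁ x - u₂ x| ≤ η)
    (h₁ : IsSpeed v₀ V v₁) (h₂ : IsSpeed v₀ V v₂) {D l : ℝ} (hD : 0 ≤ D) (hl : 0 < l)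
    (hrate : L * stabilityConst γ V M / √l ≤ 1 / 2)
    (h : ∀ τ, 0 ≤ τ → |v₁ τ - v₂ τ| ≤ D * Real.exp (l * τ)) {t : ℝ} (ht : 0 ≤ t) :
    |kineticStep γ g u₁ v₁ t - kineticStep γ g u₂ v₂ t| ≤
      (L * η + D / 2) * Real.exp (l * t) := by
  have hη0 : 0 ≤ η := (abs_nonneg _).trans (hη 0)
  have hc₁ := (isSpeed_kineticStep hγ hv₀ hg hu₁ h0₁ hN h₁).continuous
  have hc₂ := (isSpeed_kineticStep hγ hv₀ hg hu₂ h0₂ hM h₂).continuous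
  refine forall_nonneg_of_pos (f := fun t => |kineticStep γ g u₁ v₁ t - kineticStep γ g u₂ v₂ t|)
    (h := fun t => (L * η + D / 2) * Real.exp (l * t)) (by fun_prop) (by fun_prop)
    (fun τ hτ => ?_) t ht
  simp only [kineticStep, max_eq_left hτ.le]
  have hp := abs_profile_sub_le hγ hv₀ h₁ h₂ hu₁ hN hu₂ hM hη hD hl hτ
    (fun s hs _ => h s hs) 0
  have hE : 1 ≤ Real.exp (l * τ) := Real.one_le_exp (by positivity)
  calc _ ≤ L * |profile γ v₁ u₁ τ 0 - profile γ v₂ u₂ τ 0| :=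
        hL _ _ (profile_nonneg hv₀ h₁ h0₁ _ _) (profile_nonneg hv₀ h₂ h0₂ _ _)
    _ ≤ L * (η + stabilityConst γ V M / √l * (D * Real.exp (l * τ))) :=
        mul_le_mul_of_nonneg_left hp hL0
    _ = L * η * 1 + L * stabilityConst γ V M / √l * (D * Real.exp (l * τ)) := by ring
    _ ≤ L * η * Real.exp (l * τ) + 1 / 2 * (D * Real.exp (l * τ)) := by gcongr
    _ = _ := by ring

lemma IsSolution.eq_kineticStep (hγ : 0 < γ) (hv₀ : 0 < v₀) (hg : IsKinetics v₀ V g)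
    {u v : ℝ → ℝ} (hu : Continuous u) (h0 : ∀ x, 0 ≤ u x) {M : ℝ} (hM : ∀ x, |u x| ≤ M)
    (hv : IsSolution γ v₀ V g u v) {t : ℝ} (ht : 0 ≤ t) : v t = kineticStep γ g u v t := by
  have hc := (isSpeed_kineticStep hγ hv₀ hg hu h0 hM hv.toIsSpeed).continuous
  have H : ∀ τ, 0 < τ → v τ = kineticStep γ g u v τ := fun τ hτ => by
    rw [kineticStep, max_eq_left hτ.le]; exact hv.equation τ hτ
  exact le_antisymm (forall_nonneg_of_pos hv.continuous hc (fun τ hτ => (H τ hτ).le) t ht)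
    (forall_nonneg_of_pos hc hv.continuous (fun τ hτ => (H τ hτ).ge) t ht)

/-- Lipschitz dependence of the velocity on the initial temperature. -/
lemma IsSolution.abs_sub_le (hγ : 0 < γ) (hv₀ : 0 < v₀) (hg : IsKinetics v₀ V g)
    (hL0 : 0 ≤ L) (hL : ∀ a b, 0 ≤ a → 0 ≤ b → |g a - g b| ≤ L * |a - b|)
    {u₁ u₂ v₁ v₂ : ℝ → ℝ} (hu₁ : Continuous u₁) (h0₁ : ∀ x, 0 ≤ u₁ x) {N : ℝ}
    (hN : ∀ x, |u₁ x| ≤ N) (hu₂ : Continuous u₂) (h0₂ : ∀ x, 0 ≤ u₂ x) {M : ℝ}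
    (hM : ∀ x, |u₂ x| ≤ M) {η : ℝ} (hη : ∀ x, |u₁ x - u₂ x| ≤ η)
    (h₁ : IsSolution γ v₀ V g u₁ v₁) (h₂ : IsSolution γ v₀ V g u₂ v₂) {l : ℝ} (hl : 0 < l)
    (hrate : L * stabilityConst γ V M / √l ≤ 1 / 2) {t : ℝ} (ht : 0 ≤ t) :
    |v₁ t - v₂ t| ≤ 2 * L * η * Real.exp (l * t) := by
  have hη0 : 0 ≤ η := (abs_nonneg _).trans (hη 0)
  have hV : 0 < V := hv₀.trans_le hg.pos
  -- One step maps a constant `D` to `L η + D / 2`, whose fixed point is `2 L η`. The iteration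
  -- starts from the crude bound `2 V` for the difference of two admissible velocities.
  have key : ∀ n : ℕ, ∀ τ, 0 ≤ τ →
      |v₁ τ - v₂ τ| ≤ (2 * L * η + 2 * V * (1 / 2) ^ n) * Real.exp (l * τ) := by
    intro n
    induction n with
    | zero =>
      intro τ hτ
      have hE : 1 ≤ Real.exp (l * τ) := Real.one_le_exp (by positivity)
      have h3 := h₁.abs_le hv₀ τ
      have h4 := h₂.abs_le hv₀ τ
      have h5 := abs_sub (v₁ τ) (v₂ τ)
      have h6 : 0 ≤ 2 * L * η := by positivity
      rw [pow_zero, mul_one]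
      calc |v₁ τ - v₂ τ| ≤ (2 * L * η + 2 * V) * 1 := by linarith
        _ ≤ _ := by gcongr
    | succ n ih =>
      intro τ hτ
      rw [h₁.eq_kineticStep hγ hv₀ hg hu₁ h0₁ hN hτ, h₂.eq_kineticStep hγ hv₀ hg hu₂ h0₂ hM hτ]
      refine (abs_kineticStep_sub_le hγ hv₀ hg hL0 hL hu₁ h0₁ hN hu₂ h0₂ hM hη h₁.toIsSpeed
        h₂.toIsSpeed (by positivity) hl hrate ih hτ).trans (le_of_eq ?_)
      rw [pow_succ]; ring
  have hlim : Tendsto (fun n : ℕ => (2 * L * η + 2 * V * (1 / 2) ^ n) * Real.exp (l * t)) atTop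
      (𝓝 ((2 * L * η + 2 * V * 0) * Real.exp (l * t))) :=
    (((tendsto_pow_atTop_nhds_zero_of_lt_one (by norm_num) (by norm_num)).const_mul _).const_add
      _).mul_const _
  have := ge_of_tendsto' hlim fun n => key n t ht
  simpa using this

lemma stabilityConst_nonneg {M : ℝ} (hM : 0 ≤ M) (hV : 0 ≤ V) : 0 ≤ stabilityConst γ V M := by
  unfold stabilityConst; positivity

/-- Existence of a solution of the integral equation, by successive approximation. -/
lemma exists_isSolution (hγ : 0 < γ) (hv₀ : 0 < v₀) (hg : IsKinetics v₀ V g) {u : ℝ → ℝ}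
    (hu : Continuous u) (h0 : ∀ x, 0 ≤ u x) {M : ℝ} (hM : ∀ x, |u x| ≤ M) :
    ∃ v, IsSolution γ v₀ V g u v := by
  obtain ⟨L, hL0, hL⟩ := hg.exists_lipschitz
  have hV : 0 < V := hv₀.trans_le hg.pos
  have hM0 : 0 ≤ M := (abs_nonneg _).trans (hM 0)
  obtain ⟨l, hl, hrate⟩ := exists_rate (mul_nonneg hL0 (stabilityConst_nonneg (γ := γ) hM0 hV.le))
  let a : ℕ → ℝ → ℝ := fun n => Nat.rec (fun _ => -v₀) (fun _ v => kineticStep γ g u v) n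
  have ha : ∀ n, IsSpeed v₀ V (a n) := fun n => by
    induction n with
    | zero => exact ⟨continuous_const, fun _ => ⟨neg_le_neg hg.pos, le_rfl⟩⟩
    | succ n ih => exact isSpeed_kineticStep hγ hv₀ hg hu h0 hM ih
  -- Negative times are frozen at time zero, so contraction estimates known for `t ≥ 0` hold on the
  -- whole line.
  have hmax : ∀ v t, kineticStep γ g u v t = kineticStep γ g u v (max t 0) := fun v t => by
    simp [kineticStep]
  let E : ℝ → ℝ := fun t => Real.exp (l * max t 0)
  have hEc : Continuous E := by simp only [E]; fun_prop
  have hE : ∀ t, 1 ≤ E t := fun t => Real.one_le_exp (by positivity)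
  have hstep : ∀ {v w : ℝ → ℝ}, IsSpeed v₀ V v → IsSpeed v₀ V w → ∀ {D : ℝ}, 0 ≤ D →
      (∀ t, |v t - w t| ≤ D * E t) →
      ∀ t, |kineticStep γ g u v t - kineticStep γ g u w t| ≤ D / 2 * E t := by
    intro v w hv hw D hD h t
    rw [hmax v, hmax w]
    have := abs_kineticStep_sub_le hγ hv₀ hg hL0 hL hu h0 hM hu h0 hM (η := 0)
      (fun x => by simp) hv hw hD hl hrate
      (fun τ hτ => by have := h τ; simp only [E, max_eq_left hτ] at this; exact this)
      (le_max_right t 0)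
    simpa [E] using this
  have hdiff : ∀ n t, |a n t - a (n + 1) t| ≤ 2 * V * (1 / 2) ^ n * E t := by
    intro n
    induction n with
    | zero =>
      intro t
      have h3 := (ha 0).abs_le hv₀ t
      have h4 := (ha 1).abs_le hv₀ t
      have h5 := abs_sub (a 0 t) (a 1 t)
      rw [pow_zero, mul_one]
      calc |a 0 t - a 1 t| ≤ 2 * V * 1 := by linarith
        _ ≤ _ := by gcongr; exact hE t
    | succ n ih =>
      intro t
      refine (hstep (ha n) (ha (n + 1)) (by positivity) ih t).trans (le_of_eq ?_)
      rw [pow_succ]; ring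
  have hdist : ∀ t n, dist (a n t) (a (n + 1) t) ≤ 2 * V * E t * (1 / 2) ^ n := fun t n => by
    rw [Real.dist_eq]; exact (hdiff n t).trans (le_of_eq (by ring))
  have hcau : ∀ t, ∃ y, Tendsto (fun n => a n t) atTop (𝓝 y) := fun t =>
    cauchySeq_tendsto_of_complete
      (cauchySeq_of_le_geometric (1 / 2) (2 * V * E t) (by norm_num) (hdist t))
  choose v hv using hcau
  have hclose : ∀ n t, |a n t - v t| ≤ 4 * V * (1 / 2) ^ n * E t := fun n t => by
    have := dist_le_of_le_geometric_of_tendsto (1 / 2) (2 * V * E t) (by norm_num) (hdist t)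
      (hv t) n
    rw [Real.dist_eq] at this
    refine this.trans (le_of_eq ?_)
    ring
  have hpow : Tendsto (fun n : ℕ => ((1 : ℝ) / 2) ^ n) atTop (𝓝 0) :=
    tendsto_pow_atTop_nhds_zero_of_lt_one (by norm_num) (by norm_num)
  have hvs : IsSpeed v₀ V v := by
    refine ⟨?_, fun t => ⟨ge_of_tendsto' (hv t) fun n => ((ha n).bounds t).1,
      le_of_tendsto' (hv t) fun n => ((ha n).bounds t).2⟩⟩
    refine continuous_iff_continuousAt.mpr fun x => Metric.continuousAt_iff'.mpr fun ε hε => ?_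
    have hlim : Tendsto (fun n : ℕ => 4 * V * (1 / 2) ^ n * (E x + 1)) atTop (𝓝 0) := by
      simpa using (hpow.const_mul (4 * V)).mul_const (E x + 1)
    obtain ⟨n, hn⟩ := (hlim.eventually (gt_mem_nhds (show 0 < ε / 3 by positivity))).exists
    have h1 : ∀ᶠ y in 𝓝 x, E y < E x + 1 :=
      hEc.continuousAt.eventually (gt_mem_nhds (lt_add_one _))
    have h2 := Metric.continuousAt_iff'.mp ((ha n).continuous.continuousAt (x := x)) (ε / 3)
      (by positivity)
    filter_upwards [h1, h2] with y hy1 hy2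
    have b1 : |a n y - v y| < ε / 3 := ((hclose n y).trans (by gcongr)).trans_lt hn
    have b2 : |a n x - v x| < ε / 3 :=
      ((hclose n x).trans (by gcongr; exact (lt_add_one _).le)).trans_lt hn
    rw [Real.dist_eq] at hy2 ⊢
    rw [abs_lt] at *
    constructor <;> linarith [b1.1, b1.2, b2.1, b2.2, hy2.1, hy2.2]
  refine ⟨v, hvs, fun t ht => ?_⟩
  have hfix : Tendsto (fun n => a (n + 1) t) atTop (𝓝 (kineticStep γ g u v t)) := by
    rw [tendsto_iff_dist_tendsto_zero]
    have hlim : Tendsto (fun n : ℕ => 4 * V * (1 / 2) ^ n / 2 * E t) atTop (𝓝 0) := by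
      simpa using ((hpow.const_mul (4 * V)).div_const 2).mul_const (E t)
    exact squeeze_zero (fun _ => dist_nonneg)
      (fun n => hstep (ha n) hvs (by positivity) (hclose n) t) hlim
  have := tendsto_nhds_unique ((tendsto_add_atTop_iff_nat 1).mpr (hv t)) hfix
  rw [this, kineticStep, max_eq_left ht.le]

/-! ### Comparison with the velocities of the definition -/

lemma front_congr {v w : ℝ → ℝ} (h : EqOn v w (Ici 0)) {t : ℝ} (ht : 0 ≤ t) :
    front v t = front w t :=
  intervalIntegral.integral_congr fun τ hτ => h (by
    rw [uIcc_of_le ht] at hτ; exact hτ.1)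

lemma temperature_congr (γ : ℝ) {v w : ℝ → ℝ} (u : ℝ → ℝ) (h : EqOn v w (Ici 0)) {t : ℝ}
    (ht : 0 ≤ t) (x : ℝ) : temperature γ v u x t = temperature γ w u x t := by
  unfold temperature
  congr 1
  refine intervalIntegral.integral_congr fun τ hτ => ?_
  rw [uIcc_of_le ht] at hτ
  rw [front_congr h hτ.1, h hτ.1]

lemma profile_zero_eq_temperature (γ : ℝ) (v u : ℝ → ℝ) {t : ℝ} (ht : 0 < t) :
    profile γ v u t 0 = temperature γ v u (front v t) t := by
  rw [← temperature_eq_profile γ v u ht, zero_add]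

lemma IsSolution.isVelocity (hv₀ : 0 < v₀) {u v : ℝ → ℝ} (h0 : ∀ x, 0 ≤ u x)
    (hv : IsSolution γ v₀ V g u v) : IsVelocity γ g u v where
  continuousOn := hv.continuous.continuousOn
  nonneg t ht := by
    rw [← profile_zero_eq_temperature γ v u ht]
    exact profile_nonneg hv₀ hv.toIsSpeed h0 t 0
  kinetics t ht := by
    rw [← profile_zero_eq_temperature γ v u ht]; exact hv.equation t ht

/-- Nothing is known about `w` at negative times, so it is frozen there. The bounds hold for `t > 0`
by the kinetics and reach `t = 0` by continuity. -/
lemma IsVelocity.exists_isSolution (hg : IsKinetics v₀ V g) {u w : ℝ → ℝ}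
    (hw : IsVelocity γ g u w) : ∃ v, IsSolution γ v₀ V g u v ∧ EqOn w v (Ici 0) := by
  have heq : EqOn w (fun t => w (max t 0)) (Ici 0) := fun t ht => by
    simp only [max_eq_left (mem_Ici.mp ht)]
  have hc : Continuous fun t => w (max t 0) :=
    hw.continuousOn.comp_continuous (by fun_prop) fun t => mem_Ici.mpr (le_max_right _ _)
  have hb : ∀ t, 0 < t → -V ≤ w t ∧ w t ≤ -v₀ := fun t ht => by
    rw [hw.kinetics t ht]; exact hg.bounds _ (hw.nonneg t ht)
  refine ⟨fun t => w (max t 0), ⟨⟨hc, fun t => ?_⟩, fun t ht => ?_⟩, heq⟩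
  · have h1 := forall_nonneg_of_pos continuous_const hc (f := fun _ => -V) (fun τ hτ => by
      rw [max_eq_left hτ.le]; exact (hb τ hτ).1) (max t 0) (le_max_right _ _)
    have h2 := forall_nonneg_of_pos hc continuous_const (h := fun _ => -v₀) (fun τ hτ => by
      rw [max_eq_left hτ.le]; exact (hb τ hτ).2) (max t 0) (le_max_right _ _)
    simpa using And.intro h1 h2
  · rw [profile_zero_eq_temperature _ _ _ ht, ← temperature_congr γ u heq ht.le,
      ← front_congr heq ht.le, max_eq_left ht.le]
    exact hw.kinetics t ht

lemma IsSolution.eqOn (hγ : 0 < γ) (hv₀ : 0 < v₀) (hg : IsKinetics v₀ V g) {u v w : ℝ → ℝ}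
    (hu : Continuous u) (h0 : ∀ x, 0 ≤ u x) {M : ℝ} (hM : ∀ x, |u x| ≤ M)
    (hv : IsSolution γ v₀ V g u v) (hw : IsSolution γ v₀ V g u w) : EqOn v w (Ici 0) := by
  obtain ⟨L, hL0, hL⟩ := hg.exists_lipschitz
  have hM0 : 0 ≤ M := (abs_nonneg _).trans (hM 0)
  obtain ⟨l, hl, hrate⟩ := exists_rate
    (mul_nonneg hL0 (stabilityConst_nonneg (γ := γ) hM0 (hv₀.trans_le hg.pos).le))
  intro t ht
  have := hv.abs_sub_le hγ hv₀ hg hL0 hL hu h0 hM hu h0 hM (η := 0) (fun x => by simp) hw hl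
    hrate ht
  rw [mul_zero, zero_mul] at this
  exact sub_eq_zero.mp (abs_nonpos_iff.mp this)

lemma IsSolution.eqOn_of_isVelocity (hγ : 0 < γ) (hv₀ : 0 < v₀) (hg : IsKinetics v₀ V g)
    {u v w : ℝ → ℝ} (hu : Continuous u) (h0 : ∀ x, 0 ≤ u x) {M : ℝ} (hM : ∀ x, |u x| ≤ M)
    (hv : IsSolution γ v₀ V g u v) (hw : IsVelocity γ g u w) : EqOn w v (Ici 0) := by
  obtain ⟨w', hw', he⟩ := hw.exists_isSolution hg
  exact he.trans (hw'.eqOn hγ hv₀ hg hu h0 hM hv)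

/-- The chosen `velocity` is determined only on `[0, ∞)`, and the temperature sees no other times;
uniqueness lets any solution stand in for it. -/
lemma IsSolution.semigroup_eq (hγ : 0 < γ) (hv₀ : 0 < v₀) (hg : IsKinetics v₀ V g)
    {u v : ℝ → ℝ} (hu : Continuous u) (h0 : ∀ x, 0 ≤ u x) {M : ℝ} (hM : ∀ x, |u x| ≤ M)
    (hv : IsSolution γ v₀ V g u v) {t : ℝ} (ht : 0 < t) :
    semigroup γ g t u = profile γ v u t := by
  have hvel : IsVelocity γ g u (velocity γ g u) :=
    Classical.epsilon_spec ⟨v, hv.isVelocity hv₀ h0⟩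
  have he := hv.eqOn_of_isVelocity hγ hv₀ hg hu h0 hM hvel
  ext x
  rw [semigroup, if_neg (not_le.mpr ht), front_congr he ht.le, temperature_congr γ u he ht.le,
    temperature_eq_profile _ _ _ ht]

/-- The semigroup law. -/
lemma semigroup_add (hγ : 0 < γ) (hv₀ : 0 < v₀) (hg : IsKinetics v₀ V g) {u : ℝ → ℝ}
    (hu : Continuous u) (h0 : ∀ x, 0 ≤ u x) {M : ℝ} (hM : ∀ x, |u x| ≤ M) {t r : ℝ}
    (ht : 0 < t) (hr : 0 < r) :
    semigroup γ g t (semigroup γ g r u) = semigroup γ g (r + t) u := by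
  obtain ⟨v, hv⟩ := exists_isSolution hγ hv₀ hg hu h0 hM
  have hs := hv.toIsSpeed
  have hV : 0 < V := hv₀.trans_le hg.pos
  have hc := continuous_profile hγ hv₀ hs hu hM r
  have h0' := profile_nonneg (γ := γ) hv₀ hs h0 r
  have hM' : ∀ x, |profile γ v u r x| ≤ Real.exp (-γ * r) * M + V / √γ := fun x => by
    have := weighted_profile_le hγ hv₀ hs hM le_rfl (le_min (by positivity) (by positivity)) r x
    simpa using this
  have hv' : IsSolution γ v₀ V g (profile γ v u r) fun τ => v (r + τ) :=
    ⟨hs.shift r, fun τ hτ => by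
      rw [profile_profile hγ hv₀ hs hu h0 hM hτ hr]
      exact hv.equation _ (by positivity)⟩
  rw [hv.semigroup_eq hγ hv₀ hg hu h0 hM hr, hv.semigroup_eq hγ hv₀ hg hu h0 hM (by positivity),
    hv'.semigroup_eq hγ hv₀ hg hc h0' hM' ht]
  ext x
  exact profile_profile hγ hv₀ hs hu h0 hM ht hr x

end

noncomputable section

variable {γ v₀ V α β R : ℝ} {g u v φ : ℝ → ℝ}

/-! ### Weighted norms -/

lemma wnorm_le_iff {f : ℝ → ℝ} (hR : 0 ≤ R) :
    wnorm α f ≤ ENNReal.ofReal R ↔ ∀ x, Real.exp (α * |x|) * |f x| ≤ R := by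
  simp only [wnorm, iSup_le_iff, ENNReal.ofReal_le_ofReal_iff hR]

lemma wnormOff_le_iff {f : ℝ → ℝ} (hR : 0 ≤ R) :
    wnormOff α f ≤ ENNReal.ofReal R ↔ ∀ x, x ≠ 0 → Real.exp (α * |x|) * |f x| ≤ R := by
  simp only [wnormOff, iSup_le_iff, ENNReal.ofReal_le_ofReal_iff hR]

lemma wnorm_lt_of_le_half {f : ℝ → ℝ} (hR : 0 < R)
    (h : ∀ x, Real.exp (α * |x|) * |f x| ≤ R / 2) : wnorm α f < ENNReal.ofReal R :=
  ((wnorm_le_iff (by positivity)).mpr h).trans_lt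
    ((ENNReal.ofReal_lt_ofReal_iff hR).mpr (half_lt_self hR))

lemma exists_bound_of_wnorm_lt_top {f : ℝ → ℝ} (h : wnorm α f < ∞) :
    ∃ R, 0 ≤ R ∧ ∀ x, Real.exp (α * |x|) * |f x| ≤ R :=
  ⟨(wnorm α f).toReal, ENNReal.toReal_nonneg, (wnorm_le_iff ENNReal.toReal_nonneg).mp
    (ENNReal.ofReal_toReal h.ne).ge⟩

lemma abs_le_of_weighted (hα : 0 ≤ α) {x y : ℝ} (h : Real.exp (α * |x|) * |y| ≤ R) : |y| ≤ R :=
  le_trans (le_mul_of_one_le_left (abs_nonneg y) (Real.one_le_exp (by positivity))) h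

/-- Smallness on a bounded interval and faster decay imply smallness in the weighted norm. -/
lemma exists_interpolation (C : ℝ) (hαβ : α < β) (hα : 0 ≤ α) {ε : ℝ} (hε : 0 < ε) :
    ∃ r θ, 0 < θ ∧ ∀ x y : ℝ, (|x| ≤ r → |y| ≤ θ) → Real.exp (β * |x|) * |y| ≤ C →
      Real.exp (α * |x|) * |y| ≤ ε := by
  -- Beyond `r` the surplus factor `exp ((β - α) |x|)` exceeds `(β - α) r = C / ε`. Inside, the
  -- weight is at most `exp (α r)`, hence the choice of `θ`.
  set r := C / ε / (β - α) with hr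
  refine ⟨r, ε * Real.exp (-(α * r)), by positivity, fun x y h1 h2 => ?_⟩
  have hb : 0 < β - α := sub_pos.mpr hαβ
  rcases le_total |x| r with hx | hx
  · calc _ ≤ Real.exp (α * r) * (ε * Real.exp (-(α * r))) := by
          gcongr; exact h1 hx
      _ = ε := by rw [Real.exp_neg]; field_simp
  · have h3 : Real.exp (α * |x|) * |y| * Real.exp ((β - α) * |x|) ≤ C := by
      refine le_trans (le_of_eq ?_) h2
      rw [mul_right_comm, ← Real.exp_add]; ring_nf
    have h4 : C / ε ≤ Real.exp ((β - α) * |x|) := by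
      have := Real.add_one_le_exp ((β - α) * |x|)
      have h5 : (β - α) * r ≤ (β - α) * |x| := by gcongr
      rw [hr, mul_div_cancel₀ _ hb.ne'] at h5
      linarith
    rw [div_le_iff₀ hε] at h4
    have hE := Real.exp_pos ((β - α) * |x|)
    nlinarith

/-! ### Action of the semigroup on the phase space -/

/-- The weight makes the heat potential grow at most at the rate `α V + 2 α² ≤ γ / 2 + γ / 8`, which
the loss rate `γ` beats with more than `γ / 4` to spare. -/
lemma weighted_heat_part_le (hγ : 0 < γ) (hv₀ : 0 < v₀) (hv : IsSpeed v₀ V v) (hα : 0 ≤ α)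
    (hα' : α ≤ alphaMin v₀ V γ) (hR : ∀ x, Real.exp (α * |x|) * |u x| ≤ R) {t : ℝ} (ht : 0 ≤ t)
    (x : ℝ) :
    Real.exp (α * |x|) * |Real.exp (-γ * t) * heat t u (x + front v t)| ≤
      2 * R * Real.exp (-(γ / 4) * t) := by
  have hV : 0 < V := hv₀.trans_le hv.le
  have hR0 : 0 ≤ R := le_trans (by positivity) (hR 0)
  have h1 : α ≤ v₀ / 8 := hα'.trans (min_le_left _ _)
  have h2 : α ≤ γ / (2 * V) := hα'.trans (min_le_right _ _)
  rw [le_div_iff₀ (by positivity)] at h2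
  have h3 : α ^ 2 ≤ γ / 16 := by nlinarith [hv.le]
  have h4 := weighted_heat_le hα hR ht x (front v t)
  rw [abs_mul, Real.abs_exp, mul_left_comm]
  calc _ ≤ Real.exp (-γ * t) * (2 * R * Real.exp (α * |front v t| + 2 * α ^ 2 * t)) := by gcongr
    _ = 2 * R * Real.exp (-γ * t + (α * |front v t| + 2 * α ^ 2 * t)) := by
        rw [Real.exp_add (-γ * t)]; ring
    _ ≤ _ := by
        gcongr
        have h5 := mul_le_mul_of_nonneg_left (hv.abs_front_le hv₀ ht) hα
        nlinarith [mul_le_mul_of_nonneg_right h2 ht, mul_le_mul_of_nonneg_right h3 ht,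
          mul_nonneg hγ.le ht]

lemma weighted_profile_le_of_weighted (hγ : 0 < γ) (hv₀ : 0 < v₀) (hv : IsSpeed v₀ V v)
    (hα : 0 ≤ α) (hα' : α ≤ alphaMin v₀ V γ) (hR : ∀ x, Real.exp (α * |x|) * |u x| ≤ R) {t : ℝ}
    (ht : 0 ≤ t) (x : ℝ) :
    Real.exp (α * |x|) * |profile γ v u t x| ≤ 2 * R + V / √γ := by
  have hR0 : 0 ≤ R := le_trans (by positivity) (hR 0)
  have h1 := weighted_heat_part_le hγ hv₀ hv hα hα' hR ht x
  have h2 := weighted_layer_le hγ hv₀ hv hα hα' t x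
  have h3 : Real.exp (-(γ / 4) * t) ≤ 1 := by
    rw [Real.exp_le_one_iff]; nlinarith [mul_nonneg hγ.le ht]
  calc _ ≤ Real.exp (α * |x|) * |Real.exp (-γ * t) * heat t u (x + front v t)| +
        Real.exp (α * |x|) * |layer γ v t x| := by
        rw [← mul_add]; gcongr; exact abs_add_le _ _
    _ ≤ 2 * R * 1 + V / √γ := add_le_add (h1.trans (by gcongr)) h2
    _ = _ := by ring

lemma semigroup_mem_phaseSpace (hγ : 0 < γ) (hv₀ : 0 < v₀) (hg : IsKinetics v₀ V g)
    (hα : 0 ≤ α) (hα' : α ≤ alphaMin v₀ V γ) (hu : u ∈ phaseSpace α) {t : ℝ} (ht : 0 < t) :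
    semigroup γ g t u ∈ phaseSpace α := by
  obtain ⟨R, hR0, hR⟩ := exists_bound_of_wnorm_lt_top hu.1.2
  have hM : ∀ x, |u x| ≤ R := fun x => abs_le_of_weighted hα (hR x)
  obtain ⟨v, hv⟩ := exists_isSolution hγ hv₀ hg hu.1.1 hu.2 hM
  have hV : 0 < V := hv₀.trans_le hg.pos
  rw [hv.semigroup_eq hγ hv₀ hg hu.1.1 hu.2 hM ht]
  refine ⟨⟨continuous_profile hγ hv₀ hv.toIsSpeed hu.1.1 hM t, ?_⟩,
    profile_nonneg hv₀ hv.toIsSpeed hu.2 t⟩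
  exact ((wnorm_le_iff (by positivity)).mpr fun x =>
    weighted_profile_le_of_weighted hγ hv₀ hv.toIsSpeed hα hα' hR ht.le x).trans_lt
    ENNReal.ofReal_lt_top

/-- Continuity of the semigroup at states that decay faster than the weight requires. -/
lemma exists_semigroup_close (hγ : 0 < γ) (hv₀ : 0 < v₀) (hg : IsKinetics v₀ V g) (hα : 0 ≤ α)
    (hαβ : α < β) (hβ : β ≤ alphaMin v₀ V γ) (hφ : Continuous φ) (hφ0 : ∀ x, 0 ≤ φ x)
    (hφβ : ∀ x, Real.exp (β * |x|) * |φ x| ≤ R) {t : ℝ} (ht : 0 < t) {ε : ℝ} (hε : 0 < ε) :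
    ∃ δ, 0 < δ ∧ ∀ f ∈ phaseSpace α, (∀ x, Real.exp (α * |x|) * |f x - φ x| ≤ δ) →
      ∀ x, Real.exp (α * |x|) * |semigroup γ g t f x - semigroup γ g t φ x| ≤ ε := by
  have hV : 0 < V := hv₀.trans_le hg.pos
  have hR0 : 0 ≤ R := le_trans (by positivity) (hφβ 0)
  have hβ0 : 0 ≤ β := hα.trans hαβ.le
  have hM : ∀ x, |φ x| ≤ R := fun x => abs_le_of_weighted hβ0 (hφβ x)
  obtain ⟨L, hL0, hL⟩ := hg.exists_lipschitz
  have hA0 := stabilityConst_nonneg (γ := γ) hR0 hV.le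
  -- The stability constant involves the bound of one of the two states only. Taking `φ` for it
  -- fixes `l` before `f` is known.
  obtain ⟨l, hl, hrate⟩ := exists_rate (mul_nonneg hL0 hA0)
  obtain ⟨w, hw⟩ := exists_isSolution hγ hv₀ hg hφ hφ0 hM
  obtain ⟨r, θ, hθ, hint⟩ := exists_interpolation (2 * (2 * R + V / √γ)) hαβ hα (half_pos hε)
  set K := stabilityConst γ V R / √l * (2 * L * Real.exp (l * t)) with hK
  have hK0 : 0 ≤ K := by positivity
  refine ⟨min (ε / 4) (θ / (K + 1)), by positivity, fun f hf hfφ x => ?_⟩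
  set δ := min (ε / 4) (θ / (K + 1)) with hδ
  have hδ0 : 0 < δ := by positivity
  obtain ⟨N, _, hN'⟩ := exists_bound_of_wnorm_lt_top hf.1.2
  have hN : ∀ x, |f x| ≤ N := fun x => abs_le_of_weighted hα (hN' x)
  obtain ⟨v, hv⟩ := exists_isSolution hγ hv₀ hg hf.1.1 hf.2 hN
  rw [hv.semigroup_eq hγ hv₀ hg hf.1.1 hf.2 hN ht, hw.semigroup_eq hγ hv₀ hg hφ hφ0 hM ht]
  have hvw := fun τ (hτ : 0 ≤ τ) => hv.abs_sub_le hγ hv₀ hg hL0 hL hf.1.1 hf.2 hN hφ hφ0 hM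
    (fun x => abs_le_of_weighted hα (hfφ x)) hw hl hrate hτ
  -- The same state `φ` driven along two nearby paths: the stability estimate controls the
  -- difference only in the unweighted norm, and its decay at the rate `β` upgrades this to the
  -- weight `α`.
  have hsmall : |profile γ v φ t x - profile γ w φ t x| ≤ θ := by
    have h := abs_profile_sub_le hγ hv₀ hv.toIsSpeed hw.toIsSpeed hφ hM hφ hM (η := 0)
      (fun x => by simp) (by positivity : 0 ≤ 2 * L * δ) hl ht (fun τ hτ _ => hvw τ hτ) x
    have h2 : δ ≤ θ / (K + 1) := min_le_right _ _
    rw [le_div_iff₀ (by positivity)] at h2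
    calc _ ≤ _ := h
      _ = K * δ := by rw [hK, stabilityConst]; ring
      _ ≤ θ := by linarith
  have hdecay : Real.exp (β * |x|) * |profile γ v φ t x - profile γ w φ t x| ≤
      2 * (2 * R + V / √γ) := by
    have h1 := weighted_profile_le_of_weighted hγ hv₀ hv.toIsSpeed hβ0 hβ hφβ ht.le x
    have h2 := weighted_profile_le_of_weighted hγ hv₀ hw.toIsSpeed hβ0 hβ hφβ ht.le x
    have h3 := mul_le_mul_of_nonneg_left (abs_sub (profile γ v φ t x) (profile γ w φ t x))
      (Real.exp_pos (β * |x|)).le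
    linarith
  have h1 := hint x _ (fun _ => hsmall) hdecay
  have h2 := weighted_heat_part_le (u := fun x => f x - φ x) hγ hv₀ hv.toIsSpeed hα
    (hαβ.le.trans hβ) hfφ ht.le x
  have h3 : Real.exp (-(γ / 4) * t) ≤ 1 := by
    rw [Real.exp_le_one_iff]; nlinarith [mul_pos hγ ht]
  have h4 : 2 * δ * Real.exp (-(γ / 4) * t) ≤ 2 * δ * 1 := by gcongr
  have h5 : δ ≤ ε / 4 := min_le_left _ _
  have e : profile γ v f t x - profile γ w φ t x =
      Real.exp (-γ * t) * heat t (fun x => f x - φ x) (x + front v t) +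
        (profile γ v φ t x - profile γ w φ t x) := by
    rw [← heat_sub hf.1.1 hN hφ hM]; unfold profile; ring
  rw [e]
  have h6 := mul_le_mul_of_nonneg_left (abs_add_le
    (Real.exp (-γ * t) * heat t (fun x => f x - φ x) (x + front v t))
    (profile γ v φ t x - profile γ w φ t x)) (Real.exp_pos (α * |x|)).le
  rw [mul_add] at h6
  linarith

/-! ### Asymptotic compactness -/

/-- Limits of single layer potentials along an ultrafilter. -/
lemma exists_ultrafilter_limit (hγ : 0 < γ) (hv₀ : 0 < v₀) {w : ℕ → ℝ → ℝ}
    (hw : ∀ n, IsSpeed v₀ V (w n)) (s : ℕ → ℝ) (hα : 0 ≤ α) (hα' : α < alphaMin v₀ V γ)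
    (U : Ultrafilter ℕ) :
    ∃ ψ ∈ phaseSpace α, ∀ ε, 0 < ε → ∀ᶠ n in (U : Filter ℕ), ∀ x,
      Real.exp (α * |x|) * |layer γ (w n) (s n) x - ψ x| ≤ ε := by
  have hV : 0 < V := hv₀.trans_le (hw 0).le
  have hmin0 : 0 ≤ alphaMin v₀ V γ := hα.trans hα'.le
  set a := fun n => layer γ (w n) (s n) with ha
  have hdecay : ∀ (n : ℕ) (x : ℝ), Real.exp (alphaMin v₀ V γ * |x|) * |a n x| ≤ V / √γ := fun n x =>
    weighted_layer_le hγ hv₀ (hw n) hmin0 le_rfl (s n) x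
  -- Values lie in a compact interval, so an ultrafilter gives all pointwise limits at once, without
  -- extracting subsequences.
  have hlim : ∀ x, ∃ y, Tendsto (fun n => a n x) U (𝓝 y) := fun x => by
    have h := (isCompact_Icc (a := -(V / √γ)) (b := V / √γ)).ultrafilter_le_nhds
      (U.map fun n => a n x) (by
        rw [le_principal_iff]
        have hall : ∀ᶠ n in (U : Filter ℕ), a n x ∈ Icc (-(V / √γ)) (V / √γ) :=
          Eventually.of_forall fun n => abs_le.mp (abs_le_of_weighted hmin0 (hdecay n x))
        exact hall)
    obtain ⟨y, _, hy⟩ := h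
    exact ⟨y, hy⟩
  choose ψ hψ using hlim
  have hψd : ∀ x, Real.exp (alphaMin v₀ V γ * |x|) * |ψ x| ≤ V / √γ := fun x =>
    le_of_tendsto' (((hψ x).abs).const_mul _) fun n => hdecay n x
  have hψh : ∀ x y, |ψ x - ψ y| ≤ holderConst γ V * √|x - y| := fun x y =>
    le_of_tendsto' (((hψ x).sub (hψ y)).abs) fun n => abs_layer_sub_le hγ hv₀ (hw n) (s n) x y
  have hroot : ∀ x, Tendsto (fun y => holderConst γ V * √|y - x|) (𝓝 x) (𝓝 0) := fun x => by
    have : Continuous fun y => holderConst γ V * √|y - x| := by fun_prop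
    simpa using this.tendsto x
  have hψc : Continuous ψ := by
    refine continuous_iff_continuousAt.mpr fun x => ?_
    rw [ContinuousAt, tendsto_iff_dist_tendsto_zero]
    exact squeeze_zero (fun _ => dist_nonneg) (fun y => hψh y x) (hroot x)
  refine ⟨ψ, ⟨⟨hψc, ?_⟩, fun x => ge_of_tendsto' (hψ x) fun n =>
    layer_nonneg hv₀ (hw n) _ _⟩, fun ε hε => ?_⟩
  · refine ((wnorm_le_iff (by positivity : 0 ≤ V / √γ)).mpr fun x => ?_).trans_lt
      ENNReal.ofReal_lt_top
    refine le_trans ?_ (hψd x)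
    gcongr
  obtain ⟨r, θ, hθ, hint⟩ := exists_interpolation (2 * (V / √γ)) hα' hα hε
  have hρ : ∃ ρ, 0 < ρ ∧ ∀ y x : ℝ, dist x y < ρ → holderConst γ V * √|x - y| ≤ θ / 3 := by
    obtain ⟨ρ, hρ, h⟩ := Metric.eventually_nhds_iff.mp
      ((hroot 0).eventually (gt_mem_nhds (by positivity : 0 < θ / 3)))
    refine ⟨ρ, hρ, fun y x hxy => ?_⟩
    have := h (y := x - y) (by simpa [Real.dist_eq] using hxy)
    simpa using this.le
  obtain ⟨ρ, hρ, hclose⟩ := hρ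
  -- Arzelà–Ascoli in direct form: closeness on a finite net spreads over `[-r, r]` by the common
  -- Hölder bound, and outside the faster decay takes over.
  obtain ⟨T, _, hTf, hT⟩ := (isCompact_Icc (a := -r) (b := r)).finite_cover_balls hρ
  have hev : ∀ᶠ n in (U : Filter ℕ), ∀ y ∈ T, |a n y - ψ y| < θ / 3 := by
    rw [eventually_all_finite hTf]
    intro y _
    have := Metric.tendsto_nhds.mp (hψ y) (θ / 3) (by positivity)
    simpa [Real.dist_eq] using this
  filter_upwards [hev] with n hn x
  refine hint x _ (fun hx => ?_) ?_
  · obtain ⟨y, hyT, hxy⟩ := mem_iUnion₂.mp (hT (mem_Icc.mpr (abs_le.mp hx)))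
    have h1 := (abs_layer_sub_le (γ := γ) hγ hv₀ (hw n) (s n) x y).trans
      (hclose y x (Metric.mem_ball.mp hxy))
    have h2 := (hψh x y).trans (hclose y x (Metric.mem_ball.mp hxy))
    have h3 := hn y hyT
    simp only [ha] at h3
    rw [abs_lt] at h3
    rw [abs_le] at *
    constructor <;> linarith [h1.1, h1.2, h2.1, h2.2, h3.1, h3.2]
  · have h1 := hdecay n x
    have h2 := hψd x
    have h3 := mul_le_mul_of_nonneg_left (abs_sub (a n x) (ψ x))
      (Real.exp_pos (alphaMin v₀ V γ * |x|)).le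
    simp only [ha] at h1 h3
    linarith

/-- Every sequence of states with times tending to infinity has a limit point. -/
lemma exists_limit_state (hγ : 0 < γ) (hv₀ : 0 < v₀) (hg : IsKinetics v₀ V g) (hα : 0 ≤ α)
    (hα' : α < alphaMin v₀ V γ) {f : ℕ → ℝ → ℝ} (hf : ∀ n, f n ∈ phaseSpace α)
    (hR0 : 0 ≤ R) (hfR : ∀ n, wnorm α (f n) ≤ ENNReal.ofReal R) {s : ℕ → ℝ}
    (hs0 : ∀ n, 0 < s n) (hs : Tendsto s atTop atTop) :
    ∃ ψ ∈ phaseSpace α, ∃ U : Ultrafilter ℕ, (U : Filter ℕ) ≤ atTop ∧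
      ∀ ε, 0 < ε → ∀ᶠ n in (U : Filter ℕ), ∀ x,
        Real.exp (α * |x|) * |semigroup γ g (s n) (f n) x - ψ x| ≤ ε := by
  have hR : ∀ n x, Real.exp (α * |x|) * |f n x| ≤ R := fun n => (wnorm_le_iff hR0).mp (hfR n)
  have hM : ∀ n x, |f n x| ≤ R := fun n x => abs_le_of_weighted hα (hR n x)
  choose w hw using fun n => exists_isSolution hγ hv₀ hg (hf n).1.1 (hf n).2 (hM n)
  obtain ⟨ψ, hψ, hlim⟩ := exists_ultrafilter_limit hγ hv₀ (fun n => (hw n).toIsSpeed) s hα hα'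
    (hyperfilter ℕ)
  have hU : ((hyperfilter ℕ : Ultrafilter ℕ) : Filter ℕ) ≤ atTop := by
    rw [← Nat.cofinite_eq_atTop]; exact hyperfilter_le_cofinite
  refine ⟨ψ, hψ, hyperfilter ℕ, hU, fun ε hε => ?_⟩
  -- The heat parts tend to zero in the weighted norm, uniformly over the ball, so only the layers
  -- decide the limit.
  have hexp : Tendsto (fun n => 2 * R * Real.exp (-(γ / 4) * s n)) atTop (𝓝 0) := by
    have h1 : Tendsto (fun n => -(γ / 4) * s n) atTop atBot :=
      hs.const_mul_atTop_of_neg (by linarith)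
    simpa using (Real.tendsto_exp_atBot.comp h1).const_mul (2 * R)
  filter_upwards [hlim (ε / 2) (half_pos hε),
    hU (hexp.eventually (gt_mem_nhds (half_pos hε)))] with n hn1 hn2 x
  rw [(hw n).semigroup_eq hγ hv₀ hg (hf n).1.1 (hf n).2 (hM n) (hs0 n)]
  have h1 := weighted_heat_part_le hγ hv₀ (hw n).toIsSpeed hα hα'.le (hR n) (hs0 n).le x
  have h2 := hn1 x
  have h3 := mul_le_mul_of_nonneg_left (abs_add_le
    (Real.exp (-γ * s n) * heat (s n) (f n) (x + front (w n) (s n)))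
    (layer γ (w n) (s n) x - ψ x)) (Real.exp_pos (α * |x|)).le
  rw [mul_add] at h3
  rw [profile, add_sub_assoc]
  linarith

/-! ### The attractor -/

variable {δ : ℝ}

lemma tendsto_exp_neg_mul (hγ : 0 < γ) (c : ℝ) :
    Tendsto (fun t => c * Real.exp (-γ * t)) atTop (𝓝 0) := by
  have h1 : Tendsto (fun t => -γ * t) atTop atBot :=
    tendsto_id.const_mul_atTop_of_neg (by linarith)
  simpa using (Real.tendsto_exp_atBot.comp h1).const_mul c

/-- At a fixed `x`, approximate `φ` by states of large age. Their heat part is negligible there even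
after multiplication by `exp (β |x|)`, and the layer bound is all that remains; this removes `δ`
from the radius and allows every `β` up to `alphaMin`. -/
lemma attractor_weighted_le (hγ : 0 < γ) (hv₀ : 0 < v₀) (hg : IsKinetics v₀ V g) (hα : 0 ≤ α)
    (hδ : 0 < δ) (hβ : 0 ≤ β) (hβ' : β ≤ alphaMin v₀ V γ) (hφ : φ ∈ attractor γ V g α δ)
    (x : ℝ) : Real.exp (β * |x|) * |φ x| ≤ V / √γ := by
  have hV : 0 < V := hv₀.trans_le hg.pos
  set M := V / √γ + δ with hMdef
  have hM0 : 0 ≤ M := by positivity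
  refine le_of_forall_pos_le_add fun ε hε => ?_
  set E := Real.exp (β * |x|) with hE
  have hEp : 0 < E := Real.exp_pos _
  obtain ⟨τ, hτ, hτ0⟩ := (((tendsto_exp_neg_mul hγ (E * M)).eventually
    (gt_mem_nhds (half_pos hε))).and (eventually_gt_atTop (0 : ℝ))).exists
  obtain ⟨t, hτt, u, ⟨hu, huM⟩, hlt⟩ := hφ.2 τ (ε / (2 * E)) (by positivity)
  have ht : 0 < t := hτ0.trans_le hτt
  have hR := (wnorm_le_iff hM0).mp huM
  have hM : ∀ x, |u x| ≤ M := fun x => abs_le_of_weighted hα (hR x)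
  obtain ⟨v, hv⟩ := exists_isSolution hγ hv₀ hg hu.1.1 hu.2 hM
  rw [hv.semigroup_eq hγ hv₀ hg hu.1.1 hu.2 hM ht] at hlt
  have h1 := abs_le_of_weighted hα ((wnorm_le_iff (by positivity)).mp hlt.le x)
  have h2 := weighted_profile_le hγ hv₀ hv.toIsSpeed hM hβ hβ' t x
  have h3 : Real.exp (-γ * t) ≤ Real.exp (-γ * τ) := by
    rw [Real.exp_le_exp]; nlinarith
  have h4 : E * (Real.exp (-γ * t) * M) ≤ E * M * Real.exp (-γ * τ) := by
    calc _ = E * M * Real.exp (-γ * t) := by ring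
      _ ≤ _ := by gcongr
  have h5 : |φ x| ≤ |profile γ v u t x| + ε / (2 * E) := by
    have := abs_sub_abs_le_abs_sub (φ x) (profile γ v u t x)
    rw [abs_sub_comm] at this
    linarith
  have h6 : E * |φ x| ≤ E * |profile γ v u t x| + ε / 2 := by
    calc _ ≤ E * (|profile γ v u t x| + ε / (2 * E)) := by gcongr
      _ = _ := by field_simp
  linarith

/-- Continuity at `φ` is available because attractor elements decay at the rate `alphaMin > α`:
states of age `r` close to `φ` become states of age `r + t` close to the image. -/
lemma semigroup_mem_attractor (hγ : 0 < γ) (hv₀ : 0 < v₀) (hg : IsKinetics v₀ V g)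
    (hα : 0 ≤ α) (hα' : α < alphaMin v₀ V γ) (hδ : 0 < δ) (hφ : φ ∈ attractor γ V g α δ) {t : ℝ}
    (ht : 0 < t) : semigroup γ g t φ ∈ attractor γ V g α δ := by
  have hV : 0 < V := hv₀.trans_le hg.pos
  refine ⟨semigroup_mem_phaseSpace hγ hv₀ hg hα hα'.le hφ.1 ht, fun τ η hη => ?_⟩
  obtain ⟨d, hd, hclose⟩ := exists_semigroup_close hγ hv₀ hg hα hα' le_rfl hφ.1.1.1 hφ.1.2
    (attractor_weighted_le hγ hv₀ hg hα hδ (hα.trans hα'.le) le_rfl hφ) ht (half_pos hη)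
  obtain ⟨r, hτr, u, hu, hlt⟩ := hφ.2 (max τ 1) d hd
  have hr : 0 < r := lt_of_lt_of_le one_pos ((le_max_right _ _).trans hτr)
  refine ⟨r + t, by linarith [le_max_left τ 1], u, hu, ?_⟩
  have hM : ∀ x, |u x| ≤ V / √γ + δ := fun x =>
    abs_le_of_weighted hα ((wnorm_le_iff (by positivity)).mp hu.2 x)
  have h := hclose _ (semigroup_mem_phaseSpace hγ hv₀ hg hα hα'.le hu.1 hr)
    ((wnorm_le_iff hd.le).mp hlt.le)
  rw [semigroup_add hγ hv₀ hg hu.1.1.1 hu.1.2 hM ht hr] at h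
  exact wnorm_lt_of_le_half hη h

/-- Choose states of age `r n` converging to `φ` and go back by `t`. A limit point of the states of
age `r n - t` lies in the attractor, and continuity of the semigroup at it shows that its image is
`φ`. -/
lemma exists_preimage_attractor (hγ : 0 < γ) (hv₀ : 0 < v₀) (hg : IsKinetics v₀ V g)
    (hα : 0 ≤ α) (hα' : α < alphaMin v₀ V γ) (hδ : 0 < δ) (hφ : φ ∈ attractor γ V g α δ) {t : ℝ}
    (ht : 0 < t) : ∃ ψ ∈ attractor γ V g α δ, semigroup γ g t ψ = φ := by
  have hV : 0 < V := hv₀.trans_le hg.pos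
  have hch : ∀ n : ℕ, ∃ r : ℝ, (n : ℝ) + 1 + t ≤ r ∧ ∃ u ∈ absorbingBall γ V α δ,
      wnorm α (fun x => semigroup γ g r u x - φ x) < ENNReal.ofReal (1 / ((n : ℝ) + 1)) :=
    fun n => hφ.2 _ _ (by positivity)
  choose r hr u hu hlt using hch
  have hs0 : ∀ n, 0 < r n - t := fun n => by
    have := hr n; have : (0 : ℝ) ≤ n := n.cast_nonneg; linarith
  have hsn : ∀ n : ℕ, (n : ℝ) ≤ r n - t := fun n => by have := hr n; linarith
  have hs : Tendsto (fun n => r n - t) atTop atTop :=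
    tendsto_atTop_mono hsn tendsto_natCast_atTop_atTop
  obtain ⟨ψ, hψ, U, hU, hlim⟩ := exists_limit_state hγ hv₀ hg hα hα' (fun n => (hu n).1)
    (by positivity : 0 ≤ V / √γ + δ) (fun n => (hu n).2) hs0 hs
  have hM : ∀ n x, |u n x| ≤ V / √γ + δ := fun n x =>
    abs_le_of_weighted hα ((wnorm_le_iff (by positivity)).mp (hu n).2 x)
  have hψA : ψ ∈ attractor γ V g α δ := by
    refine ⟨hψ, fun τ η hη => ?_⟩
    obtain ⟨n, hn1, hn2⟩ := ((hlim (η / 2) (half_pos hη)).and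
      (hU (hs.eventually (eventually_ge_atTop τ)))).exists
    exact ⟨r n - t, hn2, u n, hu n, wnorm_lt_of_le_half hη hn1⟩
  refine ⟨ψ, hψA, funext fun x => ?_⟩
  rw [← sub_eq_zero, ← abs_nonpos_iff]
  refine le_of_forall_pos_le_add fun ε hε => ?_
  obtain ⟨d, hd, hclose⟩ := exists_semigroup_close hγ hv₀ hg hα hα' le_rfl hψ.1.1 hψ.2
    (attractor_weighted_le hγ hv₀ hg hα hδ (hα.trans hα'.le) le_rfl hψA) ht (half_pos hε)
  have hinv : ∀ᶠ n : ℕ in atTop, 1 / ((n : ℝ) + 1) < ε / 2 :=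
    tendsto_one_div_add_atTop_nhds_zero_nat.eventually (gt_mem_nhds (half_pos hε))
  obtain ⟨n, hn1, hn2⟩ := ((hlim d hd).and (hU hinv)).exists
  have h := abs_le_of_weighted hα (hclose _
    (semigroup_mem_phaseSpace hγ hv₀ hg hα hα'.le (hu n).1 (hs0 n)) hn1 x)
  rw [semigroup_add hγ hv₀ hg (hu n).1.1.1 (hu n).1.2 (hM n) ht (hs0 n), sub_add_cancel] at h
  have h2 := abs_le_of_weighted hα ((wnorm_le_iff (by positivity)).mp (hlt n).le x)
  rw [abs_le] at h h2
  rw [abs_le]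
  constructor <;> linarith [h.1, h.2, h2.1, h2.2]

lemma image_semigroup_attractor (hγ : 0 < γ) (hv₀ : 0 < v₀) (hg : IsKinetics v₀ V g)
    (hα : 0 ≤ α) (hα' : α < alphaMin v₀ V γ) (hδ : 0 < δ) {t : ℝ} (ht : 0 ≤ t) :
    semigroup γ g t '' attractor γ V g α δ = attractor γ V g α δ := by
  rcases ht.eq_or_lt with rfl | h
  · have : semigroup γ g 0 = id := by
      ext u x; simp [semigroup]
    rw [this, image_id]
  · refine Subset.antisymm ?_ fun φ hφ => ?_
    · rintro _ ⟨φ, hφ, rfl⟩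
      exact semigroup_mem_attractor hγ hv₀ hg hα hα' hδ hφ h
    · exact exists_preimage_attractor hγ hv₀ hg hα hα' hδ hφ h

/-- Elements of the attractor are profiles with arbitrarily long past. -/
lemma exists_profile_eq (hγ : 0 < γ) (hv₀ : 0 < v₀) (hg : IsKinetics v₀ V g)
    (hα : 0 ≤ α) (hα' : α < alphaMin v₀ V γ) (hδ : 0 < δ) (hφ : φ ∈ attractor γ V g α δ) {t : ℝ}
    (ht : 0 < t) : ∃ v ψ, IsSpeed v₀ V v ∧ Continuous ψ ∧ (∀ x, |ψ x| ≤ V / √γ) ∧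
      φ = profile γ v ψ t := by
  obtain ⟨ψ, hψ, rfl⟩ := exists_preimage_attractor hγ hv₀ hg hα hα' hδ hφ ht
  have hM : ∀ x, |ψ x| ≤ V / √γ := fun x =>
    abs_le_of_weighted hα (attractor_weighted_le hγ hv₀ hg hα hδ hα hα'.le hψ x)
  obtain ⟨v, hv⟩ := exists_isSolution hγ hv₀ hg hψ.1.1.1 hψ.1.2 hM
  exact ⟨v, ψ, hv.toIsSpeed, hψ.1.1.1, hM, hv.semigroup_eq hγ hv₀ hg hψ.1.1.1 hψ.1.2 hM ht⟩

/-- The path and the initial state representing `φ` change with `t`, but their bounds do not, so the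
heat contribution disappears as `t → ∞` while `deriv φ` stays fixed. -/
lemma attractor_weighted_deriv_le (hγ : 0 < γ) (hv₀ : 0 < v₀) (hg : IsKinetics v₀ V g)
    (hα : 0 ≤ α) (hα' : α < alphaMin v₀ V γ) (hδ : 0 < δ) (hβ : 0 ≤ β)
    (hβ' : β ≤ alphaMin v₀ V γ) (hφ : φ ∈ attractor γ V g α δ) {x : ℝ} (hx : x ≠ 0) :
    Real.exp (β * |x|) * |deriv φ x| ≤ V * (2 + V / (3 * v₀)) := by
  have hlim := (tendsto_exp_neg_mul hγ (Real.exp (β * |x|) * (V / √γ))).add_const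
    (V * (2 + V / (3 * v₀)))
  rw [zero_add] at hlim
  refine ge_of_tendsto hlim ?_
  filter_upwards [eventually_ge_atTop 1] with t ht
  obtain ⟨v, ψ, hv, hψ, hM, rfl⟩ := exists_profile_eq hγ hv₀ hg hα hα' hδ hφ
    (by linarith : 0 < t)
  rw [(hasDerivAt_profile hγ hv₀ hv hψ hM (by linarith) hx).deriv]
  refine (weighted_profileDeriv_le hγ hv₀ hv hM ht hβ hβ' hx).trans (le_of_eq ?_)
  ring

lemma attractor_subset_spaceC1 (hγ : 0 < γ) (hv₀ : 0 < v₀) (hg : IsKinetics v₀ V g)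
    (hα : 0 ≤ α) (hα' : α < alphaMin v₀ V γ) (hδ : 0 < δ) (hβ : 0 ≤ β)
    (hβ' : β ≤ alphaMin v₀ V γ) : attractor γ V g α δ ⊆ spaceC1 β := fun φ hφ => by
  have hV : 0 < V := hv₀.trans_le hg.pos
  obtain ⟨v, ψ, hv, hψ, hM, he⟩ := exists_profile_eq hγ hv₀ hg hα hα' hδ hφ one_pos
  have hC := contDiffOn_profile hγ hv₀ hv hψ hM one_pos
  rw [← he] at hC
  refine ⟨⟨hφ.1.1.1, ?_⟩, hC.1, hC.2, ?_⟩
  · exact ((wnorm_le_iff (by positivity)).mpr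
      (attractor_weighted_le hγ hv₀ hg hα hδ hβ hβ' hφ)).trans_lt ENNReal.ofReal_lt_top
  · exact ((wnormOff_le_iff (by positivity)).mpr fun x hx =>
      attractor_weighted_deriv_le hγ hv₀ hg hα hα' hδ hβ hβ' hφ hx).trans_lt
      ENNReal.ofReal_lt_top

end

end FreeInterface

/-! ### The main theorem. -/

theorem mainTheorem6 (γ v₀ V : ℝ) (hγ : 0 < γ) (hv₀ : 0 < v₀) (hV : 0 < V)
    (g : ℝ → ℝ) (hg : FreeInterface.IsKinetics v₀ V g)
    (α : ℝ) (hα : 0 ≤ α) (hα' : α < FreeInterface.alphaMin v₀ V γ)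
    (δ : ℝ) (hδ : 0 < δ) :
    -- the velocity, hence the semigroup, is well defined on the phase space
    (∀ u₀ ∈ FreeInterface.phaseSpace α, ∃ v, FreeInterface.IsVelocity γ g u₀ v ∧
      ∀ w, FreeInterface.IsVelocity γ g u₀ w → Set.EqOn w v (Set.Ici 0)) ∧
    -- the semigroup maps the attractor onto itself
    (∀ t : ℝ, 0 ≤ t →
      FreeInterface.semigroup γ g t '' FreeInterface.attractor γ V g α δ
        = FreeInterface.attractor γ V g α δ) ∧
    -- regularity and bounds for the elements of the attractor
    (∀ φ ∈ FreeInterface.attractor γ V g α δ,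
      DifferentiableOn ℝ φ (Set.Iic 0) ∧ DifferentiableOn ℝ φ (Set.Ici 0) ∧
      FreeInterface.wnorm α φ ≤ ENNReal.ofReal (V / √γ) ∧
      FreeInterface.wnormOff α (deriv φ)
        ≤ ENNReal.ofReal (FreeInterface.derivBound v₀ V α γ)) ∧
    FreeInterface.derivBound v₀ V α γ
      ≤ FreeInterface.derivBound v₀ V (FreeInterface.alphaMin v₀ V γ) γ ∧
    -- inclusion in the spaces of differentiable functions with faster decay
    (∀ ε : ℝ, 0 < ε → α ≤ FreeInterface.alphaMin v₀ V γ - ε →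
      FreeInterface.attractor γ V g α δ
        ⊆ FreeInterface.spaceC1 (FreeInterface.alphaMin v₀ V γ - ε)) := by
  open FreeInterface in
  refine ⟨fun u₀ hu => ?_, fun t ht => image_semigroup_attractor hγ hv₀ hg hα hα' hδ ht,
    fun φ hφ => ?_, derivBound_mono hv₀ hV hα'.le, fun ε hε h =>
      attractor_subset_spaceC1 hγ hv₀ hg hα hα' hδ (hα.trans h) (by linarith)⟩
  · obtain ⟨R, -, hR⟩ := exists_bound_of_wnorm_lt_top hu.1.2
    have hM : ∀ x, |u₀ x| ≤ R := fun x => abs_le_of_weighted hα (hR x)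
    obtain ⟨v, hv⟩ := exists_isSolution hγ hv₀ hg hu.1.1 hu.2 hM
    exact ⟨v, hv.isVelocity hv₀ hu.2, fun w hw =>
      hv.eqOn_of_isVelocity hγ hv₀ hg hu.1.1 hu.2 hM hw⟩
  · have hC := attractor_subset_spaceC1 hγ hv₀ hg hα hα' hδ hα hα'.le hφ
    have hslope : V * (2 + V / (3 * v₀)) ≤ derivBound v₀ V α γ := slope_const_le hv₀ hg.pos hα
    refine ⟨hC.2.1.differentiableOn one_ne_zero, hC.2.2.1.differentiableOn one_ne_zero,
      (wnorm_le_iff (by positivity)).mpr (attractor_weighted_le hγ hv₀ hg hα hδ hα hα'.le hφ),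
      (wnormOff_le_iff (le_trans (by positivity) hslope)).mpr fun x hx => ?_⟩
    exact (attractor_weighted_deriv_le hγ hv₀ hg hα hα' hδ hα hα'.le hφ hx).trans hslope
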